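/- Setting. Let $(\Lambda,d_\Lambda)$ be a bounded metric space with a finite Borel measure $\rho$, $T:\Lambda\to\Lambda$ a nonsingular transformation, $Y\subset\Lambda$ a measurable subset with $\rho(Y)>0$, $\alpha$ an at most countable measurable partition of $Y$, and $\tau:Y\to\{1,2,\dots\}$ an integrable function, constant on each $a\in\alpha$, such that $F=T^\tau$, $Fy=T^{\tau(y)}y$, maps $Y$ to $Y$. Suppose that $T$ is nonuniformly expanding: there are constants $\beta>1$, $\eta\in(0,1]$, $C_1\ge1$ such that for each $a\in\alpha$, (1) $F$ restricts to a bijection, modulo null sets, from $a$ onto $Y$; (2) $d_\Lambda(Fx,Fy)\ge\beta\,d_\Lambda(x,y)$ for all $x,y\in a$; (3) $d_\Lambda(T^\ell x,T^\ell y)\le C_1d_\Lambda(Fx,Fy)$ for all $x,y\in a$, $0\le\ell<\tau(a)$; (4) $\zeta_0=\frac{d\rho|_Y}{d\rho|_Y\circ F}$ satisfies $|\log\zeta_0(x)-\log\zeta_0(y)|\le C_1d_\Lambda(Fx,Fy)^\eta$ for all $x,y\in a$. Let $\mu_Y$ be the (unique) $F$-invariant probability measure on $Y$ that is absolutely continuous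 with respect to $\rho|_Y$, and assume that $\tau\in L^p(Y,\mu_Y)$ for some real $p\ge2$; write $|\tau|_p$ for the norm in $L^p(Y,\mu_Y)$. Let $\Delta=\{(y,\ell)\in Y\times\mathbb{Z}:0\le\ell\le\tau(y)-1\}$, $\mu_\Delta=(\mu_Y\times\text{counting})/\int_Y\tau\,d\mu_Y$, $\pi_\Delta(y,\ell)=T^\ell y$, and $\mu=(\pi_\Delta)_*\mu_\Delta$, a $T$-invariant probability measure on $\Lambda$. Let $d\ge1$ and let $v:\Lambda\to\mathbb{R}^d$ satisfy $\int_\Lambda v\,d\mu=0$ and $\|v\|_\eta=\sup_x|v(x)|+\sup_{x\ne y}|v(x)-v(y)|/d_\Lambda(x,y)^\eta<\infty$. For $a,b\in\mathbb{R}^d$ write $a\otimes b=ab^T$, and let $|J|=(\sum_{i,j}J_{ij}^2)^{1/2}$ for matrices. Put $$S_nv=\sum_{0\le j<n}v\circ T^j,\qquad \mathbb{S}_nv=\sum_{0\le i<j<n}(v\circ T^i)\otimes(v\circ T^j).$$ Let $\phi=v\circ\pi_\Delta$ and $\phi'(y)=\sum_{\ell=0}^{\tau(y)-1}\phi(y,\ell)$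 for $y\in Y$. Let $P:L^1(Y,\mu_Y)\to L^1(Y,\mu_Y)$ be the transfer operator of $F$, that is, $\int_YPu\,w\,d\mu_Y=\int_Yu\,(w\circ F)\,d\mu_Y$ for $u\in L^1$, $w\in L^\infty$ (acting coordinatewise on $\mathbb{R}^d$-valued functions), and define $\chi'=\sum_{k\ge1}P^k\phi'$, $m'=\phi'-\chi'\circ F+\chi'$ and, on $\Delta$, $$\chi(y,\ell)=\chi'(y)+\sum_{k=0}^{\ell-1}\phi(y,k),\qquad m(y,\ell)=\begin{cases}0,&\ell\le\tau(y)-2,\\ m'(y),&\ell=\tau(y)-1.\end{cases}$$ Proposition. The series for $\chi'$ converges $\mu_Y$-almost everywhere, $m\otimes m$ and $\chi\otimes\phi$ are $\mu_\Delta$-integrable, and the limits $$\Sigma=\lim_{n\to\infty}\frac1n\int_\Lambda S_nv\otimes S_nv\,d\mu,\qquad E=\lim_{n\to\infty}\frac1n\int_\Lambda\mathbb{S}_nv\,d\mu$$ exist and are given by $$\Sigma=\int_\Delta m\otimes m\,d\mu_\Delta,\qquad E=\int_\Delta\chi\otimes\phi\,d\mu_\Delta.$$ Moreover, for all $n\ge1$,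 $$\Big|\frac1n\int_\Lambda S_nv\otimes S_nv\,d\mu-\Sigma\Big|\le C\|v\|_\eta^2\,n^{1/p-1/2},\qquad \Big|\frac1n\int_\Lambda\mathbb{S}_nv\,d\mu-E\Big|\le C\|v\|_\eta^2\,\big(n^{-1/2}+n^{-(p-2)}\big),$$ where $C$ is a continuous function of $\operatorname{diam}\Lambda$, $C_1$, $\beta$, $\eta$, $p$ and $|\tau|_p$ alone (the same function for all systems and all $v$). -/

import Mathlib

open MeasureTheory Filter Topology

noncomputable section

namespace NUE

/-- The induced map `F = T^τ`, `F x = T^{τ(x)} x`. -/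
def inducedMap {Λ : Type*} (T : Λ → Λ) (τ : Λ → ℕ) (x : Λ) : Λ := T^[τ x] x

/-- `T` is nonuniformly expanding with respect to the finite Borel measure `ρ`, with inducing set
`Y`, at most countable measurable partition `α` of `Y`, return time `τ` (only its values on `Y`
matter) and constants `β > 1`, `η ∈ (0,1]`, `C₁ ≥ 1`. -/
structure NonuniformlyExpanding {Λ : Type*} [MetricSpace Λ] [MeasurableSpace Λ]
    (ρ : Measure Λ) (T : Λ → Λ) (Y : Set Λ) (α : Set (Set Λ)) (τ : Λ → ℕ)
    (β η C₁ : ℝ) : Prop where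
  nonsingular : Measure.QuasiMeasurePreserving T ρ ρ
  measurableSet_base : MeasurableSet Y
  base_pos : 0 < ρ Y
  countable_partition : α.Countable
  measurableSet_partition : ∀ a ∈ α, MeasurableSet a
  disjoint_partition : α.PairwiseDisjoint id
  sUnion_partition : ⋃₀ α = Y
  one_le_return : ∀ x ∈ Y, 1 ≤ τ x
  return_const : ∀ a ∈ α, ∀ x ∈ a, ∀ y ∈ a, τ x = τ y
  integrable_return : IntegrableOn (fun x => (τ x : ℝ)) Y ρ
  one_lt_β : 1 < β
  η_pos : 0 < η
  η_le_one : η ≤ 1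
  one_le_C₁ : 1 ≤ C₁
  mapsTo : Set.MapsTo (inducedMap T τ) Y Y
  /-- `F` restricts to a bijection, modulo null sets, from each `a ∈ α` onto `Y`. -/
  bijective : ∀ a ∈ α, Set.InjOn (inducedMap T τ) a ∧ ρ (Y \ inducedMap T τ '' a) = 0
  expanding : ∀ a ∈ α, ∀ x ∈ a, ∀ y ∈ a,
    β * dist x y ≤ dist (inducedMap T τ x) (inducedMap T τ y)
  backward : ∀ a ∈ α, ∀ x ∈ a, ∀ y ∈ a, ∀ ℓ < τ x,
    dist (T^[ℓ] x) (T^[ℓ] y) ≤ C₁ * dist (inducedMap T τ x) (inducedMap T τ y)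
  /-- Bounded distortion of `ζ₀ = dρ|_Y / (dρ|_Y ∘ F)`. As `0 < ζ₀ < ∞`, that `ζ₀` is this density
  means that on each `a ∈ α` the measure `A ↦ ρ (F A)` has density `1 / ζ₀` with respect to `ρ`. -/
  distortion : ∃ ζ₀ : Λ → ℝ, Measurable ζ₀ ∧ (∀ x ∈ Y, 0 < ζ₀ x) ∧
    (∀ a ∈ α, ∀ A ⊆ a, MeasurableSet A →
      ρ (inducedMap T τ '' A) = ∫⁻ x in A, ENNReal.ofReal (ζ₀ x)⁻¹ ∂ρ) ∧
    ∀ a ∈ α, ∀ x ∈ a, ∀ y ∈ a, |Real.log (ζ₀ x) - Real.log (ζ₀ y)| ≤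
      C₁ * dist (inducedMap T τ x) (inducedMap T τ y) ^ η

/-- The Hölder norm `‖v‖_η = |v|_∞ + |v|_η`. -/
def holderNorm {Λ E : Type*} [MetricSpace Λ] [NormedAddCommGroup E] (η : ℝ) (v : Λ → E) : ℝ :=
  (⨆ x, ‖v x‖) + (nnHolderNorm η.toNNReal v : ℝ)

/-- The outer product `a ⊗ b = a bᵀ`. -/
def outer {d : ℕ} (a b : EuclideanSpace ℝ (Fin d)) : Matrix (Fin d) (Fin d) ℝ :=
  Matrix.vecMulVec a.ofLp b.ofLp

/-- The norm `|J| = (∑ᵢⱼ Jᵢⱼ²)^{1/2}` on matrices. -/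
def matNorm {d : ℕ} (J : Matrix (Fin d) (Fin d) ℝ) : ℝ :=
  Real.sqrt (∑ i, ∑ j, J i j ^ 2)

/-- The (entrywise) integral of a matrix-valued function. -/
def matIntegral {Ω : Type*} [MeasurableSpace Ω] {d : ℕ} (ν : Measure Ω)
    (A : Ω → Matrix (Fin d) (Fin d) ℝ) : Matrix (Fin d) (Fin d) ℝ :=
  Matrix.of fun i j => ∫ x, A x i j ∂ν

/-- The Birkhoff sum `S_n v = ∑_{0 ≤ j < n} v ∘ T^j`. -/
def birkhoff {Λ : Type*} {d : ℕ} (T : Λ → Λ) (v : Λ → EuclideanSpace ℝ (Fin d)) (n : ℕ)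
    (x : Λ) : EuclideanSpace ℝ (Fin d) :=
  ∑ j ∈ Finset.range n, v (T^[j] x)

/-- The iterated sum `𝕊_n v = ∑_{0 ≤ i < j < n} (v ∘ T^i) ⊗ (v ∘ T^j)`. -/
def iteratedSum {Λ : Type*} {d : ℕ} (T : Λ → Λ) (v : Λ → EuclideanSpace ℝ (Fin d)) (n : ℕ)
    (x : Λ) : Matrix (Fin d) (Fin d) ℝ :=
  ∑ j ∈ Finset.range n, ∑ i ∈ Finset.range j, outer (v (T^[i] x)) (v (T^[j] x))

/-- The transfer operator `P` of `F : (Λ, ν) → (Λ, ν)` on integrable `u`: `P u` is the density with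
respect to `ν` of the push-forward under `F` of the signed measure `u dν`, so that
`∫ (P u) w dν = ∫ u (w ∘ F) dν` for bounded measurable `w`. -/
def transfer {Λ : Type*} [MeasurableSpace Λ] (ν : Measure Λ) (F : Λ → Λ) (u : Λ → ℝ)
    (y : Λ) : ℝ :=
  (((ν.withDensity fun x => ENNReal.ofReal (u x)).map F).rnDeriv ν y).toReal -
    (((ν.withDensity fun x => ENNReal.ofReal (-u x)).map F).rnDeriv ν y).toReal

/-- The Young tower `Δ = {(y, ℓ) : y ∈ Y, 0 ≤ ℓ ≤ τ(y) - 1}`. -/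
def tower {Λ : Type*} (Y : Set Λ) (τ : Λ → ℕ) : Set (Λ × ℕ) :=
  {q | q.1 ∈ Y ∧ q.2 < τ q.1}

/-- The probability measure `μ_Δ = (μ_Y × counting) / ∫_Y τ dμ_Y` on the tower, as a measure on
`Λ × ℕ` concentrated on `Δ`. -/
def towerMeasure {Λ : Type*} [MeasurableSpace Λ] (Y : Set Λ) (τ : Λ → ℕ) (μY : Measure Λ) :
    Measure (Λ × ℕ) :=
  (∫⁻ y, (τ y : ENNReal) ∂μY)⁻¹ • (μY.prod Measure.count).restrict (tower Y τ)

/-- The projection `π_Δ(y, ℓ) = T^ℓ y`. -/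
def towerProj {Λ : Type*} (T : Λ → Λ) (q : Λ × ℕ) : Λ := T^[q.2] q.1

/-- The `T`-invariant probability measure `μ = (π_Δ)_* μ_Δ`. -/
def baseMeasure {Λ : Type*} [MeasurableSpace Λ] (T : Λ → Λ) (Y : Set Λ) (τ : Λ → ℕ)
    (μY : Measure Λ) : Measure Λ :=
  (towerMeasure Y τ μY).map (towerProj T)

section Decomposition

variable {Λ : Type*} {d : ℕ}

/-- The lifted observable `φ = v ∘ π_Δ`. -/
def lift (T : Λ → Λ) (v : Λ → EuclideanSpace ℝ (Fin d)) (q : Λ × ℕ) :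
    EuclideanSpace ℝ (Fin d) :=
  v (towerProj T q)

/-- The induced observable `φ'(y) = ∑_{ℓ=0}^{τ(y)-1} φ(y, ℓ)`. -/
def inducedObs (T : Λ → Λ) (τ : Λ → ℕ) (v : Λ → EuclideanSpace ℝ (Fin d)) (y : Λ) :
    EuclideanSpace ℝ (Fin d) :=
  ∑ ℓ ∈ Finset.range (τ y), lift T v (y, ℓ)

variable [MeasurableSpace Λ]

/-- The `i`-th coordinate of `P^k φ'`. -/
def transferIter (T : Λ → Λ) (τ : Λ → ℕ) (μY : Measure Λ) (v : Λ → EuclideanSpace ℝ (Fin d))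
    (i : Fin d) (k : ℕ) : Λ → ℝ :=
  (transfer μY (inducedMap T τ))^[k] fun y => inducedObs T τ v y i

/-- `χ' = ∑_{k ≥ 1} P^k φ'`. -/
def chiBase (T : Λ → Λ) (τ : Λ → ℕ) (μY : Measure Λ) (v : Λ → EuclideanSpace ℝ (Fin d))
    (y : Λ) : EuclideanSpace ℝ (Fin d) :=
  WithLp.toLp 2 fun i => ∑' k : ℕ, transferIter T τ μY v i (k + 1) y

/-- `m'`, defined by `φ' = m' + χ' ∘ F - χ'`. -/
def mBase (T : Λ → Λ) (τ : Λ → ℕ) (μY : Measure Λ) (v : Λ → EuclideanSpace ℝ (Fin d))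
    (y : Λ) : EuclideanSpace ℝ (Fin d) :=
  inducedObs T τ v y - chiBase T τ μY v (inducedMap T τ y) + chiBase T τ μY v y

/-- `χ(y, ℓ) = χ'(y) + ∑_{k=0}^{ℓ-1} φ(y, k)`. -/
def chi (T : Λ → Λ) (τ : Λ → ℕ) (μY : Measure Λ) (v : Λ → EuclideanSpace ℝ (Fin d))
    (q : Λ × ℕ) : EuclideanSpace ℝ (Fin d) :=
  chiBase T τ μY v q.1 + ∑ k ∈ Finset.range q.2, lift T v (q.1, k)

/-- `m(y, ℓ) = m'(y)` if `ℓ = τ(y) - 1`, and `m(y, ℓ) = 0` if `ℓ ≤ τ(y) - 2`. -/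
def mart (T : Λ → Λ) (τ : Λ → ℕ) (μY : Measure Λ) (v : Λ → EuclideanSpace ℝ (Fin d))
    (q : Λ × ℕ) : EuclideanSpace ℝ (Fin d) :=
  if q.2 + 1 = τ q.1 then mBase T τ μY v q.1 else 0

end Decomposition

end NUE

end

namespace NUE

/-! The theorem rests on exponential decay of correlations for the induced map `F`, carried to the
tower by a martingale-coboundary decomposition.

Densities `g` with `g x ≤ exp (R d(x,y)^η) g y` form a cone. The branches of `F` are full, expanding
and of bounded distortion, so pushing forward turns `R` into `R β^(-η) + C₁`, and the cone of
constant `coneConst` is strictly preserved. A density in it is at least a fixed fraction of its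
mean. Removing this common part from two measures of equal mass, over and over, couples them
exponentially fast (`exists_coupling`). The density of `μY` lies in the cone as well
(`isLogHolder_of_invariant`). The induced observable `φ'` is unbounded, but it is of size `V τ` and
regular along branches, so one push-forward brings it into the cone. Hence `P^(k+1) φ'` decays
exponentially in the supremum norm (`ae_norm_transferIter_le`), `χ'` is bounded, and `P m' = 0`.

On the tower, with map `f`, one has `φ = m + χ ∘ f - χ`, and `P m' = 0` makes `m ∘ f^a` orthogonal
to every function of `f^n` for `n > a`. So `S_n v` is a sum `M_n` of reverse martingale differences
plus a coboundary `R_n`. The integral of `M_n ⊗ M_n` is exactly `n Σ`, and the squared `L²` norm of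
`R_n` is controlled by `psi n = ∫ min(n, τ) τ²`. The same orthogonality gives the exact identity
that the integral of `𝕊_n v` is `n E` minus the integral of `χ ⊗ S_n v`. In this error term `S_n v`
is split at the first return. The part before the return costs `psi n`. The part after it starts at
`F y` and is independent of `τ y` up to a constant factor (`lintegral_comp_return_le`), so a second
moment of `τ` and the bound `√n` for the size of Birkhoff sums suffice.

The interpolation `min(n, τ) τ² ≤ n^a τ^(3-a)` turns `psi n / n` into the two rates. For `p = 2`
these rates do not decay, and the limits come from `psi n / n → 0`, by dominated convergence. The
constants do not depend on `d`, because vectors and matrices are tested against vectors and matrices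
rather than entry by entry. -/

/-- The weight `exp (R d(x,y)^η)`. -/
noncomputable def expWeight {Λ : Type*} [MetricSpace Λ] (η R : ℝ) (x y : Λ) : ENNReal :=
  ENNReal.ofReal (Real.exp (R * dist x y ^ η))

/-- `g` is log-Hölder: `g x ≤ exp (R d(x,y)^η) g y`. -/
def LogHolder {Λ : Type*} [MetricSpace Λ] (η R : ℝ) (g : Λ → ENNReal) : Prop :=
  ∀ x y, g x ≤ expWeight η R x y * g y

/-! ### Log-Hölder functions. -/

section LogHolder

variable {Λ : Type*} [MetricSpace Λ] {η R R' : ℝ} {g g' : Λ → ENNReal}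

lemma expWeight_ne_zero (x y : Λ) : expWeight η R x y ≠ 0 := by
  simp [expWeight, Real.exp_pos]

lemma expWeight_ne_top (x y : Λ) : expWeight η R x y ≠ ⊤ := ENNReal.ofReal_ne_top

lemma expWeight_self (hη : 0 < η) (x : Λ) : expWeight η R x x = 1 := by
  simp [expWeight, Real.zero_rpow hη.ne']

lemma expWeight_comm (x y : Λ) : expWeight η R x y = expWeight η R y x := by
  simp [expWeight, dist_comm]

lemma expWeight_mono (h : R ≤ R') (x y : Λ) : expWeight η R x y ≤ expWeight η R' x y := by
  unfold expWeight
  gcongr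

lemma expWeight_add (x y : Λ) :
    expWeight η R x y * expWeight η R' x y = expWeight η (R + R') x y := by
  unfold expWeight
  rw [← ENNReal.ofReal_mul (Real.exp_pos _).le, ← Real.exp_add]
  ring_nf

lemma expWeight_triangle (hη : 0 < η) (hη1 : η ≤ 1) (hR : 0 ≤ R) (x y z : Λ) :
    expWeight η R x z ≤ expWeight η R x y * expWeight η R y z := by
  unfold expWeight
  rw [← ENNReal.ofReal_mul (Real.exp_pos _).le, ← Real.exp_add, ← mul_add]
  gcongr
  exact (Real.rpow_le_rpow dist_nonneg (dist_triangle x y z) hη.le).trans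
    (Real.rpow_add_le_add_rpow dist_nonneg dist_nonneg hη.le hη1)

lemma one_le_expWeight (hR : 0 ≤ R) (x y : Λ) : 1 ≤ expWeight η R x y := by
  unfold expWeight
  rw [ENNReal.one_le_ofReal]
  exact Real.one_le_exp (by positivity)

lemma expWeight_le_diam [BoundedSpace Λ] (hη : 0 < η) (hR : 0 ≤ R) (x y : Λ) :
    expWeight η R x y ≤
      ENNReal.ofReal (Real.exp (R * Metric.diam (Set.univ : Set Λ) ^ η)) := by
  unfold expWeight
  gcongr
  exact Metric.dist_le_diam_of_mem (Bornology.IsBounded.all _) trivial trivial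

/-- If `F` expands distances by `β`, the weight contracts. -/
lemma expWeight_le_of_expanding {β : ℝ} (hβ : 0 < β) (hη : 0 < η) (hR : 0 ≤ R) {x y x' y' : Λ}
    (h : β * dist x y ≤ dist x' y') :
    expWeight η R x y ≤ expWeight η (R * β ^ (-η)) x' y' := by
  unfold expWeight
  apply ENNReal.ofReal_le_ofReal
  apply Real.exp_le_exp.2
  rw [mul_assoc]
  gcongr
  have h1 : dist x y ≤ β⁻¹ * dist x' y' := by
    rw [inv_mul_eq_div, le_div_iff₀ hβ]; linarith
  calc dist x y ^ η ≤ (β⁻¹ * dist x' y') ^ η := by gcongr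
    _ = β ^ (-η) * dist x' y' ^ η := by
      rw [Real.mul_rpow (by positivity) dist_nonneg, Real.inv_rpow hβ.le, Real.rpow_neg hβ.le]

lemma LogHolder.mono (hg : LogHolder η R g) (h : R ≤ R') : LogHolder η R' g := fun x y =>
  (hg x y).trans (by gcongr; exact expWeight_mono h x y)

lemma LogHolder.const_mul (hg : LogHolder η R g) (c : ENNReal) :
    LogHolder η R fun x => c * g x := fun x y => by
  rw [mul_left_comm]
  exact mul_le_mul_right (hg x y) c

lemma LogHolder.tsum {ι : Type*} {G : ι → Λ → ENNReal} (hG : ∀ i, LogHolder η R (G i)) :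
    LogHolder η R (∑' i, G i) := fun x y => by
  simp only [ENNReal.tsum_apply]
  rw [← ENNReal.tsum_mul_left]
  exact ENNReal.tsum_le_tsum fun i => hG i x y

lemma LogHolder.limsup {G : ℕ → Λ → ENNReal} (hG : ∀ i, LogHolder η R (G i)) :
    LogHolder η R fun x => limsup (fun n => G n x) atTop := fun x y => by
  rw [← ENNReal.limsup_const_mul_of_ne_top (expWeight_ne_top x y)]
  exact limsup_le_limsup (Eventually.of_forall fun n => hG n x y)

lemma LogHolder.ne_top (hg : LogHolder η R g) {x : Λ} (hx : g x ≠ ⊤) (y : Λ) : g y ≠ ⊤ :=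
  ne_top_of_le_ne_top (ENNReal.mul_ne_top (expWeight_ne_top y x) hx) (hg y x)

/-- Weights are finite, so the value `⊤` at one point spreads to all points and `g` is constant.
Otherwise `g y` is squeezed between `g x` times the weight and `g x` divided by it, and the weight
tends to `1`. -/
lemma LogHolder.continuous (hη : 0 < η) (hg : LogHolder η R g) : Continuous g := by
  rw [continuous_iff_continuousAt]
  intro x
  have hc : Tendsto (fun y => expWeight η R y x) (𝓝 x) (𝓝 1) := by
    have h0 : ContinuousAt (fun y : Λ => ENNReal.ofReal (Real.exp (R * dist y x ^ η))) x := by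
      apply ENNReal.continuous_ofReal.continuousAt.comp
      apply Real.continuous_exp.continuousAt.comp
      apply ContinuousAt.mul continuousAt_const
      exact ContinuousAt.rpow_const (by fun_prop) (Or.inr hη.le)
    have := h0.tendsto
    simpa [expWeight, dist_self, Real.zero_rpow hη.ne'] using this
  by_cases hx : g x = ⊤
  · have hall : ∀ y, g y = ⊤ := by
      intro y
      by_contra h
      exact hg.ne_top h x hx
    rw [show g = fun _ => ⊤ from funext hall]
    exact continuousAt_const
  · have hup : Tendsto (fun y => expWeight η R y x * g x) (𝓝 x) (𝓝 (g x)) := by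
      simpa using ENNReal.Tendsto.mul_const hc (Or.inr hx)
    have hlo : Tendsto (fun y => (expWeight η R y x)⁻¹ * g x) (𝓝 x) (𝓝 (g x)) := by
      have := ENNReal.Tendsto.mul_const (b := g x) (tendsto_inv_iff.2 hc) (Or.inr hx)
      simpa using this
    refine tendsto_of_tendsto_of_tendsto_of_le_of_le hlo hup (fun y => ?_) (fun y => hg y x)
    have := hg x y
    rw [expWeight_comm] at this
    calc (expWeight η R y x)⁻¹ * g x ≤ (expWeight η R y x)⁻¹ * (expWeight η R y x * g y) := by
          gcongr
      _ = g y := by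
          rw [← mul_assoc, ENNReal.inv_mul_cancel (expWeight_ne_zero _ _) (expWeight_ne_top _ _),
            one_mul]

lemma LogHolder.measurable [MeasurableSpace Λ] [BorelSpace Λ] (hη : 0 < η)
    (hg : LogHolder η R g) : Measurable g := (hg.continuous hη).measurable

/-- The infimal convolution with the weight, along a map `F` and over a set `a`. -/
lemma LogHolder.iInf_expWeight (hη : 0 < η) (hη1 : η ≤ 1) (hR : 0 ≤ R) (F : Λ → Λ) (a : Set Λ)
    (ψ : Λ → ENNReal) :
    LogHolder η R fun y => ⨅ x ∈ a, expWeight η R y (F x) * ψ x := fun y z => by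
  simp only [ENNReal.mul_iInf_of_ne (expWeight_ne_zero y z) (expWeight_ne_top y z)]
  refine iInf₂_mono fun x _ => ?_
  rw [← mul_assoc]
  gcongr
  exact expWeight_triangle hη hη1 hR y z (F x)

/-- McShane extension in multiplicative form. A function on `a` that is regular as seen from its
image under `F` becomes a log-Hölder function on the whole space composed with `F`, with no inverse
branch involved. -/
lemma iInf_expWeight_eq (hη : 0 < η) {F : Λ → Λ} {a : Set Λ} {ψ : Λ → ENNReal}
    (h : ∀ x ∈ a, ∀ y ∈ a, ψ x ≤ expWeight η R (F x) (F y) * ψ y) {x : Λ} (hx : x ∈ a) :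
    ⨅ z ∈ a, expWeight η R (F x) (F z) * ψ z = ψ x := by
  apply le_antisymm
  · refine (iInf₂_le x hx).trans ?_
    rw [expWeight_self hη, one_mul]
  · exact le_iInf₂ fun z hz => h x hx z hz

/-- Subtracting a fraction of a lower bound keeps the log-Hölder property, with a larger
constant. -/
lemma LogHolder.tsub_const {δ : ℝ} (hδ : δ < 1) (hδ0 : 0 ≤ δ) (hR : 0 ≤ R)
    (hg : LogHolder η R g) (hfin : ∀ x, g x ≠ ⊤) {c : ENNReal}
    (hc : ∀ x, c ≤ ENNReal.ofReal δ * g x) :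
    LogHolder η (R / (1 - δ)) fun x => g x - c := fun x y => by
  have hcfin : c ≠ ⊤ :=
    ne_top_of_le_ne_top (ENNReal.mul_ne_top ENNReal.ofReal_ne_top (hfin x)) (hc x)
  have h1 := hg x y
  have h2 := hc y
  have hcy : c ≤ g y := h2.trans (mul_le_of_le_one_left (zero_le)
    (ENNReal.ofReal_le_one.2 hδ.le))
  unfold expWeight at h1 ⊢
  lift c to NNReal using hcfin
  obtain ⟨u, hu⟩ := WithTop.ne_top_iff_exists.1 (hfin x)
  obtain ⟨w, hw⟩ := WithTop.ne_top_iff_exists.1 (hfin y)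
  beta_reduce
  change (u : ENNReal) = g x at hu
  change (w : ENNReal) = g y at hw
  rw [← hw] at h1 h2 hcy ⊢
  rw [← hu] at h1 ⊢
  set t := dist x y ^ η
  -- Convexity of `exp` between `R t / (1 - δ)` and `0`, with weights `1 - δ` and `δ`. With `X` the
  -- larger exponential, `u ≤ ((1 - δ) X + δ) w`, and `(X - 1) c ≤ (X - 1) δ w` then yields `u - c ≤
  -- X (w - c)`.
  have hE : (1 - δ) * Real.exp (R / (1 - δ) * t) + δ ≥ Real.exp (R * t) := by
    have := convexOn_exp.2 (Set.mem_univ (R / (1 - δ) * t)) (Set.mem_univ 0)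
      (by linarith : 0 ≤ 1 - δ) hδ0 (by ring)
    simp only [smul_eq_mul, mul_zero, add_zero, Real.exp_zero, mul_one] at this
    have e : (1 - δ) * (R / (1 - δ) * t) = R * t := by
      have : 1 - δ ≠ 0 := by linarith
      field_simp
    rw [e] at this
    exact this
  have h1' : (u : ℝ) ≤ Real.exp (R * t) * w := by
    have := ENNReal.toReal_mono (by finiteness) h1
    simpa [ENNReal.toReal_mul, (Real.exp_pos _).le] using this
  have h2' : (c : ℝ) ≤ δ * w := by
    have := ENNReal.toReal_mono (by finiteness) h2
    simpa [ENNReal.toReal_mul, hδ0] using this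
  have hcy' : (c : ℝ) ≤ w := by exact_mod_cast hcy
  rw [tsub_le_iff_right, ← ENNReal.coe_sub]
  have e1 : ((w - c : NNReal) : ENNReal) = ENNReal.ofReal ((w : ℝ) - c) := by
    rw [← NNReal.coe_sub (by exact_mod_cast hcy'), ENNReal.ofReal_coe_nnreal]
  rw [e1, ← ENNReal.ofReal_mul (Real.exp_pos _).le, ← ENNReal.ofReal_coe_nnreal,
    ← ENNReal.ofReal_coe_nnreal, ← ENNReal.ofReal_add (by
      have : 0 ≤ (w:ℝ) - c := by linarith
      positivity) c.coe_nonneg]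
  apply ENNReal.ofReal_le_ofReal
  have hw0 : (0 : ℝ) ≤ w := w.2
  have h : 1 ≤ Real.exp (R / (1 - δ) * t) :=
    Real.one_le_exp (mul_nonneg (div_nonneg hR (by linarith)) (by positivity))
  set X := Real.exp (R / (1 - δ) * t)
  nlinarith [mul_le_mul_of_nonneg_right hE hw0, mul_le_mul_of_nonneg_left h2' (sub_nonneg.2 h)]

end LogHolder

lemma measurable_inducedMap {Λ : Type*} [MeasurableSpace Λ] {T : Λ → Λ} {τ : Λ → ℕ}
    (hT : Measurable T) (hτ : Measurable τ) : Measurable (inducedMap T τ) := by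
  have h : Measurable fun q : ℕ × Λ => T^[q.1] q.2 :=
    measurable_from_prod_countable_right fun n => hT.iterate n
  exact h.comp (hτ.prodMk measurable_id)

/-! ### Push-forward of densities by the induced map. -/

section Pushforward

variable {Λ : Type*} [MetricSpace Λ] [MeasurableSpace Λ]
  {ρ : Measure Λ} {T : Λ → Λ} {Y : Set Λ} {α : Set (Set Λ)}
  {τ : Λ → ℕ} {β η C₁ : ℝ}

lemma NonuniformlyExpanding.measurable_F (h : NonuniformlyExpanding ρ T Y α τ β η C₁)
    (hτ : Measurable τ) : Measurable (inducedMap T τ) :=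
  measurable_inducedMap h.nonsingular.measurable hτ

lemma NonuniformlyExpanding.subset (h : NonuniformlyExpanding ρ T Y α τ β η C₁)
    {a : Set Λ} (ha : a ∈ α) : a ⊆ Y := by
  rw [← h.sUnion_partition]
  exact Set.subset_sUnion_of_mem ha

lemma NonuniformlyExpanding.restrict_eq_sum (h : NonuniformlyExpanding ρ T Y α τ β η C₁) :
    ρ.restrict Y = Measure.sum fun a : α => ρ.restrict (a : Set Λ) := by
  have : Countable α := h.countable_partition.to_subtype
  rw [← h.sUnion_partition, Set.sUnion_eq_iUnion]
  refine Measure.restrict_iUnion (fun a b hab => ?_) fun a => h.measurableSet_partition a a.2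
  exact h.disjoint_partition a.2 b.2 (fun e => hab (Subtype.ext e))

/-- Bounds for a log-Hölder density in terms of its total mass. -/
lemma LogHolder.mass_le [BoundedSpace Λ] {ν : Measure Λ} {R : ℝ} (hη : 0 < η) (hR : 0 ≤ R)
    {g : Λ → ENNReal}
    (hg : LogHolder η R g) (x : Λ) :
    ν.withDensity g Set.univ ≤
      ENNReal.ofReal (Real.exp (R * Metric.diam (Set.univ : Set Λ) ^ η)) * g x * ν Set.univ := by
  rw [withDensity_apply _ MeasurableSet.univ, Measure.restrict_univ]
  calc ∫⁻ y, g y ∂ν ≤ ∫⁻ _, ENNReal.ofReal (Real.exp (R * Metric.diam (Set.univ : Set Λ) ^ η)) *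
        g x ∂ν := lintegral_mono fun y =>
          (hg y x).trans (by gcongr; exact expWeight_le_diam hη hR y x)
    _ = _ := by rw [lintegral_const]

/-- The image under `F` of the measure with density `1 / ζ₀` on a partition element is `ρ|_Y`. -/
lemma map_restrict_withDensity (h : NonuniformlyExpanding ρ T Y α τ β η C₁) (hτ : Measurable τ)
    {ζ : Λ → ℝ} (hζ : ∀ a ∈ α, ∀ A ⊆ a, MeasurableSet A →
      ρ (inducedMap T τ '' A) = ∫⁻ x in A, ENNReal.ofReal (ζ x)⁻¹ ∂ρ)
    {a : Set Λ} (ha : a ∈ α) :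
    ((ρ.restrict a).withDensity fun x => ENNReal.ofReal (ζ x)⁻¹).map (inducedMap T τ) =
      ρ.restrict Y := by
  have hF := h.measurable_F hτ
  ext B hB
  have hma := h.measurableSet_partition a ha
  rw [Measure.map_apply hF hB, withDensity_apply _ (hF hB), Measure.restrict_restrict (hF hB),
    ← hζ a ha _ Set.inter_subset_right ((hF hB).inter hma), Measure.restrict_apply hB]
  have himg : inducedMap T τ '' (inducedMap T τ ⁻¹' B ∩ a) = B ∩ inducedMap T τ '' a := by
    rw [Set.inter_comm, Set.image_inter_preimage, Set.inter_comm]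
  rw [himg]
  have hsub : inducedMap T τ '' a ⊆ Y := by
    rintro _ ⟨x, hx, rfl⟩
    exact h.mapsTo (h.subset ha hx)
  apply le_antisymm (measure_mono (Set.inter_subset_inter_right _ hsub))
  calc ρ (B ∩ Y) ≤ ρ (B ∩ inducedMap T τ '' a ∪ Y \ inducedMap T τ '' a) := by
        apply measure_mono
        rintro x ⟨hxB, hxY⟩
        by_cases hx : x ∈ inducedMap T τ '' a
        · exact Or.inl ⟨hxB, hx⟩
        · exact Or.inr ⟨hxY, hx⟩
    _ ≤ ρ (B ∩ inducedMap T τ '' a) + ρ (Y \ inducedMap T τ '' a) := measure_union_le _ _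
    _ = ρ (B ∩ inducedMap T τ '' a) := by rw [(h.bijective a ha).2, add_zero]

variable [BorelSpace Λ]

/-- The image under `F` of a measure whose density varies regularly along the branches has a
log-Hölder density. -/
theorem exists_logHolder_map (h : NonuniformlyExpanding ρ T Y α τ β η C₁) (hτ : Measurable τ)
    {L : ℝ} (hL : 0 ≤ L) {w : Λ → ENNReal}
    (hwL : ∀ a ∈ α, ∀ x ∈ a, ∀ y ∈ a,
      w x ≤ expWeight η L (inducedMap T τ x) (inducedMap T τ y) * w y) :
    ∃ G, LogHolder η (L + C₁) G ∧
      ((ρ.restrict Y).withDensity w).map (inducedMap T τ) = (ρ.restrict Y).withDensity G := by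
  have hF := h.measurable_F hτ
  have : Countable α := h.countable_partition.to_subtype
  obtain ⟨ζ, hζm, hζ0, hζi, hζd⟩ := h.distortion
  have hR : 0 ≤ L + C₁ := by linarith [h.one_le_C₁]
  set F := inducedMap T τ with hFdef
  -- `ζ` is the inverse Jacobian of `F`, so `ψ x` is the contribution of the branch through `x` to
  -- the image density at `F x`.
  set ψ : Λ → ENNReal := fun x => w x * ENNReal.ofReal (ζ x) with hψ
  have hψL : ∀ a ∈ α, ∀ x ∈ a, ∀ y ∈ a, ψ x ≤ expWeight η (L + C₁) (F x) (F y) * ψ y := by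
    intro a ha x hx y hy
    have h1 := hwL a ha x hx y hy
    have hx0 := hζ0 x (h.subset ha hx)
    have hy0 := hζ0 y (h.subset ha hy)
    have h2 : ENNReal.ofReal (ζ x) ≤ expWeight η C₁ (F x) (F y) * ENNReal.ofReal (ζ y) := by
      unfold expWeight
      rw [← ENNReal.ofReal_mul (Real.exp_pos _).le]
      apply ENNReal.ofReal_le_ofReal
      have := (abs_le.1 (hζd a ha x hx y hy)).2
      calc ζ x = Real.exp (Real.log (ζ x)) := (Real.exp_log hx0).symm
        _ ≤ Real.exp (C₁ * dist (F x) (F y) ^ η + Real.log (ζ y)) := by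
          apply Real.exp_le_exp.2; linarith
        _ = _ := by rw [Real.exp_add, Real.exp_log hy0]
    calc ψ x ≤ (expWeight η L (F x) (F y) * w y) *
          (expWeight η C₁ (F x) (F y) * ENNReal.ofReal (ζ y)) := mul_le_mul' h1 h2
      _ = (expWeight η L (F x) (F y) * expWeight η C₁ (F x) (F y)) * ψ y := by
        simp only [hψ]; ring
      _ = _ := by rw [expWeight_add]
  set G : α → Λ → ENNReal := fun a y => ⨅ x ∈ (a : Set Λ), expWeight η (L + C₁) y (F x) * ψ x
    with hG
  have hGL : ∀ a, LogHolder η (L + C₁) (G a) := fun a =>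
    LogHolder.iInf_expWeight h.η_pos h.η_le_one hR F a ψ
  have hGm : ∀ a, Measurable (G a) := fun a => (hGL a).measurable h.η_pos
  refine ⟨∑' a, G a, LogHolder.tsum hGL, ?_⟩
  rw [withDensity_tsum hGm, h.restrict_eq_sum, withDensity_sum, Measure.map_sum hF.aemeasurable]
  rw [← h.restrict_eq_sum]
  congr 1
  ext1 a
  have hma := h.measurableSet_partition a a.2
  -- On `a` the density is `1 / ζ` times a function of `F x`. The second factor passes through the
  -- push-forward, and the first is sent to `ρ` restricted to `Y`.
  have hdens : (ρ.restrict a).withDensity w =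
      ((ρ.restrict a).withDensity fun x => ENNReal.ofReal (ζ x)⁻¹).withDensity (G a ∘ F) := by
    rw [← withDensity_mul _ (by fun_prop) ((hGm a).comp hF)]
    apply withDensity_congr_ae
    filter_upwards [ae_restrict_mem hma] with x hx
    have hx0 := hζ0 x (h.subset a.2 hx)
    have : G a (F x) = ψ x := iInf_expWeight_eq h.η_pos (hψL a a.2) hx
    simp only [Pi.mul_apply, Function.comp_apply, this, hψ]
    rw [mul_comm (w x), ← mul_assoc, ← ENNReal.ofReal_mul (by positivity), inv_mul_cancel₀ hx0.ne',
      ENNReal.ofReal_one, one_mul]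
  rw [hdens]
  conv_rhs => rw [← map_restrict_withDensity h hτ hζi a.2]
  ext B hB
  rw [Measure.map_apply hF hB, withDensity_apply _ (hF hB), withDensity_apply _ hB,
    setLIntegral_map hB (hGm a) hF]
  rfl

lemma LogHolder.le_mass [BoundedSpace Λ] {ν : Measure Λ} {R : ℝ} (hη : 0 < η) (hR : 0 ≤ R)
    {g : Λ → ENNReal}
    (hg : LogHolder η R g) (x : Λ) :
    g x * ν Set.univ ≤
      ENNReal.ofReal (Real.exp (R * Metric.diam (Set.univ : Set Λ) ^ η)) *
        ν.withDensity g Set.univ := by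
  rw [withDensity_apply _ MeasurableSet.univ, Measure.restrict_univ, ← lintegral_const,
    ← lintegral_const_mul _ (hg.measurable hη)]
  exact lintegral_mono fun y => (hg x y).trans (by gcongr; exact expWeight_le_diam hη hR x y)

end Pushforward

/-! ### Constants of the invariant cone. -/

/-- The contraction ratio `β^{-η/2}`. -/
noncomputable def ratio (β η : ℝ) : ℝ := β ^ (-(η / 2))

/-- The log-Hölder constant of the densities preserved by the induced map. -/
noncomputable def coneConst (β η C₁ : ℝ) : ℝ := 2 * C₁ / (1 - ratio β η)

/-- The proportion of mass which is coupled at each step, for a space of diameter `D`. -/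
noncomputable def gap (D β η C₁ : ℝ) : ℝ :=
  (1 - ratio β η) * Real.exp (-(coneConst β η C₁ * D ^ η))

/-- The bound for the ratio of two invariant-type densities of equal mass. -/
noncomputable def distConst (D β η C₁ : ℝ) : ℝ := Real.exp (2 * (coneConst β η C₁ * D ^ η))

section Constants

variable {D β η C₁ : ℝ}

lemma ratio_pos (hβ : 1 < β) : 0 < ratio β η := Real.rpow_pos_of_pos (by linarith) _

lemma ratio_lt_one (hβ : 1 < β) (hη : 0 < η) : ratio β η < 1 :=
  Real.rpow_lt_one_of_one_lt_of_neg hβ (by linarith)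

lemma ratio_mul_ratio (hβ : 1 < β) : ratio β η * ratio β η = β ^ (-η) := by
  unfold ratio
  rw [← Real.rpow_add (by linarith)]
  ring_nf

lemma coneConst_pos (hβ : 1 < β) (hη : 0 < η) (hC : 1 ≤ C₁) : 0 < coneConst β η C₁ := by
  have := ratio_lt_one hβ hη
  unfold coneConst
  apply div_pos <;> linarith

/-- The fixed-point equation that dictates `coneConst`. A push-forward contracts the constant by
`ratio²`. One factor `ratio` is spent on the loss from subtracting the common part, the other keeps
the cone invariant. Two copies of `C₁` leave room for the distortion and for the oscillation of an
observable. -/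
lemma coneConst_eq (hβ : 1 < β) (hη : 0 < η) :
    coneConst β η C₁ * ratio β η + 2 * C₁ = coneConst β η C₁ := by
  have : 1 - ratio β η ≠ 0 := by linarith [ratio_lt_one hβ hη]
  unfold coneConst
  field_simp
  ring

lemma gap_pos (hβ : 1 < β) (hη : 0 < η) : 0 < gap D β η C₁ :=
  mul_pos (by linarith [ratio_lt_one hβ hη]) (Real.exp_pos _)

lemma gap_lt_one (hD : 0 ≤ D) (hβ : 1 < β) (hη : 0 < η) (hC : 1 ≤ C₁) : gap D β η C₁ < 1 := by
  have h1 := ratio_pos (η := η) hβ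
  have h2 := ratio_lt_one hβ hη
  have h3 : Real.exp (-(coneConst β η C₁ * D ^ η)) ≤ 1 := by
    rw [Real.exp_le_one_iff]
    have := coneConst_pos hβ hη hC
    have : 0 ≤ coneConst β η C₁ * D ^ η := by positivity
    linarith
  unfold gap
  nlinarith [Real.exp_pos (-(coneConst β η C₁ * D ^ η))]

end Constants

/-! ### Exponential coupling. -/

/-- The measures with log-Hölder density of constant `R` with respect to `ν`. -/
def IsLogHolder {Λ : Type*} [MetricSpace Λ] [MeasurableSpace Λ] (η R : ℝ) (ν μ : Measure Λ) :
    Prop :=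
  ∃ g, LogHolder η R g ∧ μ = ν.withDensity g

section Coupling

variable {Λ : Type*} [MetricSpace Λ] [MeasurableSpace Λ]
  {ρ : Measure Λ} {T : Λ → Λ} {Y : Set Λ} {α : Set (Set Λ)}
  {τ : Λ → ℕ} {β η C₁ : ℝ}

lemma IsLogHolder.mono {R R' : ℝ} {ν μ : Measure Λ} (hμ : IsLogHolder η R ν μ) (h : R ≤ R') :
    IsLogHolder η R' ν μ := by
  obtain ⟨g, hg, rfl⟩ := hμ
  exact ⟨g, hg.mono h, rfl⟩

variable [BorelSpace Λ]

lemma IsLogHolder.map (h : NonuniformlyExpanding ρ T Y α τ β η C₁) (hτ : Measurable τ) {R : ℝ}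
    (hR : 0 ≤ R) {μ : Measure Λ} (hμ : IsLogHolder η R (ρ.restrict Y) μ) :
    IsLogHolder η (R * β ^ (-η) + C₁) (ρ.restrict Y) (μ.map (inducedMap T τ)) := by
  obtain ⟨g, hg, rfl⟩ := hμ
  have hβ : 0 < β := by linarith [h.one_lt_β]
  refine exists_logHolder_map h hτ (L := R * β ^ (-η)) (by positivity) fun a ha x hx y hy => ?_
  refine (hg x y).trans ?_
  gcongr
  exact expWeight_le_of_expanding hβ h.η_pos hR (h.expanding a ha x hx y hy)

lemma IsLogHolder.map_coneConst (h : NonuniformlyExpanding ρ T Y α τ β η C₁) (hτ : Measurable τ)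
    {μ : Measure Λ}
    (hμ : IsLogHolder η (coneConst β η C₁ / ratio β η) (ρ.restrict Y) μ) :
    IsLogHolder η (coneConst β η C₁) (ρ.restrict Y) (μ.map (inducedMap T τ)) := by
  have h0 := ratio_pos (η := η) h.one_lt_β
  have h1 := coneConst_pos h.one_lt_β h.η_pos h.one_le_C₁
  refine (hμ.map h hτ (by positivity)).mono ?_
  rw [← ratio_mul_ratio h.one_lt_β]
  have h2 := coneConst_eq (C₁ := C₁) h.one_lt_β h.η_pos
  have h3 : coneConst β η C₁ / ratio β η * (ratio β η * ratio β η) =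
      coneConst β η C₁ * ratio β η := by
    field_simp
  linarith [h.one_le_C₁]

variable [BoundedSpace Λ]

/-- A measure with log-Hölder density splits off a fixed proportion of the reference measure. -/
lemma IsLogHolder.exists_split (h : NonuniformlyExpanding ρ T Y α τ β η C₁)
    {ν : Measure Λ} [IsFiniteMeasure ν] (hν : ν ≠ 0) {μ : Measure Λ} [IsFiniteMeasure μ]
    (hμ : IsLogHolder η (coneConst β η C₁) ν μ) :
    ∃ μ', IsLogHolder η (coneConst β η C₁ / ratio β η) ν μ' ∧ μ' Set.univ = μ Set.univ ∧
      μ = (ENNReal.ofReal (gap (Metric.diam (Set.univ : Set Λ)) β η C₁) * μ Set.univ / ν Set.univ) •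
        ν + ENNReal.ofReal (1 - gap (Metric.diam (Set.univ : Set Λ)) β η C₁) • μ' := by
  obtain ⟨g, hg, hμg⟩ := hμ
  set D := Metric.diam (Set.univ : Set Λ)
  set θ := gap D β η C₁
  set R := coneConst β η C₁
  have hη := h.η_pos
  have hR : 0 < R := coneConst_pos h.one_lt_β hη h.one_le_C₁
  have hθ : 0 < θ := gap_pos h.one_lt_β hη
  have hθ1 : θ < 1 := gap_lt_one Metric.diam_nonneg h.one_lt_β hη h.one_le_C₁
  have hr0 := ratio_pos (η := η) h.one_lt_β
  have hr1 := ratio_lt_one h.one_lt_β hη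
  have hν0 : ν Set.univ ≠ 0 := by simpa using hν
  have hν1 : ν Set.univ ≠ ⊤ := measure_ne_top _ _
  have hM : μ Set.univ ≠ ⊤ := measure_ne_top _ _
  have hgm := hg.measurable hη
  have hfin : ∀ x, g x ≠ ⊤ := by
    intro x hx
    have := hg.le_mass (ν := ν) hη hR.le x
    rw [← hμg, hx, ENNReal.top_mul hν0, top_le_iff] at this
    exact ENNReal.mul_ne_top ENNReal.ofReal_ne_top hM this
  -- The density is at least its mean times `exp (-(R D^η))`. The definition of `gap` makes `c` at
  -- most the fraction `1 - ratio` of that lower bound.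
  set c := ENNReal.ofReal θ * μ Set.univ / ν Set.univ with hc
  have hcg : ∀ x, c ≤ ENNReal.ofReal (1 - ratio β η) * g x := by
    intro x
    have h1 := hg.mass_le (ν := ν) hη hR.le x
    rw [← hμg] at h1
    rw [hc, ENNReal.div_le_iff hν0 hν1]
    calc ENNReal.ofReal θ * μ Set.univ ≤ ENNReal.ofReal θ *
          (ENNReal.ofReal (Real.exp (R * D ^ η)) * g x * ν Set.univ) := by gcongr
      _ = (ENNReal.ofReal θ * ENNReal.ofReal (Real.exp (R * D ^ η))) * g x * ν Set.univ := by ring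
      _ = _ := by
        rw [← ENNReal.ofReal_mul hθ.le]
        congr 3
        simp only [θ, gap]
        rw [mul_assoc, ← Real.exp_add, neg_add_cancel, Real.exp_zero, mul_one]
  have hcg' : ∀ x, c ≤ g x := fun x => (hcg x).trans
    (mul_le_of_le_one_left (zero_le) (ENNReal.ofReal_le_one.2 (by linarith)))
  -- With `δ = 1 - ratio` the new constant is `R / ratio`, which `IsLogHolder.map_coneConst` brings
  -- back to `R` after one push-forward.
  have hsub := hg.tsub_const (δ := 1 - ratio β η) (by linarith) (by linarith) hR.le hfin hcg
  rw [sub_sub_cancel] at hsub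
  have hγ0 : ENNReal.ofReal (1 - θ) ≠ 0 := by simpa using hθ1
  have hγ1 : ENNReal.ofReal (1 - θ) ≠ ⊤ := ENNReal.ofReal_ne_top
  refine ⟨ν.withDensity fun x => (ENNReal.ofReal (1 - θ))⁻¹ * (g x - c),
    ⟨_, hsub.const_mul _, rfl⟩, ?_, ?_⟩
  · have hcfin : c * ν Set.univ = ENNReal.ofReal θ * μ Set.univ :=
      ENNReal.div_mul_cancel hν0 hν1
    rw [withDensity_apply _ MeasurableSet.univ, Measure.restrict_univ,
      lintegral_const_mul _ (by fun_prop), lintegral_sub (by fun_prop)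
        (by rw [lintegral_const, hcfin]; exact ENNReal.mul_ne_top ENNReal.ofReal_ne_top hM)
        (ae_of_all _ hcg'), lintegral_const, hcfin]
    have e : ∫⁻ x, g x ∂ν = μ Set.univ := by
      rw [hμg, withDensity_apply _ MeasurableSet.univ, Measure.restrict_univ]
    rw [e]
    have e2 : μ Set.univ - ENNReal.ofReal θ * μ Set.univ = ENNReal.ofReal (1 - θ) * μ Set.univ := by
      rw [ENNReal.ofReal_sub _ hθ.le, ENNReal.ofReal_one, ENNReal.sub_mul (fun _ _ => hM), one_mul]
    rw [e2, ← mul_assoc, ENNReal.inv_mul_cancel hγ0 hγ1, one_mul]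
  · rw [← withDensity_const c, ← withDensity_smul _ (by fun_prop),
      ← withDensity_add_left (by fun_prop)]
    conv_lhs => rw [hμg]
    congr 1
    ext x
    simp only [Pi.add_apply, Pi.smul_apply, smul_eq_mul]
    rw [← mul_assoc, ENNReal.mul_inv_cancel hγ0 hγ1, one_mul, add_tsub_cancel_of_le (hcg' x)]

/-- Exponential coupling of measures with log-Hölder densities. -/
theorem exists_coupling (h : NonuniformlyExpanding ρ T Y α τ β η C₁) (hτ : Measurable τ)
    [IsFiniteMeasure ρ] (n : ℕ) {μ₁ μ₂ : Measure Λ} [IsFiniteMeasure μ₁] [IsFiniteMeasure μ₂]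
    (h₁ : IsLogHolder η (coneConst β η C₁) (ρ.restrict Y) μ₁)
    (h₂ : IsLogHolder η (coneConst β η C₁) (ρ.restrict Y) μ₂) (hM : μ₁ Set.univ = μ₂ Set.univ) :
    ∃ κ₁ κ₂, IsLogHolder η (coneConst β η C₁) (ρ.restrict Y) κ₁ ∧
      IsLogHolder η (coneConst β η C₁) (ρ.restrict Y) κ₂ ∧ κ₁ Set.univ = μ₁ Set.univ ∧
      κ₂ Set.univ = μ₁ Set.univ ∧
      μ₁.map (inducedMap T τ)^[n] +
          ENNReal.ofReal (1 - gap (Metric.diam (Set.univ : Set Λ)) β η C₁) ^ n • κ₂ =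
        μ₂.map (inducedMap T τ)^[n] +
          ENNReal.ofReal (1 - gap (Metric.diam (Set.univ : Set Λ)) β η C₁) ^ n • κ₁ := by
  induction n generalizing μ₁ μ₂ with
  | zero => exact ⟨μ₁, μ₂, h₁, h₂, rfl, hM.symm, by simp [add_comm]⟩
  | succ n ih =>
    have hF := h.measurable_F hτ
    have hν : ρ.restrict Y ≠ 0 := by
      intro h0
      have := h.base_pos
      rw [← Measure.restrict_apply_univ, h0] at this
      simp at this
    obtain ⟨μ₁', c₁, m₁, e₁⟩ := h₁.exists_split h hν
    obtain ⟨μ₂', c₂, m₂, e₂⟩ := h₂.exists_split h hν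
    have : IsFiniteMeasure μ₁' := ⟨by rw [m₁]; exact measure_lt_top _ _⟩
    have : IsFiniteMeasure μ₂' := ⟨by rw [m₂]; exact measure_lt_top _ _⟩
    have n₁ : μ₁'.map (inducedMap T τ) Set.univ = μ₁ Set.univ := by
      rw [Measure.map_apply hF MeasurableSet.univ, Set.preimage_univ, m₁]
    have n₂ : μ₂'.map (inducedMap T τ) Set.univ = μ₁ Set.univ := by
      rw [Measure.map_apply hF MeasurableSet.univ, Set.preimage_univ, m₂, hM]
    -- The remainders leave the cone by a factor in the constant, and their images under `F` are in
    -- it again, with the same total mass. The remainders sit crosswise in the conclusion since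
    -- measures cannot be subtracted.
    obtain ⟨κ₁, κ₂, hκ₁, hκ₂, k₁, k₂, e⟩ := ih (c₁.map_coneConst h hτ) (c₂.map_coneConst h hτ)
      (n₁.trans n₂.symm)
    refine ⟨κ₁, κ₂, hκ₁, hκ₂, k₁.trans n₁, k₂.trans n₁, ?_⟩
    -- Equal masses make the two split-off multiples of the reference measure the same measure `σ`,
    -- so it contributes equally to both sides.
    rw [hM] at e₁
    rw [Measure.map_map (hF.iterate n) hF, Measure.map_map (hF.iterate n) hF,
      ← Function.iterate_succ] at e
    set γ := ENNReal.ofReal (1 - gap (Metric.diam (Set.univ : Set Λ)) β η C₁)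
    set σ := (ENNReal.ofReal (gap (Metric.diam (Set.univ : Set Λ)) β η C₁) * μ₂ Set.univ /
      (ρ.restrict Y) Set.univ) • ρ.restrict Y
    have hFn := hF.iterate (n + 1)
    rw [e₁, e₂, Measure.map_add _ _ hFn, Measure.map_add _ _ hFn, Measure.map_smul,
      Measure.map_smul, Measure.map_smul, add_assoc, add_assoc, pow_succ', mul_smul, mul_smul,
      ← smul_add, e,
      smul_add]

end Coupling

/-! ### The invariant density is log-Hölder. -/

/-- The hypothesis is used only on the set where `g ≤ f`. Applied in both directions, it turns
closeness on all sets into `L¹` closeness of densities. -/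
lemma lintegral_tsub_le {Ω : Type*} [MeasurableSpace Ω] {ν : Measure Ω} {f g : Ω → ENNReal}
    (hf : Measurable f) (hg : Measurable g) (hfin : ∫⁻ x, g x ∂ν ≠ ⊤) {ε : ENNReal}
    (h : ∀ B, MeasurableSet B → ∫⁻ x in B, f x ∂ν ≤ ∫⁻ x in B, g x ∂ν + ε) :
    ∫⁻ x, (f x - g x) ∂ν ≤ ε := by
  have hB : MeasurableSet {x | g x ≤ f x} := measurableSet_le hg hf
  have e : (fun x => f x - g x) = {x | g x ≤ f x}.indicator fun x => f x - g x := by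
    ext x
    by_cases hx : g x ≤ f x
    · simp [Set.indicator, hx]
    · simp only [Set.indicator, Set.mem_ofPred_eq, hx, if_false]
      exact tsub_eq_zero_of_le (not_le.1 hx).le
  have hmem : ∀ᵐ x ∂ν.restrict {x | g x ≤ f x}, g x ≤ f x := ae_restrict_mem hB
  rw [e, lintegral_indicator hB, lintegral_sub hg
    (ne_top_of_le_ne_top hfin (setLIntegral_le_lintegral _ _)) hmem, tsub_le_iff_left]
  exact h _ hB

section Approximation

variable {Λ : Type*} [MetricSpace Λ] {η : ℝ}

lemma monotone_iInf_expWeight (G : Λ → ENNReal) :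
    Monotone fun (n : ℕ) (y : Λ) => ⨅ x ∈ Set.univ, expWeight η n y (id x) * G x := by
  intro m n hmn y
  refine iInf₂_mono fun x _ => ?_
  gcongr
  exact expWeight_mono (by exact_mod_cast hmn) _ _

/-- Near `y`, lower semicontinuity keeps `G` above any level below `G y`. Farther than `r`, the
weight is at least `exp (n r^η)`, and since `G` is bounded below by `e ≠ 0`, the product exceeds any
finite level for large `n`. -/
lemma iSup_iInf_expWeight (hη : 0 < η) {G : Λ → ENNReal} (hG : LowerSemicontinuous G)
    {e : ENNReal} (he : e ≠ 0) (hGe : ∀ x, e ≤ G x) (y : Λ) :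
    ⨆ n : ℕ, ⨅ x ∈ Set.univ, expWeight η n y (id x) * G x = G y := by
  apply le_antisymm
  · refine iSup_le fun n => (iInf₂_le y trivial).trans ?_
    rw [id, expWeight_self hη, one_mul]
  · refine le_of_forall_lt fun c hc => ?_
    obtain ⟨c', hc', hc2⟩ := exists_between hc
    refine hc'.trans_le ?_
    have hcfin : c' ≠ ⊤ := hc2.ne_top
    obtain ⟨r, hr, hball⟩ := Metric.eventually_nhds_iff.1 (hG y c' hc2)
    have hlim : Tendsto (fun n : ℕ => ENNReal.ofReal (Real.exp (n * r ^ η)) * e) atTop (𝓝 ⊤) := by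
      have h1 : Tendsto (fun n : ℕ => Real.exp (n * r ^ η)) atTop atTop :=
        Real.tendsto_exp_atTop.comp
          (tendsto_natCast_atTop_atTop.atTop_mul_const (Real.rpow_pos_of_pos hr η))
      have h2 := ENNReal.Tendsto.mul_const (b := e) (ENNReal.tendsto_ofReal_atTop.comp h1)
        (Or.inl ENNReal.top_ne_zero)
      rwa [ENNReal.top_mul he] at h2
    obtain ⟨n, hn⟩ := (hlim.eventually (lt_mem_nhds (lt_top_iff_ne_top.2 hcfin))).exists
    refine le_trans ?_ (le_iSup _ n)
    refine le_iInf₂ fun x _ => ?_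
    by_cases hx : dist x y < r
    · exact (hball hx).le.trans (le_mul_of_one_le_left (zero_le)
        (one_le_expWeight (Nat.cast_nonneg n) _ _))
    · refine hn.le.trans ?_
      refine mul_le_mul' ?_ (hGe x)
      unfold expWeight
      gcongr
      rw [id, dist_comm]
      exact not_lt.1 hx

end Approximation

section Invariant

variable {Λ : Type*} [MetricSpace Λ] [MeasurableSpace Λ] [BorelSpace Λ]
  {ρ : Measure Λ} {T : Λ → Λ} {Y : Set Λ} {α : Set (Set Λ)}
  {τ : Λ → ℕ} {β η C₁ : ℝ}

/-- Each step multiplies the constant by `β^(-η)` and adds `C₁`, which keeps `coneConst / 2` from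
growing. The other half of `coneConst` is left for the transient `R β^(-η k)`. -/
lemma IsLogHolder.map_iterate (h : NonuniformlyExpanding ρ T Y α τ β η C₁) (hτ : Measurable τ)
    {R : ℝ} (hR : 0 ≤ R) {μ : Measure Λ} (hμ : IsLogHolder η R (ρ.restrict Y) μ) (k : ℕ) :
    IsLogHolder η (R * (β ^ (-η)) ^ k + coneConst β η C₁ / 2) (ρ.restrict Y)
      (μ.map (inducedMap T τ)^[k]) := by
  have h0 := ratio_pos (η := η) h.one_lt_β
  have h1 := coneConst_pos h.one_lt_β h.η_pos h.one_le_C₁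
  have h2 := coneConst_eq (C₁ := C₁) h.one_lt_β h.η_pos
  have h3 := ratio_lt_one h.one_lt_β h.η_pos
  have hβ : 0 < β := by linarith [h.one_lt_β]
  induction k with
  | zero =>
    simp only [pow_zero, mul_one, Function.iterate_zero, Measure.map_id]
    exact hμ.mono (by linarith)
  | succ k ih =>
    have hF := h.measurable_F hτ
    have := ih.map h hτ (by positivity)
    rw [Measure.map_map hF (hF.iterate k), ← Function.iterate_succ'] at this
    refine this.mono ?_
    rw [pow_succ]
    have h4 : β ^ (-η) ≤ ratio β η := by
      rw [← ratio_mul_ratio h.one_lt_β]; nlinarith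
    nlinarith

/-- An invariant probability measure is approximated in total variation by measures with
log-Hölder densities of a fixed constant. -/
lemma exists_isLogHolder_approx (h : NonuniformlyExpanding ρ T Y α τ β η C₁) (hτ : Measurable τ)
    [IsFiniteMeasure ρ] {μY : Measure Λ} [IsProbabilityMeasure μY] (hac : μY ≪ ρ.restrict Y)
    (hinv : μY.map (inducedMap T τ) = μY) {ε : ENNReal} (hε : ε ≠ 0)
    (hεt : ε ≠ ⊤) :
    ∃ κ, IsLogHolder η (coneConst β η C₁) (ρ.restrict Y) κ ∧
      ∀ B, MeasurableSet B → κ B ≤ μY B + ε ∧ μY B ≤ κ B + ε := by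
  set ν := ρ.restrict Y with hνdef
  have hF := h.measurable_F hτ
  have hν0 : ν Set.univ ≠ 0 := by
    rw [hνdef, Measure.restrict_apply_univ]; exact h.base_pos.ne'
  have hν1 : ν Set.univ ≠ ⊤ := measure_ne_top _ _
  have hε2 : ε / 2 ≠ 0 := by simpa using hε
  set h0 := μY.rnDeriv ν
  have hh0 : ν.withDensity h0 = μY := Measure.withDensity_rnDeriv_eq _ _ hac
  have hh0m : Measurable h0 := Measure.measurable_rnDeriv _ _
  obtain ⟨G0, hG0, hG0l, hG0i⟩ := exists_le_lowerSemicontinuous_lintegral_ge ν h0 hh0m hε2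
  -- Half of `ε` pays for the lower semicontinuous majorant, the other half for a constant that
  -- makes it strictly positive, as multiplicative weights require.
  set e := ε / 2 / ν Set.univ with hedef
  have he : e ≠ 0 := ENNReal.div_ne_zero.2 ⟨hε2, hν1⟩
  set G : Λ → ENNReal := fun x => G0 x + e with hGdef
  have hGl : LowerSemicontinuous G := hG0l.add lowerSemicontinuous_const
  have hGm : Measurable G := hGl.measurable
  have hGi : ∫⁻ x, G x ∂ν ≤ 1 + ε := by
    have e1 : ∫⁻ x, h0 x ∂ν = 1 := by
      have : ν.withDensity h0 Set.univ = 1 := by rw [hh0]; exact measure_univ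
      rwa [withDensity_apply _ MeasurableSet.univ, Measure.restrict_univ] at this
    rw [lintegral_add_right _ measurable_const, lintegral_const, hedef,
      ENNReal.div_mul_cancel hν0 hν1]
    calc _ ≤ (1 + ε / 2) + ε / 2 := by rw [← e1]; gcongr
      _ = _ := by rw [add_assoc, ENNReal.add_halves]
  have hGfin : ∫⁻ x, G x ∂ν ≠ ⊤ := ne_top_of_le_ne_top (by finiteness) hGi
  have hle : ∀ S, μY S ≤ ν.withDensity G S := by
    intro S
    have : ν.withDensity h0 ≤ ν.withDensity G :=
      withDensity_mono (ae_of_all _ fun x => (hG0 x).trans le_self_add)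
    rw [hh0] at this
    exact this S
  have hGuniv : ν.withDensity G Set.univ ≤ 1 + ε := by
    rwa [withDensity_apply _ MeasurableSet.univ, Measure.restrict_univ]
  -- The new measure dominates `μY` and has total mass at most `1 + ε`, so its excess over `μY` on
  -- any single set is at most `ε`.
  have hge : ∀ S, MeasurableSet S → ν.withDensity G S ≤ μY S + ε := by
    intro S hS
    have h1 : ν.withDensity G S + μY Sᶜ ≤ μY S + ε + μY Sᶜ := by
      calc ν.withDensity G S + μY Sᶜ ≤ ν.withDensity G S + ν.withDensity G Sᶜ :=
            add_le_add le_rfl (hle _)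
        _ = ν.withDensity G Set.univ := measure_add_measure_compl hS
        _ ≤ 1 + ε := hGuniv
        _ = μY S + ε + μY Sᶜ := by
          rw [add_right_comm, measure_add_measure_compl hS, measure_univ]
    exact (ENNReal.add_le_add_iff_right (measure_ne_top _ _)).1 h1
  -- the infimal convolutions
  set g : ℕ → Λ → ENNReal := fun n y => ⨅ x ∈ Set.univ, expWeight η n y (id x) * G x with hg
  have hgL : ∀ n : ℕ, LogHolder η n (g n) := fun n =>
    LogHolder.iInf_expWeight h.η_pos h.η_le_one (Nat.cast_nonneg n) id Set.univ G
  have hgm : ∀ n, Measurable (g n) := fun n => (hgL n).measurable h.η_pos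
  have hgsup : ∀ y, ⨆ n, g n y = G y := fun y =>
    iSup_iInf_expWeight h.η_pos hGl he (fun x => le_add_self) y
  have hgG : ∀ n y, g n y ≤ G y := fun n y => by
    rw [← hgsup]; exact le_iSup (fun n => g n y) n
  have hint : Tendsto (fun n => ∫⁻ y, g n y ∂ν) atTop (𝓝 (∫⁻ y, G y ∂ν)) := by
    rw [← lintegral_congr hgsup, lintegral_iSup hgm (monotone_iInf_expWeight G)]
    exact tendsto_atTop_iSup fun m n hmn =>
      lintegral_mono fun y => monotone_iInf_expWeight G hmn y
  obtain ⟨n, hn⟩ : ∃ n, ∫⁻ y, G y ∂ν ≤ ∫⁻ y, g n y ∂ν + ε := by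
    have h1 : Tendsto (fun n => ∫⁻ y, g n y ∂ν + ε) atTop (𝓝 (∫⁻ y, G y ∂ν + ε)) :=
      hint.add tendsto_const_nhds
    obtain ⟨n, hn⟩ := (h1.eventually (lt_mem_nhds (ENNReal.lt_add_right hGfin hε))).exists
    exact ⟨n, hn.le⟩
  have hnS : ∀ S, MeasurableSet S → ν.withDensity G S ≤ ν.withDensity (g n) S + ε := by
    intro S hS
    have hfin : ν.withDensity (g n) Sᶜ ≠ ⊤ := by
      refine ne_top_of_le_ne_top hGfin ?_
      rw [withDensity_apply _ hS.compl]
      exact (setLIntegral_le_lintegral _ _).trans (lintegral_mono (hgG n))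
    have h1 : ν.withDensity G S + ν.withDensity (g n) Sᶜ ≤
        ν.withDensity (g n) S + ε + ν.withDensity (g n) Sᶜ := by
      calc ν.withDensity G S + ν.withDensity (g n) Sᶜ ≤
            ν.withDensity G S + ν.withDensity G Sᶜ :=
            add_le_add le_rfl (withDensity_mono (ae_of_all _ (hgG n)) _)
        _ = ∫⁻ y, G y ∂ν := by
          rw [measure_add_measure_compl hS, withDensity_apply _ MeasurableSet.univ,
            Measure.restrict_univ]
        _ ≤ ∫⁻ y, g n y ∂ν + ε := hn
        _ = _ := by
          rw [add_right_comm, measure_add_measure_compl hS, withDensity_apply _ MeasurableSet.univ,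
            Measure.restrict_univ]
    exact (ENNReal.add_le_add_iff_right hfin).1 h1
  -- iterate until the constant is small
  have hR := coneConst_pos h.one_lt_β h.η_pos h.one_le_C₁
  have hβ : 0 < β := by linarith [h.one_lt_β]
  obtain ⟨N, hN⟩ : ∃ N : ℕ, (n : ℝ) * (β ^ (-η)) ^ N ≤ coneConst β η C₁ / 2 := by
    have h1 : Tendsto (fun N : ℕ => (n : ℝ) * (β ^ (-η)) ^ N) atTop (𝓝 (n * 0)) :=
      (tendsto_pow_atTop_nhds_zero_of_lt_one (by positivity)
        (Real.rpow_lt_one_of_one_lt_of_neg h.one_lt_β (by linarith [h.η_pos]))).const_mul _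
    rw [mul_zero] at h1
    obtain ⟨N, hN⟩ := (h1.eventually (gt_mem_nhds (half_pos hR))).exists
    exact ⟨N, hN.le⟩
  have hFN := hF.iterate N
  have hinvN : μY.map (inducedMap T τ)^[N] = μY := by
    have : MeasurePreserving (inducedMap T τ) μY μY := ⟨hF, hinv⟩
    exact (this.iterate N).map_eq
  refine ⟨(ν.withDensity (g n)).map (inducedMap T τ)^[N],
    (IsLogHolder.map_iterate h hτ (Nat.cast_nonneg n) ⟨g n, hgL n, rfl⟩ N).mono (by linarith),
    fun B hB => ?_⟩
  have hS : MeasurableSet ((inducedMap T τ)^[N] ⁻¹' B) := hFN hB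
  have hμB : μY B = μY ((inducedMap T τ)^[N] ⁻¹' B) := by
    conv_lhs => rw [← hinvN, Measure.map_apply hFN hB]
  -- Since `μY` is invariant, the comparison on `B` after `N` steps is the comparison on the
  -- preimage of `B` before them: iterating improves the constant and loses nothing in the
  -- approximation.
  rw [Measure.map_apply hFN hB, hμB]
  exact ⟨(withDensity_mono (ae_of_all _ (hgG n)) _).trans (hge _ hS), (hle _).trans (hnS _ hS)⟩

/-- The absolutely continuous invariant probability measure has a log-Hölder density. -/
theorem isLogHolder_of_invariant (h : NonuniformlyExpanding ρ T Y α τ β η C₁) (hτ : Measurable τ)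
    [IsFiniteMeasure ρ] {μY : Measure Λ} [IsProbabilityMeasure μY] (hac : μY ≪ ρ.restrict Y)
    (hinv : μY.map (inducedMap T τ) = μY) :
    IsLogHolder η (coneConst β η C₁) (ρ.restrict Y) μY := by
  have key := fun j : ℕ => exists_isLogHolder_approx h hτ hac hinv
    (ε := 2⁻¹ ^ j) (by simp) (by finiteness)
  choose κ hκ hκB using key
  choose g hgL hgκ using hκ
  set ν := ρ.restrict Y
  set h0 := μY.rnDeriv ν
  have hh0 : ν.withDensity h0 = μY := Measure.withDensity_rnDeriv_eq _ _ hac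
  have hh0m : Measurable h0 := Measure.measurable_rnDeriv _ _
  have hgm : ∀ j, Measurable (g j) := fun j => (hgL j).measurable h.η_pos
  have hi : ∀ j B, MeasurableSet B → ∫⁻ x in B, g j x ∂ν ≤ ∫⁻ x in B, h0 x ∂ν + 2⁻¹ ^ j ∧
      ∫⁻ x in B, h0 x ∂ν ≤ ∫⁻ x in B, g j x ∂ν + 2⁻¹ ^ j := by
    intro j B hB
    rw [← withDensity_apply _ hB, ← withDensity_apply _ hB, hh0, ← hgκ]
    exact hκB j B hB
  have h0fin : ∫⁻ x, h0 x ∂ν ≠ ⊤ := by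
    rw [← Measure.restrict_univ (μ := ν), ← withDensity_apply _ MeasurableSet.univ, hh0]
    exact measure_ne_top _ _
  have hgfin : ∀ j, ∫⁻ x, g j x ∂ν ≠ ⊤ := by
    intro j
    have := (hi j Set.univ MeasurableSet.univ).1
    rw [Measure.restrict_univ] at this
    exact ne_top_of_le_ne_top (by finiteness) this
  -- The errors `2^(-j)` are summable, so the `L¹` distances are too, and the approximating
  -- densities converge almost everywhere.
  have hsum : ∫⁻ x, ∑' j, ((g j x - h0 x) + (h0 x - g j x)) ∂ν ≠ ⊤ := by
    rw [lintegral_tsum (fun j => by fun_prop)]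
    have hb : ∀ j, ∫⁻ x, ((g j x - h0 x) + (h0 x - g j x)) ∂ν ≤ 2 * 2⁻¹ ^ j := by
      intro j
      rw [lintegral_add_left (by fun_prop), two_mul]
      exact add_le_add (lintegral_tsub_le (hgm j) hh0m h0fin fun B hB => (hi j B hB).1)
        (lintegral_tsub_le hh0m (hgm j) (hgfin j) fun B hB => (hi j B hB).2)
    refine ne_top_of_le_ne_top ?_ (ENNReal.tsum_le_tsum hb)
    rw [ENNReal.tsum_mul_left, ENNReal.tsum_geometric]
    simp [ENNReal.mul_eq_top]
  have hae : (fun x => limsup (fun j => g j x) atTop) =ᵐ[ν] h0 := by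
    filter_upwards [ae_lt_top' (by fun_prop) hsum, ae_lt_top hh0m h0fin] with x hx hx0
    have ht := ENNReal.tendsto_atTop_zero_of_tsum_ne_top hx.ne
    have t1 : Tendsto (fun j => h0 x + ((g j x - h0 x) + (h0 x - g j x))) atTop (𝓝 (h0 x)) := by
      simpa using tendsto_const_nhds.add ht
    have t2 : Tendsto (fun j => h0 x - ((g j x - h0 x) + (h0 x - g j x))) atTop (𝓝 (h0 x)) := by
      simpa using ENNReal.Tendsto.sub tendsto_const_nhds ht (Or.inl hx0.ne)
    refine (tendsto_of_tendsto_of_tendsto_of_le_of_le t2 t1 (fun j => ?_) fun j => ?_).limsup_eq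
    · refine tsub_le_iff_right.2 ?_
      refine (le_add_tsub (a := h0 x) (b := g j x)).trans ?_
      gcongr
      exact le_add_self
    · refine (le_add_tsub (a := g j x) (b := h0 x)).trans ?_
      gcongr
      exact le_self_add
  -- The upper limit is defined everywhere and inherits the pointwise inequality, so it is a
  -- log-Hölder version of the invariant density.
  exact ⟨_, LogHolder.limsup hgL, by rw [withDensity_congr_ae hae, hh0]⟩

end Invariant

/-! ### Decay of correlations and decoupling. -/

section Decay

variable {Λ : Type*} [MetricSpace Λ] [MeasurableSpace Λ] [BorelSpace Λ]
  {ρ : Measure Λ} [IsFiniteMeasure ρ] {T : Λ → Λ} {Y : Set Λ} {α : Set (Set Λ)}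
  {τ : Λ → ℕ} {β η C₁ : ℝ} {μY : Measure Λ} [IsProbabilityMeasure μY]

/-- The image of a measure whose density with respect to `μY` varies regularly along the
branches. -/
lemma isLogHolder_map_withDensity (h : NonuniformlyExpanding ρ T Y α τ β η C₁) (hτ : Measurable τ)
    (hac : μY ≪ ρ.restrict Y) (hinv : μY.map (inducedMap T τ) = μY)
    {w : Λ → ENNReal} (hw : Measurable w)
    (hwL : ∀ a ∈ α, ∀ x ∈ a, ∀ y ∈ a,
      w x ≤ expWeight η C₁ (inducedMap T τ x) (inducedMap T τ y) * w y) :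
    IsLogHolder η (coneConst β η C₁) (ρ.restrict Y)
      ((μY.withDensity w).map (inducedMap T τ)) := by
  obtain ⟨k, hk, hμk⟩ := isLogHolder_of_invariant h hτ hac hinv
  have hR := coneConst_pos h.one_lt_β h.η_pos h.one_le_C₁
  have hβ : 0 < β := by linarith [h.one_lt_β]
  have h0 := ratio_pos (η := η) h.one_lt_β
  have h1 := ratio_lt_one h.one_lt_β h.η_pos
  have hC := h.one_le_C₁
  have key : IsLogHolder η (coneConst β η C₁ * β ^ (-η) + C₁ + C₁) (ρ.restrict Y)
      (((ρ.restrict Y).withDensity (k * w)).map (inducedMap T τ)) := by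
    refine exists_logHolder_map h hτ (by positivity) fun a ha x hx y hy => ?_
    rw [← expWeight_add]
    calc k x * w x ≤ (expWeight η (coneConst β η C₁) x y * k y) *
          (expWeight η C₁ (inducedMap T τ x) (inducedMap T τ y) * w y) :=
          mul_le_mul' (hk x y) (hwL a ha x hx y hy)
      _ ≤ (expWeight η (coneConst β η C₁ * β ^ (-η)) (inducedMap T τ x) (inducedMap T τ y) * k y) *
          (expWeight η C₁ (inducedMap T τ x) (inducedMap T τ y) * w y) := by
          gcongr
          exact expWeight_le_of_expanding hβ h.η_pos hR.le (h.expanding a ha x hx y hy)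
      _ = _ := by simp only [Pi.mul_apply]; ring
  rw [withDensity_mul _ (hk.measurable h.η_pos) hw, ← hμk] at key
  refine key.mono ?_
  have h2 := coneConst_eq (C₁ := C₁) h.one_lt_β h.η_pos
  have h3 : β ^ (-η) ≤ ratio β η := by
    rw [← ratio_mul_ratio h.one_lt_β]; nlinarith
  nlinarith

variable [BoundedSpace Λ]

/-- Measures with log-Hölder densities are dominated by a probability measure with log-Hölder
density. -/
lemma IsLogHolder.le_smul {R : ℝ} (hη : 0 < η) (hR : 0 ≤ R) {ν κ : Measure Λ}
    [IsFiniteMeasure ν] (hκ : IsLogHolder η R ν κ) (hμ : IsLogHolder η R ν μY) :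
    κ ≤ (ENNReal.ofReal (Real.exp (2 * (R * Metric.diam (Set.univ : Set Λ) ^ η))) *
      κ Set.univ) • μY := by
  obtain ⟨g, hg, hκg⟩ := hκ
  obtain ⟨k, hk, hμk⟩ := hμ
  have hν0 : ν Set.univ ≠ 0 := by
    intro h0
    have h1 : μY Set.univ = 1 := measure_univ
    rw [Measure.measure_univ_eq_zero.1 h0] at hμk
    rw [hμk] at h1
    simp at h1
  have hν1 : ν Set.univ ≠ ⊤ := measure_ne_top _ _
  set e := ENNReal.ofReal (Real.exp (R * Metric.diam (Set.univ : Set Λ) ^ η))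
  have he : ENNReal.ofReal (Real.exp (2 * (R * Metric.diam (Set.univ : Set Λ) ^ η))) = e * e := by
    rw [← ENNReal.ofReal_mul (Real.exp_pos _).le, ← Real.exp_add, two_mul]
  rw [he]
  have hpt : ∀ x, g x ≤ (e * e * κ Set.univ) * k x := by
    intro x
    have h1 := hg.le_mass (ν := ν) hη hR x
    have h2 := hk.mass_le (ν := ν) hη hR x
    rw [← hκg] at h1
    rw [← hμk, measure_univ] at h2
    refine (ENNReal.mul_le_mul_iff_left hν0 hν1).1 ?_
    calc g x * ν Set.univ ≤ e * κ Set.univ * 1 := by rwa [mul_one]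
      _ ≤ e * κ Set.univ * (e * k x * ν Set.univ) := by gcongr
      _ = _ := by ring
  have : κ ≤ ν.withDensity ((e * e * κ Set.univ) • k) := by
    conv_lhs => rw [hκg]
    exact withDensity_mono (ae_of_all _ hpt)
  rwa [withDensity_smul _ (hk.measurable hη), ← hμk] at this

/-- A function of `τ` is constant on branches, so the measure it weights is pushed by `F` to one
with density in the cone. Such a density is at most a constant times its mass, relative to `μY`:
what happens before the return is independent of what follows, up to the factor `distConst`. -/
lemma lintegral_comp_return_le (h : NonuniformlyExpanding ρ T Y α τ β η C₁) (hτ : Measurable τ)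
    (hac : μY ≪ ρ.restrict Y) (hinv : μY.map (inducedMap T τ) = μY)
    (s : ℕ → ENNReal) {W : Λ → ENNReal} (hW : Measurable W) :
    ∫⁻ x, s (τ x) * W (inducedMap T τ x) ∂μY ≤
      ENNReal.ofReal (distConst (Metric.diam (Set.univ : Set Λ)) β η C₁) *
        (∫⁻ x, s (τ x) ∂μY) * ∫⁻ x, W x ∂μY := by
  have hF := h.measurable_F hτ
  have hs : Measurable fun x => s (τ x) := (measurable_of_countable s).comp hτ
  have hR := coneConst_pos h.one_lt_β h.η_pos h.one_le_C₁
  have hκ := isLogHolder_map_withDensity h hτ hac hinv hs fun a ha x hx y hy => by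
    rw [h.return_const a ha x hx y hy]
    exact le_mul_of_one_le_left (zero_le)
      (one_le_expWeight (by linarith [h.one_le_C₁]) _ _)
  have hle := hκ.le_smul h.η_pos hR.le (isLogHolder_of_invariant h hτ hac hinv)
  have e1 : (μY.withDensity fun x => s (τ x)).map (inducedMap T τ) Set.univ =
      ∫⁻ x, s (τ x) ∂μY := by
    rw [Measure.map_apply hF MeasurableSet.univ, Set.preimage_univ,
      withDensity_apply _ MeasurableSet.univ, Measure.restrict_univ]
  rw [e1] at hle
  calc ∫⁻ x, s (τ x) * W (inducedMap T τ x) ∂μY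
      = ∫⁻ x, W x ∂((μY.withDensity fun x => s (τ x)).map (inducedMap T τ)) := by
        rw [lintegral_map hW hF,
          lintegral_withDensity_eq_lintegral_mul _ hs
            (show Measurable fun x => W (inducedMap T τ x) from hW.comp hF)]
        rfl
    _ ≤ _ := by
      refine (lintegral_mono' hle le_rfl).trans ?_
      rw [lintegral_smul_measure]
      rfl

lemma abs_sub_le_of_add_eq {a b c d M : ℝ} (h : a + c = b + d) (hc : 0 ≤ c) (hd : 0 ≤ d)
    (hcM : c ≤ M) (hdM : d ≤ M) : |a - b| ≤ M := by
  rw [abs_le]; constructor <;> linarith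

/-- Exponential decay, uniformly over sets, for observables which are regular along the
branches. -/
theorem abs_setIntegral_preimage_iterate_le (h : NonuniformlyExpanding ρ T Y α τ β η C₁)
    (hτ : Measurable τ) (hac : μY ≪ ρ.restrict Y) (hinv : μY.map (inducedMap T τ) = μY)
    (hτi : Integrable (fun x => (τ x : ℝ)) μY) {V : ℝ} (hV : 0 ≤ V) {u : Λ → ℝ}
    (hu : Measurable u) (hub : ∀ x ∈ Y, |u x| ≤ V * τ x)
    (huL : ∀ a ∈ α, ∀ x ∈ a, ∀ y ∈ a,
      |u x - u y| ≤ V * τ x * (C₁ * dist (inducedMap T τ x) (inducedMap T τ y) ^ η))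
    (hu0 : ∫ x, u x ∂μY = 0) (k : ℕ) {B : Set Λ} (hB : MeasurableSet B) :
    |∫ x in (inducedMap T τ)^[k + 1] ⁻¹' B, u x ∂μY| ≤
      (1 - gap (Metric.diam (Set.univ : Set Λ)) β η C₁) ^ k *
        (distConst (Metric.diam (Set.univ : Set Λ)) β η C₁ * (2 * V * ∫ x, (τ x : ℝ) ∂μY)) *
        μY.real B := by
  have hF := h.measurable_F hτ
  have hR := coneConst_pos h.one_lt_β h.η_pos h.one_le_C₁
  have hγ0 : 0 ≤ 1 - gap (Metric.diam (Set.univ : Set Λ)) β η C₁ := by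
    linarith [gap_lt_one (D := Metric.diam (Set.univ : Set Λ)) Metric.diam_nonneg h.one_lt_β
      h.η_pos h.one_le_C₁]
  have hYae : ∀ᵐ x ∂μY, x ∈ Y := hac (ae_restrict_mem h.measurableSet_base)
  have hτm : Measurable fun x => (τ x : ℝ) := (measurable_of_countable _).comp hτ
  have hui : Integrable u μY := by
    refine (hτi.const_mul V).mono' hu.aestronglyMeasurable ?_
    filter_upwards [hYae] with x hx
    exact hub x hx
  -- Two nonnegative weights of equal mass whose difference is `u`. The factor `2` makes `w₁ ≥ V τ`,
  -- so the oscillation of `u` on a branch is at most `t w₁`, and `1 + t ≤ exp t` gives the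
  -- log-Hölder bound with constant `C₁`.
  set w₁ : Λ → ℝ := fun x => u x + 2 * V * τ x with hw₁
  set w₂ : Λ → ℝ := fun x => 2 * V * τ x with hw₂
  have hw₁m : Measurable w₁ := by fun_prop
  have hw₂m : Measurable w₂ := by fun_prop
  have hw₂i : Integrable w₂ μY := hτi.const_mul _
  have hw₁i : Integrable w₁ μY := hui.add hw₂i
  have hw₁0 : ∀ᵐ x ∂μY, 0 ≤ w₁ x := by
    filter_upwards [hYae] with x hx
    have := (abs_le.1 (hub x hx)).1
    have : 0 ≤ V * τ x := by positivity
    simp only [hw₁]; linarith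
  have hw₂0 : ∀ᵐ x ∂μY, 0 ≤ w₂ x := ae_of_all _ fun x => by simp only [hw₂]; positivity
  set M := 2 * V * ∫ x, (τ x : ℝ) ∂μY with hM
  have hM2 : ∫ x, w₂ x ∂μY = M := by rw [hM, ← integral_const_mul]
  have hM1 : ∫ x, w₁ x ∂μY = M := by rw [integral_add hui hw₂i, hu0, zero_add, hM2]
  have hM0 : 0 ≤ M := by rw [← hM2]; exact integral_nonneg_of_ae hw₂0
  have hmass : ∀ w : Λ → ℝ, Integrable w μY → (∀ᵐ x ∂μY, 0 ≤ w x) → ∀ S, MeasurableSet S →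
      (μY.withDensity fun x => ENNReal.ofReal (w x)) S = ENNReal.ofReal (∫ x in S, w x ∂μY) := by
    intro w hwi hw0 S hS
    rw [withDensity_apply _ hS, ofReal_integral_eq_lintegral_ofReal hwi.integrableOn
      (ae_restrict_of_ae hw0)]
  -- The first iterate brings both weights into the cone. Only the other `k` iterates contract,
  -- hence the power `k` for `k + 1` iterates.
  set l₁ := (μY.withDensity fun x => ENNReal.ofReal (w₁ x)).map (inducedMap T τ)
  set l₂ := (μY.withDensity fun x => ENNReal.ofReal (w₂ x)).map (inducedMap T τ)
  have hl₁u : l₁ Set.univ = ENNReal.ofReal M := by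
    rw [Measure.map_apply hF MeasurableSet.univ, Set.preimage_univ,
      hmass w₁ hw₁i hw₁0 _ MeasurableSet.univ, Measure.restrict_univ, hM1]
  have hl₂u : l₂ Set.univ = ENNReal.ofReal M := by
    rw [Measure.map_apply hF MeasurableSet.univ, Set.preimage_univ,
      hmass w₂ hw₂i hw₂0 _ MeasurableSet.univ, Measure.restrict_univ, hM2]
  have : IsFiniteMeasure l₁ := ⟨by rw [hl₁u]; exact ENNReal.ofReal_lt_top⟩
  have : IsFiniteMeasure l₂ := ⟨by rw [hl₂u]; exact ENNReal.ofReal_lt_top⟩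
  have hl₁ : IsLogHolder η (coneConst β η C₁) (ρ.restrict Y) l₁ := by
    refine isLogHolder_map_withDensity h hτ hac hinv (by fun_prop) fun a ha x hx y hy => ?_
    unfold expWeight
    rw [← ENNReal.ofReal_mul (Real.exp_pos _).le]
    apply ENNReal.ofReal_le_ofReal
    have e1 := (abs_le.1 (huL a ha x hx y hy)).2
    have e2 := (abs_le.1 (hub y (h.subset ha hy))).1
    have e3 := h.return_const a ha x hx y hy
    simp only [hw₁]
    rw [e3] at e1 ⊢
    set t := C₁ * dist (inducedMap T τ x) (inducedMap T τ y) ^ η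
    have ht : 0 ≤ t := by have := h.one_le_C₁; positivity
    have hVτ : 0 ≤ V * τ y := by positivity
    have e4 := Real.add_one_le_exp t
    nlinarith [mul_le_mul_of_nonneg_right e4 (by linarith : 0 ≤ u y + 2 * V * τ y)]
  have hl₂ : IsLogHolder η (coneConst β η C₁) (ρ.restrict Y) l₂ := by
    refine isLogHolder_map_withDensity h hτ hac hinv (by fun_prop) fun a ha x hx y hy => ?_
    simp only [hw₂]
    rw [h.return_const a ha x hx y hy]
    exact le_mul_of_one_le_left (zero_le)
      (one_le_expWeight (by linarith [h.one_le_C₁]) _ _)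
  obtain ⟨κ₁, κ₂, hκ₁, hκ₂, m₁, m₂, e⟩ :=
    exists_coupling h hτ k hl₁ hl₂ (hl₁u.trans hl₂u.symm)
  have hμ := isLogHolder_of_invariant h hτ hac hinv
  have d₁ := hκ₁.le_smul h.η_pos hR.le hμ
  have d₂ := hκ₂.le_smul h.η_pos hR.le hμ
  rw [m₁, hl₁u] at d₁
  rw [m₂, hl₁u] at d₂
  set S := (inducedMap T τ)^[k + 1] ⁻¹' B
  have hS : MeasurableSet S := (hF.iterate (k + 1)) hB
  have hle : ∀ w : Λ → ℝ, Integrable w μY → (∀ᵐ x ∂μY, 0 ≤ w x) →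
      ((μY.withDensity fun x => ENNReal.ofReal (w x)).map (inducedMap T τ)).map
        (inducedMap T τ)^[k] B = ENNReal.ofReal (∫ x in S, w x ∂μY) := by
    intro w hwi hw0
    rw [Measure.map_map (hF.iterate k) hF, ← Function.iterate_succ,
      Measure.map_apply (hF.iterate (k + 1)) hB, hmass w hwi hw0 _ hS]
  have eB := congrArg (fun m : Measure Λ => (m B).toReal) e
  have b : ∀ κ : Measure Λ,
      κ ≤ (ENNReal.ofReal (Real.exp (2 * (coneConst β η C₁ *
        Metric.diam (Set.univ : Set Λ) ^ η))) * ENNReal.ofReal M) • μY →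
      κ B ≠ ⊤ ∧ (κ B).toReal ≤
        distConst (Metric.diam (Set.univ : Set Λ)) β η C₁ * M * μY.real B := by
    intro κ hκ
    have h1 := hκ B
    rw [Measure.smul_apply, smul_eq_mul] at h1
    have hfin : ENNReal.ofReal (Real.exp (2 * (coneConst β η C₁ *
        Metric.diam (Set.univ : Set Λ) ^ η))) * ENNReal.ofReal M * μY B ≠ ⊤ := by finiteness
    refine ⟨ne_top_of_le_ne_top hfin h1, ?_⟩
    have := ENNReal.toReal_mono hfin h1
    rwa [ENNReal.toReal_mul, ENNReal.toReal_mul, ENNReal.toReal_ofReal (Real.exp_pos _).le,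
      ENNReal.toReal_ofReal hM0] at this
  obtain ⟨f₁, b₁⟩ := b κ₁ d₁
  obtain ⟨f₂, b₂⟩ := b κ₂ d₂
  simp only [Measure.add_apply, Measure.smul_apply, smul_eq_mul] at eB
  rw [hle w₁ hw₁i hw₁0, hle w₂ hw₂i hw₂0, ENNReal.toReal_add (by finiteness) (by finiteness),
    ENNReal.toReal_add (by finiteness) (by finiteness),
    ENNReal.toReal_ofReal (integral_nonneg_of_ae (ae_restrict_of_ae hw₁0)),
    ENNReal.toReal_ofReal (integral_nonneg_of_ae (ae_restrict_of_ae hw₂0)),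
    ENNReal.toReal_mul, ENNReal.toReal_mul, ENNReal.toReal_pow, ENNReal.toReal_ofReal hγ0] at eB
  have hsub : ∫ x in S, u x ∂μY = ∫ x in S, w₁ x ∂μY - ∫ x in S, w₂ x ∂μY := by
    rw [← integral_sub hw₁i.integrableOn hw₂i.integrableOn]
    simp [hw₁, hw₂]
  rw [hsub, mul_assoc]
  exact abs_sub_le_of_add_eq eB (by positivity) (by positivity) (by gcongr) (by gcongr)

end Decay

/-! ### The transfer operator. -/

section Transfer

variable {Λ : Type*} [MeasurableSpace Λ] {ν : Measure Λ} {F : Λ → Λ}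

lemma measurable_transfer (ν : Measure Λ) (F : Λ → Λ) (u : Λ → ℝ) :
    Measurable (transfer ν F u) :=
  (Measure.measurable_rnDeriv _ _).ennreal_toReal.sub
    (Measure.measurable_rnDeriv _ _).ennreal_toReal

/-- The equality is everywhere, not just almost everywhere: `transfer` sees its arguments only
through measures, and equal measures have the same chosen Radon–Nikodym derivative. -/
lemma transfer_congr {F' : Λ → Λ} {u u' : Λ → ℝ} (hF : F =ᵐ[ν] F') (hu : u =ᵐ[ν] u') :
    transfer ν F u = transfer ν F' u' := by
  have key : ∀ w w' : Λ → ENNReal, w =ᵐ[ν] w' →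
      (ν.withDensity w).map F = (ν.withDensity w').map F' := fun w w' hw => by
    rw [withDensity_congr_ae hw]
    exact Measure.map_congr ((withDensity_absolutelyContinuous ν w').ae_eq hF)
  unfold transfer
  rw [key _ (fun x => ENNReal.ofReal (u' x)) (hu.mono fun x hx => by simp only [hx]),
    key _ (fun x => ENNReal.ofReal (-u' x)) (hu.mono fun x hx => by simp only [hx])]

lemma isFiniteMeasure_map_withDensity {u : Λ → ℝ} (hu : Integrable u ν) :
    IsFiniteMeasure ((ν.withDensity fun x => ENNReal.ofReal (u x)).map F) :=
  have : IsFiniteMeasure (ν.withDensity fun x => ENNReal.ofReal (u x)) :=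
    isFiniteMeasure_withDensity_ofReal hu.2
  inferInstance

lemma integrable_transfer {u : Λ → ℝ} (hu : Integrable u ν) :
    Integrable (transfer ν F u) ν := by
  have := isFiniteMeasure_map_withDensity (F := F) hu
  have := isFiniteMeasure_map_withDensity (F := F) hu.neg
  exact Measure.integrable_toReal_rnDeriv.sub Measure.integrable_toReal_rnDeriv

lemma setIntegral_transfer [IsFiniteMeasure ν] (hF : MeasurePreserving F ν ν) {u : Λ → ℝ}
    (hu : Integrable u ν)
    {B : Set Λ} (hB : MeasurableSet B) :
    ∫ y in B, transfer ν F u y ∂ν = ∫ x in F ⁻¹' B, u x ∂ν := by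
  have key : ∀ w : Λ → ℝ, Integrable w ν →
      Integrable
        (fun y => (((ν.withDensity fun x => ENNReal.ofReal (w x)).map F).rnDeriv ν y).toReal) ν ∧
      ∫ y in B, (((ν.withDensity fun x => ENNReal.ofReal (w x)).map F).rnDeriv ν y).toReal ∂ν =
        (∫⁻ x in F ⁻¹' B, ENNReal.ofReal (w x) ∂ν).toReal := by
    intro w hw
    have := isFiniteMeasure_map_withDensity (F := F) hw
    have hac : (ν.withDensity fun x => ENNReal.ofReal (w x)).map F ≪ ν := by
      have := (withDensity_absolutelyContinuous ν fun x => ENNReal.ofReal (w x)).map hF.measurable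
      rwa [hF.map_eq] at this
    refine ⟨Measure.integrable_toReal_rnDeriv, ?_⟩
    rw [Measure.setIntegral_toReal_rnDeriv hac, Measure.real, Measure.map_apply hF.measurable hB,
      withDensity_apply _ (hF.measurable hB)]
  obtain ⟨i₁, e₁⟩ := key u hu
  obtain ⟨i₂, e₂⟩ := key (fun x => -u x) hu.neg
  unfold transfer
  rw [integral_sub i₁.integrableOn i₂.integrableOn, e₁, e₂,
    integral_eq_lintegral_pos_part_sub_lintegral_neg_part hu.integrableOn]

lemma integrable_transfer_iterate {u : Λ → ℝ} (hu : Integrable u ν) (k : ℕ) :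
    Integrable ((transfer ν F)^[k] u) ν := by
  induction k with
  | zero => exact hu
  | succ k ih => rw [Function.iterate_succ']; exact integrable_transfer ih

lemma setIntegral_transfer_iterate [IsFiniteMeasure ν] (hF : MeasurePreserving F ν ν) {u : Λ → ℝ}
    (hu : Integrable u ν) (k : ℕ) {B : Set Λ} (hB : MeasurableSet B) :
    ∫ y in B, (transfer ν F)^[k] u y ∂ν = ∫ x in F^[k] ⁻¹' B, u x ∂ν := by
  induction k generalizing B with
  | zero => rfl
  | succ k ih =>
    rw [Function.iterate_succ', Function.comp_apply,
      setIntegral_transfer hF (integrable_transfer_iterate hu k) hB, ih (hF.measurable hB),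
      Function.iterate_succ', Set.preimage_comp]

end Transfer

/-! ### Hölder observables and induced observables. -/

section Holder

variable {Λ E : Type*} [MetricSpace Λ] [NormedAddCommGroup E] {η : ℝ} {v : Λ → E}

lemma norm_sub_le_of_memHolder (hη : 0 < η) (hv : MemHolder η.toNNReal v) (x y : Λ) :
    ‖v x - v y‖ ≤ nnHolderNorm η.toNNReal v * dist x y ^ η := by
  have := hv.holderWith.dist_le x y
  rwa [dist_eq_norm, Real.coe_toNNReal _ hη.le] at this

/-- An unbounded real supremum would default to `0`, so boundedness is what lets `holderNorm`
dominate `v` pointwise. It holds because the space is bounded. -/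
lemma bddAbove_norm_of_memHolder [BoundedSpace Λ] (hη : 0 < η) (hv : MemHolder η.toNNReal v) :
    BddAbove (Set.range fun x => ‖v x‖) := by
  rcases isEmpty_or_nonempty Λ with hΛ | ⟨⟨x₀⟩⟩
  · simp [Set.range_eq_empty]
  · refine ⟨‖v x₀‖ + nnHolderNorm η.toNNReal v * Metric.diam (Set.univ : Set Λ) ^ η, ?_⟩
    rintro _ ⟨x, rfl⟩
    have h1 := norm_sub_le_of_memHolder hη hv x x₀
    have h2 : dist x x₀ ^ η ≤ Metric.diam (Set.univ : Set Λ) ^ η :=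
      Real.rpow_le_rpow dist_nonneg
        (Metric.dist_le_diam_of_mem (Bornology.IsBounded.all _) trivial trivial) hη.le
    have h3 := norm_le_norm_add_norm_sub' (v x) (v x₀)
    have h4 := mul_le_mul_of_nonneg_left h2 (nnHolderNorm η.toNNReal v).coe_nonneg
    show ‖v x‖ ≤ _
    linarith

lemma holderNorm_nonneg : 0 ≤ holderNorm η v :=
  add_nonneg (Real.iSup_nonneg fun _ => norm_nonneg _) NNReal.zero_le_coe

lemma norm_le_holderNorm [BoundedSpace Λ] (hη : 0 < η) (hv : MemHolder η.toNNReal v) (x : Λ) :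
    ‖v x‖ ≤ holderNorm η v :=
  (le_ciSup (bddAbove_norm_of_memHolder hη hv) x).trans (le_add_of_nonneg_right NNReal.zero_le_coe)

lemma norm_sub_le_holderNorm (hη : 0 < η) (hv : MemHolder η.toNNReal v) (x y : Λ) :
    ‖v x - v y‖ ≤ holderNorm η v * dist x y ^ η := by
  refine (norm_sub_le_of_memHolder hη hv x y).trans ?_
  gcongr
  exact le_add_of_nonneg_left (Real.iSup_nonneg fun _ => norm_nonneg _)

lemma continuous_of_memHolder (hη : 0 < η) (hv : MemHolder η.toNNReal v) : Continuous v :=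
  hv.holderWith.continuous (by simpa using hη)

end Holder

section Induced

variable {Λ : Type*} {d : ℕ} {T : Λ → Λ} {τ : Λ → ℕ} {v : Λ → EuclideanSpace ℝ (Fin d)}

lemma measurable_inducedObs [MeasurableSpace Λ] (hT : Measurable T) (hτ : Measurable τ)
    (hv : Measurable v) : Measurable (inducedObs T τ v) := by
  have h : Measurable fun q : ℕ × Λ => ∑ ℓ ∈ Finset.range q.1, v (T^[ℓ] q.2) :=
    measurable_from_prod_countable_right fun n =>
      Finset.measurable_sum (Finset.range n) (f := fun ℓ x => v (T^[ℓ] x))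
        fun ℓ _ => hv.comp (hT.iterate ℓ)
  exact h.comp (hτ.prodMk measurable_id)

lemma norm_inducedObs_le {V : ℝ} (hv : ∀ x, ‖v x‖ ≤ V) (y : Λ) :
    ‖inducedObs T τ v y‖ ≤ V * τ y := by
  refine (norm_sum_le_of_le _ (f := fun ℓ => lift T v (y, ℓ)) fun ℓ _ => hv _).trans ?_
  simp [mul_comm]

/-- Both points of a branch have the same return time, so the sums are compared term by term. Each
term is controlled by the distance of the images under `F`, and `C₁ ^ η ≤ C₁`. -/
lemma norm_inducedObs_sub_le [MetricSpace Λ] [MeasurableSpace Λ] {ρ : Measure Λ} {Y : Set Λ}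
    {α : Set (Set Λ)} {β η C₁ : ℝ} (h : NonuniformlyExpanding ρ T Y α τ β η C₁)
    (hv : MemHolder η.toNNReal v) {a : Set Λ} (ha : a ∈ α) {x y : Λ} (hx : x ∈ a) (hy : y ∈ a) :
    ‖inducedObs T τ v x - inducedObs T τ v y‖ ≤
      holderNorm η v * τ x * (C₁ * dist (inducedMap T τ x) (inducedMap T τ y) ^ η) := by
  have hC := h.one_le_C₁
  unfold inducedObs
  rw [← h.return_const a ha x hx y hy, ← Finset.sum_sub_distrib]
  have hb : ∀ ℓ ∈ Finset.range (τ x), ‖lift T v (x, ℓ) - lift T v (y, ℓ)‖ ≤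
      holderNorm η v * (C₁ * dist (inducedMap T τ x) (inducedMap T τ y) ^ η) := by
    intro ℓ hℓ
    refine (norm_sub_le_holderNorm h.η_pos hv _ _).trans ?_
    refine mul_le_mul_of_nonneg_left ?_ holderNorm_nonneg
    calc dist (T^[ℓ] x) (T^[ℓ] y) ^ η
        ≤ (C₁ * dist (inducedMap T τ x) (inducedMap T τ y)) ^ η :=
          Real.rpow_le_rpow dist_nonneg (h.backward a ha x hx y hy ℓ (Finset.mem_range.1 hℓ))
            h.η_pos.le
      _ = C₁ ^ η * dist (inducedMap T τ x) (inducedMap T τ y) ^ η :=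
          Real.mul_rpow (by linarith) dist_nonneg
      _ ≤ C₁ * dist (inducedMap T τ x) (inducedMap T τ y) ^ η := by
          gcongr
          calc C₁ ^ η ≤ C₁ ^ (1 : ℝ) := Real.rpow_le_rpow_of_exponent_le hC h.η_le_one
            _ = C₁ := Real.rpow_one _
  refine (norm_sum_le_of_le _ hb).trans ?_
  simp only [Finset.sum_const, Finset.card_range, nsmul_eq_mul]
  apply le_of_eq
  ring

end Induced

/-- `chiBase` is summed by coordinates. Passing through the vector-valued series bounds its
Euclidean norm without a factor depending on `d`. -/
lemma summable_and_norm_tsum_le {d : ℕ} {f : Fin d → ℕ → ℝ} {b : ℕ → ℝ} {S : ℝ}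
    (hb : HasSum b S)
    (h : ∀ k, ‖(WithLp.toLp 2 fun i => f i k : EuclideanSpace ℝ (Fin d))‖ ≤ b k) :
    (∀ i, Summable (f i)) ∧
      ‖(WithLp.toLp 2 fun i => ∑' k, f i k : EuclideanSpace ℝ (Fin d))‖ ≤ S := by
  have hs : Summable fun k => (WithLp.toLp 2 fun i => f i k : EuclideanSpace ℝ (Fin d)) :=
    Summable.of_norm_bounded hb.summable h
  have hsi : ∀ i, HasSum (f i)
      ((∑' k, (WithLp.toLp 2 fun i => f i k : EuclideanSpace ℝ (Fin d))) i) := fun i =>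
    (EuclideanSpace.proj i : EuclideanSpace ℝ (Fin d) →L[ℝ] ℝ).hasSum hs.hasSum
  refine ⟨fun i => (hsi i).summable, ?_⟩
  have e : (WithLp.toLp 2 fun i => ∑' k, f i k : EuclideanSpace ℝ (Fin d)) =
      ∑' k, (WithLp.toLp 2 fun i => f i k : EuclideanSpace ℝ (Fin d)) := by
    ext i
    exact (hsi i).tsum_eq
  rw [e]
  exact tsum_of_norm_bounded hb h

lemma measurable_chiBase {Λ : Type*} [MeasurableSpace Λ] {d : ℕ} (T : Λ → Λ) (τ : Λ → ℕ)
    (μY : Measure Λ)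
    (v : Λ → EuclideanSpace ℝ (Fin d)) : Measurable (chiBase T τ μY v) := by
  have : Measurable fun y => fun i : Fin d => ∑' k : ℕ, transferIter T τ μY v i (k + 1) y := by
    refine measurable_pi_lambda _ fun i => Measurable.tsum fun k => ?_
    unfold transferIter
    rw [Function.iterate_succ']
    exact measurable_transfer _ _ _
  exact (WithLp.measurable_toLp 2 _).comp this

/-! ### Boundedness of `χ'` and the identity `P m' = 0`. -/

section Chi

variable {Λ : Type*} [MetricSpace Λ] [BoundedSpace Λ] [MeasurableSpace Λ] [BorelSpace Λ]
  {ρ : Measure Λ} [IsFiniteMeasure ρ] {T : Λ → Λ} {Y : Set Λ} {α : Set (Set Λ)}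
  {τ : Λ → ℕ} {β η C₁ : ℝ} {μY : Measure Λ}
  {d : ℕ} {v : Λ → EuclideanSpace ℝ (Fin d)}

lemma integrable_inducedObs (hT : Measurable T) (hτ : Measurable τ)
    (hτi : Integrable (fun x => (τ x : ℝ)) μY) (hη : 0 < η) (hv : MemHolder η.toNNReal v) :
    Integrable (inducedObs T τ v) μY :=
  (hτi.const_mul (holderNorm η v)).mono'
    (measurable_inducedObs hT hτ (continuous_of_memHolder hη hv).measurable).aestronglyMeasurable
    (ae_of_all _ fun x => norm_inducedObs_le (norm_le_holderNorm hη hv) x)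

lemma integrable_inducedObs_apply (hT : Measurable T) (hτ : Measurable τ)
    (hτi : Integrable (fun x => (τ x : ℝ)) μY) (hη : 0 < η) (hv : MemHolder η.toNNReal v)
    (i : Fin d) : Integrable (fun x => inducedObs T τ v x i) μY :=
  ((EuclideanSpace.proj i : EuclideanSpace ℝ (Fin d) →L[ℝ] ℝ).integrable_comp
    (integrable_inducedObs hT hτ hτi hη hv))

variable [IsProbabilityMeasure μY]

/-- The bound for `P φ'` per unit of Hölder norm, given a bound `t` for the mean return time. -/
noncomputable def decayConst (D β η C₁ t : ℝ) : ℝ := distConst D β η C₁ * (2 * t)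

/-- Exponential decay of `P^{k+1} φ'` in the supremum norm. -/
theorem ae_norm_transferIter_le (h : NonuniformlyExpanding ρ T Y α τ β η C₁)
    (hτ : Measurable τ) (hac : μY ≪ ρ.restrict Y) (hinv : μY.map (inducedMap T τ) = μY)
    (hτi : Integrable (fun x => (τ x : ℝ)) μY) (hv : MemHolder η.toNNReal v)
    (h0 : ∫ x, inducedObs T τ v x ∂μY = 0) (k : ℕ) :
    ∀ᵐ y ∂μY, ‖(WithLp.toLp 2 fun i => transferIter T τ μY v i (k + 1) y :
        EuclideanSpace ℝ (Fin d))‖ ≤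
      (1 - gap (Metric.diam (Set.univ : Set Λ)) β η C₁) ^ k *
        (holderNorm η v *
          decayConst (Metric.diam (Set.univ : Set Λ)) β η C₁ (∫ x, (τ x : ℝ) ∂μY)) := by
  have hT := h.nonsingular.measurable
  have hF : MeasurePreserving (inducedMap T τ) μY μY := ⟨h.measurable_F hτ, hinv⟩
  have hφi := integrable_inducedObs hT hτ hτi h.η_pos hv
  have hφm := measurable_inducedObs hT hτ (continuous_of_memHolder h.η_pos hv).measurable
  have hφii := integrable_inducedObs_apply (μY := μY) hT hτ hτi h.η_pos hv
  set c := (1 - gap (Metric.diam (Set.univ : Set Λ)) β η C₁) ^ k *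
        (holderNorm η v *
          decayConst (Metric.diam (Set.univ : Set Λ)) β η C₁ (∫ x, (τ x : ℝ) ∂μY)) with hc
  set X : Λ → EuclideanSpace ℝ (Fin d) := fun y =>
    WithLp.toLp 2 fun i => transferIter T τ μY v i (k + 1) y with hX
  have hXi : ∀ i, Integrable (fun y => transferIter T τ μY v i (k + 1) y) μY := fun i =>
    integrable_transfer_iterate (hφii i) (k + 1)
  have hinner : ∀ e x : EuclideanSpace ℝ (Fin d), inner ℝ e x = ∑ i, e i * x i := by
    intro e x
    simp [PiLp.inner_apply, mul_comm]
  -- For a fixed vector `e`, the scalar function `⟨e, φ'⟩` meets the decay theorem with `V = ‖e‖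
  -- ‖v‖_η`. A bound on integrals over all sets, proportional to the measure of the set, is an
  -- almost sure bound.
  have key : ∀ e : EuclideanSpace ℝ (Fin d), ∀ᵐ y ∂μY, inner ℝ e (X y) ≤ c * ‖e‖ := by
    intro e
    refine ae_le_of_forall_setIntegral_le ?_ (integrable_const _) fun B hB _ => ?_
    · simp only [hinner]
      exact integrable_finsetSum _ fun i _ => (hXi i).const_mul _
    have e1 : ∫ y in B, inner ℝ e (X y) ∂μY =
        ∫ x in (inducedMap T τ)^[k + 1] ⁻¹' B, inner ℝ e (inducedObs T τ v x) ∂μY := by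
      simp only [hinner]
      rw [integral_finsetSum _ fun i _ => ((hXi i).const_mul _).integrableOn,
        integral_finsetSum _ fun i _ => ((hφii i).const_mul _).integrableOn]
      refine Finset.sum_congr rfl fun i _ => ?_
      rw [integral_const_mul, integral_const_mul]
      congr 1
      exact setIntegral_transfer_iterate hF (hφii i) (k + 1) hB
    rw [e1, setIntegral_const]
    have := abs_setIntegral_preimage_iterate_le h hτ hac hinv hτi
      (V := ‖e‖ * holderNorm η v) (mul_nonneg (norm_nonneg _) holderNorm_nonneg)
      (u := fun x => inner ℝ e (inducedObs T τ v x)) (by fun_prop)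
      (fun x _ => ?_) (fun a ha x hx y hy => ?_) ?_ k hB
    · refine (le_abs_self _).trans (this.trans (le_of_eq ?_))
      simp only [hc, decayConst, smul_eq_mul]
      ring
    · refine (abs_real_inner_le_norm _ _).trans ?_
      rw [mul_assoc]
      gcongr
      exact norm_inducedObs_le (norm_le_holderNorm h.η_pos hv) x
    · rw [← inner_sub_right]
      refine (abs_real_inner_le_norm _ _).trans ?_
      rw [mul_assoc, mul_assoc, ← mul_assoc (holderNorm η v)]
      gcongr
      exact norm_inducedObs_sub_le h hv ha hx hy
    · rw [integral_inner hφi, h0, inner_zero_right]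
  -- The exceptional null set depends on `e`. Countably many dense vectors share one, and the
  -- inequality is closed in `e`.
  have hdense : ∀ᵐ y ∂μY, ∀ n, inner ℝ (TopologicalSpace.denseSeq _ n) (X y) ≤
      c * ‖TopologicalSpace.denseSeq (EuclideanSpace ℝ (Fin d)) n‖ :=
    ae_all_iff.2 fun n => key _
  have hc0 : 0 ≤ c := by
    have h1 := gap_lt_one (D := Metric.diam (Set.univ : Set Λ)) Metric.diam_nonneg h.one_lt_β
      h.η_pos h.one_le_C₁
    have h2 : 0 ≤ ∫ x, (τ x : ℝ) ∂μY := integral_nonneg fun _ => Nat.cast_nonneg _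
    have h3 : (0 : ℝ) ≤ holderNorm η v := holderNorm_nonneg
    have h4 : 0 ≤ distConst (Metric.diam (Set.univ : Set Λ)) β η C₁ := (Real.exp_pos _).le
    have : 0 ≤ 1 - gap (Metric.diam (Set.univ : Set Λ)) β η C₁ := by linarith
    simp only [hc, decayConst]
    positivity
  filter_upwards [hdense] with y hy
  have hall : ∀ e : EuclideanSpace ℝ (Fin d), inner ℝ e (X y) ≤ c * ‖e‖ := by
    have hcl : IsClosed {e : EuclideanSpace ℝ (Fin d) | inner ℝ e (X y) ≤ c * ‖e‖} :=
      isClosed_le (by fun_prop) (by fun_prop)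
    have hd := TopologicalSpace.denseRange_denseSeq (EuclideanSpace ℝ (Fin d))
    intro e
    have := hcl.closure_subset_iff.2 (Set.range_subset_iff.2 hy)
    rw [hd.closure_range] at this
    exact this (Set.mem_univ e)
  -- Testing `X y` against itself recovers its norm.
  have h1 := hall (X y)
  rw [real_inner_self_eq_norm_sq] at h1
  by_contra hlt
  push Not at hlt
  have : 0 < ‖X y‖ := lt_of_le_of_lt hc0 hlt
  nlinarith

/-- The bound for `χ'` per unit of Hölder norm. -/
noncomputable def chiConst (D β η C₁ t : ℝ) : ℝ := decayConst D β η C₁ t / gap D β η C₁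

/-- The series for `χ'` converges and `χ'` is bounded. -/
theorem ae_summable_and_norm_chiBase_le (h : NonuniformlyExpanding ρ T Y α τ β η C₁)
    (hτ : Measurable τ) (hac : μY ≪ ρ.restrict Y) (hinv : μY.map (inducedMap T τ) = μY)
    (hτi : Integrable (fun x => (τ x : ℝ)) μY) (hv : MemHolder η.toNNReal v)
    (h0 : ∫ x, inducedObs T τ v x ∂μY = 0) :
    ∀ᵐ y ∂μY, (∀ i, Summable fun k : ℕ => transferIter T τ μY v i (k + 1) y) ∧
      ‖chiBase T τ μY v y‖ ≤ holderNorm η v *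
        chiConst (Metric.diam (Set.univ : Set Λ)) β η C₁ (∫ x, (τ x : ℝ) ∂μY) := by
  have h1 := gap_lt_one (D := Metric.diam (Set.univ : Set Λ)) Metric.diam_nonneg h.one_lt_β
      h.η_pos h.one_le_C₁
  have h2 := gap_pos (D := Metric.diam (Set.univ : Set Λ)) (C₁ := C₁) h.one_lt_β h.η_pos
  filter_upwards [ae_all_iff.2 fun k => ae_norm_transferIter_le h hτ hac hinv hτi hv h0 k]
    with y hy
  have hgeo := (hasSum_geometric_of_lt_one (r := 1 - gap (Metric.diam (Set.univ : Set Λ)) β η C₁)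
    (by linarith) (by linarith)).mul_right (holderNorm η v *
          decayConst (Metric.diam (Set.univ : Set Λ)) β η C₁ (∫ x, (τ x : ℝ) ∂μY))
  have := summable_and_norm_tsum_le hgeo hy
  refine ⟨this.1, this.2.trans (le_of_eq ?_)⟩
  rw [sub_sub_cancel]
  unfold chiConst
  field_simp

lemma ae_abs_transferIter_le (h : NonuniformlyExpanding ρ T Y α τ β η C₁)
    (hτ : Measurable τ) (hac : μY ≪ ρ.restrict Y) (hinv : μY.map (inducedMap T τ) = μY)
    (hτi : Integrable (fun x => (τ x : ℝ)) μY) (hv : MemHolder η.toNNReal v)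
    (h0 : ∫ x, inducedObs T τ v x ∂μY = 0) (k : ℕ) (i : Fin d) :
    ∀ᵐ y ∂μY, ‖transferIter T τ μY v i (k + 1) y‖ ≤
      (1 - gap (Metric.diam (Set.univ : Set Λ)) β η C₁) ^ k *
        (holderNorm η v *
          decayConst (Metric.diam (Set.univ : Set Λ)) β η C₁ (∫ x, (τ x : ℝ) ∂μY)) := by
  filter_upwards [ae_norm_transferIter_le h hτ hac hinv hτi hv h0 k] with y hy
  exact (PiLp.norm_apply_le (WithLp.toLp 2 fun i => transferIter T τ μY v i (k + 1) y :
        EuclideanSpace ℝ (Fin d)) i).trans hy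

/-- Integrals of `P^k φ'` over `B` are integrals of `φ'` over preimages of `B`. This form lets `P m'
= 0` follow by shifting a series, without applying `P` to an infinite sum. -/
lemma hasSum_setIntegral_chiBase (h : NonuniformlyExpanding ρ T Y α τ β η C₁)
    (hτ : Measurable τ) (hac : μY ≪ ρ.restrict Y) (hinv : μY.map (inducedMap T τ) = μY)
    (hτi : Integrable (fun x => (τ x : ℝ)) μY) (hv : MemHolder η.toNNReal v)
    (h0 : ∫ x, inducedObs T τ v x ∂μY = 0) (i : Fin d) {B : Set Λ} (hB : MeasurableSet B) :
    HasSum (fun k : ℕ => ∫ x in (inducedMap T τ)^[k + 1] ⁻¹' B, inducedObs T τ v x i ∂μY)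
      (∫ y in B, chiBase T τ μY v y i ∂μY) := by
  have h1 := gap_lt_one (D := Metric.diam (Set.univ : Set Λ)) Metric.diam_nonneg h.one_lt_β
      h.η_pos h.one_le_C₁
  have h2 := gap_pos (D := Metric.diam (Set.univ : Set Λ)) (C₁ := C₁) h.one_lt_β h.η_pos
  have hF : MeasurePreserving (inducedMap T τ) μY μY := ⟨h.measurable_F hτ, hinv⟩
  have hφii := integrable_inducedObs_apply (μY := μY) h.nonsingular.measurable hτ hτi h.η_pos hv i
  have hgeo := (hasSum_geometric_of_lt_one (r := 1 - gap (Metric.diam (Set.univ : Set Λ)) β η C₁)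
    (by linarith) (by linarith)).mul_right (holderNorm η v *
          decayConst (Metric.diam (Set.univ : Set Λ)) β η C₁ (∫ x, (τ x : ℝ) ∂μY))
  have hi : ∀ k, Integrable (fun y => transferIter T τ μY v i (k + 1) y) (μY.restrict B) := fun k =>
    (integrable_transfer_iterate hφii (k + 1)).integrableOn
  have hb := fun k => ae_abs_transferIter_le h hτ hac hinv hτi hv h0 k i
  have := hasSum_integral_of_summable_integral_norm hi (by
    refine Summable.of_nonneg_of_le (fun k => integral_nonneg fun _ => norm_nonneg _)
      (fun k => ?_) (hgeo.summable.mul_right (μY.real B))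
    refine (integral_mono_ae (hi k).norm (integrable_const _)
      (ae_restrict_of_ae (hb k))).trans (le_of_eq ?_)
    rw [setIntegral_const, smul_eq_mul, mul_comm])
  have e : (fun k : ℕ => ∫ x in (inducedMap T τ)^[k + 1] ⁻¹' B, inducedObs T τ v x i ∂μY) =
      fun k : ℕ => ∫ y in B, transferIter T τ μY v i (k + 1) y ∂μY :=
    funext fun k => (setIntegral_transfer_iterate hF hφii (k + 1) hB).symm
  rw [e]
  exact this

/-- `P m' = 0`, in integrated form. -/
theorem setIntegral_preimage_mBase (h : NonuniformlyExpanding ρ T Y α τ β η C₁)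
    (hτ : Measurable τ) (hac : μY ≪ ρ.restrict Y) (hinv : μY.map (inducedMap T τ) = μY)
    (hτi : Integrable (fun x => (τ x : ℝ)) μY) (hv : MemHolder η.toNNReal v)
    (h0 : ∫ x, inducedObs T τ v x ∂μY = 0) (i : Fin d) {B : Set Λ} (hB : MeasurableSet B) :
    ∫ x in inducedMap T τ ⁻¹' B, mBase T τ μY v x i ∂μY = 0 := by
  have hF : MeasurePreserving (inducedMap T τ) μY μY := ⟨h.measurable_F hτ, hinv⟩
  have hφii := integrable_inducedObs_apply (μY := μY) h.nonsingular.measurable hτ hτi h.η_pos hv i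
  have hχm : Measurable fun y => chiBase T τ μY v y i :=
    (EuclideanSpace.proj i : EuclideanSpace ℝ (Fin d) →L[ℝ] ℝ).measurable.comp
      (measurable_chiBase T τ μY v)
  have hχi : Integrable (fun y => chiBase T τ μY v y i) μY := by
    refine (integrable_const (holderNorm η v *
        chiConst (Metric.diam (Set.univ : Set Λ)) β η C₁ (∫ x, (τ x : ℝ) ∂μY))).mono'
        hχm.aestronglyMeasurable ?_
    filter_upwards [ae_summable_and_norm_chiBase_le h hτ hac hinv hτi hv h0] with y hy
    exact (PiLp.norm_apply_le _ i).trans hy.2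
  have hs1 := hasSum_setIntegral_chiBase h hτ hac hinv hτi hv h0 i hB
  have hs2 := hasSum_setIntegral_chiBase h hτ hac hinv hτi hv h0 i (hF.measurable hB)
  have hpre : ∀ k : ℕ, (inducedMap T τ)^[k + 1] ⁻¹' (inducedMap T τ ⁻¹' B) =
      (inducedMap T τ)^[k + 1 + 1] ⁻¹' B := fun k => by
    rw [Function.iterate_succ' _ (k + 1), Set.preimage_comp]
  simp only [hpre] at hs2
  -- Replacing `B` by its preimage drops the first term of the series, so the integral of `χ'` over
  -- the preimage is that over `B` minus the integral of `φ'` over the preimage.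
  have e1 := hs2.unique ((hasSum_nat_add_iff' 1).2 hs1)
  simp only [Finset.sum_range_one, zero_add, Function.iterate_one] at e1
  have e2 : ∫ x in inducedMap T τ ⁻¹' B, chiBase T τ μY v (inducedMap T τ x) i ∂μY =
      ∫ y in B, chiBase T τ μY v y i ∂μY := by
    have aux : ∀ g : Λ → ℝ, Measurable g →
        ∫ x in inducedMap T τ ⁻¹' B, g (inducedMap T τ x) ∂μY = ∫ y in B, g y ∂μY := by
      intro g hg
      conv_rhs => rw [← hF.map_eq]
      rw [setIntegral_map hB hg.aestronglyMeasurable hF.measurable.aemeasurable]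
    exact aux _ hχm
  have i1 : Integrable (fun x => chiBase T τ μY v (inducedMap T τ x) i) μY :=
    hF.integrable_comp_of_integrable hχi
  have e3 : ∀ x, mBase T τ μY v x i = inducedObs T τ v x i -
      chiBase T τ μY v (inducedMap T τ x) i + chiBase T τ μY v x i := fun x => rfl
  simp only [e3]
  have i2 : Integrable (fun x => inducedObs T τ v x i - chiBase T τ μY v (inducedMap T τ x) i)
      μY := hφii.sub i1
  rw [integral_add i2.integrableOn hχi.integrableOn,
    integral_sub hφii.integrableOn i1.integrableOn, e1, e2]
  ring

end Chi

/-! ### The tower, its map and its invariant measure. -/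

/-- The tower map, `(y, ℓ) ↦ (y, ℓ + 1)` below the top level and `(y, τ(y) - 1) ↦ (F y, 0)`. -/
noncomputable def towerMap {Λ : Type*} (T : Λ → Λ) (τ : Λ → ℕ) (q : Λ × ℕ) : Λ × ℕ :=
  if q.2 + 1 < τ q.1 then (q.1, q.2 + 1) else (inducedMap T τ q.1, 0)

section TowerMap

variable {Λ : Type*} {T : Λ → Λ} {τ : Λ → ℕ}

lemma towerMap_mem (hτ1 : ∀ x, 1 ≤ τ x) (q : Λ × ℕ) :
    (towerMap T τ q).2 < τ (towerMap T τ q).1 := by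
  unfold towerMap
  split_ifs with h
  · exact h
  · exact hτ1 _

lemma towerMap_iterate_mem (hτ1 : ∀ x, 1 ≤ τ x) {q : Λ × ℕ} (hq : q.2 < τ q.1) (n : ℕ) :
    ((towerMap T τ)^[n] q).2 < τ ((towerMap T τ)^[n] q).1 := by
  cases n with
  | zero => exact hq
  | succ n => rw [Function.iterate_succ_apply']; exact towerMap_mem hτ1 _

lemma towerProj_towerMap {q : Λ × ℕ} (hq : q.2 < τ q.1) :
    towerProj T (towerMap T τ q) = T (towerProj T q) := by
  unfold towerMap towerProj
  split_ifs with h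
  · exact Function.iterate_succ_apply' _ _ _
  · have : τ q.1 = q.2 + 1 := by omega
    simp only [Function.iterate_zero, id, inducedMap]
    rw [this, Function.iterate_succ_apply']

lemma towerProj_towerMap_iterate (hτ1 : ∀ x, 1 ≤ τ x) {q : Λ × ℕ} (hq : q.2 < τ q.1) (n : ℕ) :
    towerProj T ((towerMap T τ)^[n] q) = T^[n] (towerProj T q) := by
  induction n with
  | zero => rfl
  | succ n ih =>
    rw [Function.iterate_succ_apply', towerProj_towerMap (towerMap_iterate_mem hτ1 hq n), ih,
      Function.iterate_succ_apply']

/-- Either no return happens during the first `n` steps, or the level after `n` steps is less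
than `n`. -/
lemma towerMap_iterate_cases {q : Λ × ℕ} (hq : q.2 < τ q.1) (n : ℕ) :
    (q.2 + n < τ q.1 ∧ (towerMap T τ)^[n] q = (q.1, q.2 + n)) ∨
      (τ q.1 ≤ q.2 + n ∧ ((towerMap T τ)^[n] q).2 < n) := by
  induction n with
  | zero => exact Or.inl ⟨hq, rfl⟩
  | succ n ih =>
    rw [Function.iterate_succ_apply']
    rcases ih with ⟨h1, h2⟩ | ⟨h1, h2⟩
    · rw [h2]
      by_cases h : q.2 + n + 1 < τ q.1
      · left
        exact ⟨by omega, by simp only [towerMap]; rw [if_pos h, add_assoc]⟩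
      · right
        exact ⟨by omega, by simp [towerMap, h]⟩
    · right
      refine ⟨by omega, ?_⟩
      generalize (towerMap T τ)^[n] q = q' at h2
      unfold towerMap
      split_ifs
      · simp only; omega
      · simp

/-- Along a column the tower map moves every level up by one, so the two sums differ only by trading
the bottom value over `y` for that over `F y`. The common part `A` is kept explicit because `E` has
no subtraction. -/
lemma sum_range_towerMap {E : Type*} [AddCommMonoid E] (hτ1 : ∀ x, 1 ≤ τ x) (G : Λ × ℕ → E)
    (y : Λ) : ∃ A : E, ∑ ℓ ∈ Finset.range (τ y), G (towerMap T τ (y, ℓ)) =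
        A + G (inducedMap T τ y, 0) ∧ ∑ ℓ ∈ Finset.range (τ y), G (y, ℓ) = A + G (y, 0) := by
  obtain ⟨k, hk⟩ : ∃ k, τ y = k + 1 := ⟨τ y - 1, by have := hτ1 y; omega⟩
  refine ⟨∑ ℓ ∈ Finset.range k, G (y, ℓ + 1), ?_, ?_⟩
  · rw [hk, Finset.sum_range_succ]
    congr 1
    · refine Finset.sum_congr rfl fun ℓ hℓ => ?_
      have := Finset.mem_range.1 hℓ
      rw [towerMap, if_pos (by simp only; omega)]
    · rw [towerMap, if_neg (by simp only; omega)]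
  · rw [hk, Finset.sum_range_succ']

end TowerMap

section Tower

variable {Λ : Type*} [MeasurableSpace Λ] {T : Λ → Λ} {τ : Λ → ℕ} {μY : Measure Λ}

lemma measurable_returnTime_fst (hτ : Measurable τ) :
    Measurable fun q : Λ × ℕ => (τ q.1, q.2) :=
  (hτ.comp measurable_fst).prodMk measurable_snd

lemma measurableSet_tower (hτ : Measurable τ) : MeasurableSet (tower Set.univ τ) := by
  have : tower Set.univ τ = (fun q : Λ × ℕ => (τ q.1, q.2)) ⁻¹' {r | r.2 < r.1} := by
    ext q
    simp [tower]
  rw [this]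
  exact measurable_returnTime_fst hτ (Set.to_countable _).measurableSet

lemma measurable_towerMap (hT : Measurable T) (hτ : Measurable τ) : Measurable (towerMap T τ) := by
  have hs : MeasurableSet {q : Λ × ℕ | q.2 + 1 < τ q.1} :=
    measurable_returnTime_fst hτ
      (Set.to_countable {r : ℕ × ℕ | r.2 + 1 < r.1}).measurableSet
  unfold towerMap
  refine Measurable.ite hs ?_ ?_
  · exact measurable_fst.prodMk ((measurable_of_countable fun n : ℕ => n + 1).comp measurable_snd)
  · exact ((measurable_inducedMap hT hτ).comp measurable_fst).prodMk measurable_const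

lemma lintegral_towerMeasure [SFinite μY] (hτ : Measurable τ) {G : Λ × ℕ → ENNReal}
    (hG : Measurable G) :
    ∫⁻ q, G q ∂(towerMeasure Set.univ τ μY) =
      (∫⁻ y, (τ y : ENNReal) ∂μY)⁻¹ * ∫⁻ y, ∑ ℓ ∈ Finset.range (τ y), G (y, ℓ) ∂μY := by
  unfold towerMeasure
  rw [lintegral_smul_measure, ← lintegral_indicator (measurableSet_tower hτ),
    lintegral_prod _ (hG.indicator (measurableSet_tower hτ)).aemeasurable, smul_eq_mul]
  congr 2
  ext y
  rw [lintegral_count, tsum_eq_sum (s := Finset.range (τ y))]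
  · refine Finset.sum_congr rfl fun ℓ hℓ => ?_
    rw [Set.indicator_of_mem]
    exact ⟨trivial, Finset.mem_range.1 hℓ⟩
  · intro ℓ hℓ
    rw [Set.indicator_of_notMem]
    rintro ⟨-, h⟩
    exact hℓ (Finset.mem_range.2 h)

lemma ae_tower (hτ : Measurable τ) : ∀ᵐ q ∂(towerMeasure Set.univ τ μY), q.2 < τ q.1 := by
  apply Measure.ae_smul_measure
  filter_upwards [ae_restrict_mem (measurableSet_tower hτ)] with q hq
  exact hq.2

lemma ae_tower_of_ae [SFinite μY] {p : Λ → Prop} (hp : ∀ᵐ y ∂μY, p y) :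
    ∀ᵐ q ∂(towerMeasure Set.univ τ μY), p q.1 := by
  apply Measure.ae_smul_measure
  apply ae_restrict_of_ae
  exact Measure.quasiMeasurePreserving_fst.ae hp

lemma lintegral_return_eq (hτi : Integrable (fun y => (τ y : ℝ)) μY) :
    ∫⁻ y, (τ y : ENNReal) ∂μY = ENNReal.ofReal (∫ y, (τ y : ℝ) ∂μY) := by
  rw [ofReal_integral_eq_lintegral_ofReal hτi (ae_of_all _ fun _ => Nat.cast_nonneg _)]
  simp

lemma lintegral_return_ne_top (hτi : Integrable (fun y => (τ y : ℝ)) μY) :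
    ∫⁻ y, (τ y : ENNReal) ∂μY ≠ ⊤ := by
  rw [lintegral_return_eq hτi]
  exact ENNReal.ofReal_ne_top

lemma measurable_sum_range {E : Type*} [MeasurableSpace E] [AddCommMonoid E] [MeasurableAdd₂ E]
    (hτ : Measurable τ) {G : Λ × ℕ → E} (hG : Measurable G) :
    Measurable fun y => ∑ ℓ ∈ Finset.range (τ y), G (y, ℓ) := by
  have h : Measurable fun q : ℕ × Λ => ∑ ℓ ∈ Finset.range q.1, G (q.2, ℓ) :=
    measurable_from_prod_countable_right fun n =>
      Finset.measurable_sum (Finset.range n) (f := fun ℓ x => G (x, ℓ))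
        fun ℓ _ => hG.comp (measurable_id.prodMk measurable_const)
  exact h.comp (hτ.prodMk measurable_id)

variable [IsProbabilityMeasure μY]

lemma one_le_lintegral_return (hτ1 : ∀ x, 1 ≤ τ x) : 1 ≤ ∫⁻ y, (τ y : ENNReal) ∂μY := by
  calc (1 : ENNReal) = ∫⁻ _, 1 ∂μY := by simp
    _ ≤ _ := lintegral_mono fun y => Nat.one_le_cast.2 (hτ1 y)

lemma isProbabilityMeasure_towerMeasure (hτ : Measurable τ) (hτ1 : ∀ x, 1 ≤ τ x)
    (hτi : Integrable (fun y => (τ y : ℝ)) μY) :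
    IsProbabilityMeasure (towerMeasure Set.univ τ μY) := by
  constructor
  rw [← lintegral_one, lintegral_towerMeasure hτ measurable_const]
  simp only [Finset.sum_const, Finset.card_range, nsmul_eq_mul, mul_one]
  exact ENNReal.inv_mul_cancel (zero_lt_one.trans_le (one_le_lintegral_return hτ1)).ne'
    (lintegral_return_ne_top hτi)

/-- The tower measure is invariant under the tower map. -/
theorem measurePreserving_towerMap (hT : Measurable T) (hτ : Measurable τ) (hτ1 : ∀ x, 1 ≤ τ x)
    (hF : MeasurePreserving (inducedMap T τ) μY μY) :
    MeasurePreserving (towerMap T τ) (towerMeasure Set.univ τ μY) (towerMeasure Set.univ τ μY) := by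
  have hf := measurable_towerMap hT hτ
  refine ⟨hf, Measure.ext_of_lintegral _ fun G hG => ?_⟩
  rw [lintegral_map hG hf, lintegral_towerMeasure hτ hG, lintegral_towerMeasure hτ
    (show Measurable fun q => G (towerMap T τ q) from hG.comp hf)]
  congr 1
  have h0 : Measurable fun y : Λ => G (y, 0) := hG.comp (measurable_id.prodMk measurable_const)
  choose A hA using fun y => sum_range_towerMap (T := T) hτ1 G y
  -- The bottom integral can be cancelled only if it is finite. If it is infinite, so are both
  -- sides, by invariance of `μY` under `F`.
  by_cases hfin : ∫⁻ y, G (y, 0) ∂μY = ⊤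
  · have e1 : ∫⁻ y, G (inducedMap T τ y, 0) ∂μY = ⊤ := by
      rw [hF.lintegral_comp h0, hfin]
    rw [eq_top_iff.2 (e1.ge.trans (lintegral_mono fun y => ?_)),
      eq_top_iff.2 (hfin.ge.trans (lintegral_mono fun y => ?_))]
    · rw [(hA y).2]; exact le_add_self
    · rw [(hA y).1]; exact le_add_self
  · have e1 : ∫⁻ y, ∑ ℓ ∈ Finset.range (τ y), G (towerMap T τ (y, ℓ)) ∂μY + ∫⁻ y, G (y, 0) ∂μY =
        ∫⁻ y, ∑ ℓ ∈ Finset.range (τ y), G (y, ℓ) ∂μY + ∫⁻ y, G (y, 0) ∂μY := by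
      conv_rhs => rw [← hF.lintegral_comp h0]
      rw [← lintegral_add_right _ h0, ← lintegral_add_right _
        (show Measurable fun y => G (inducedMap T τ y, 0) from h0.comp hF.measurable)]
      refine lintegral_congr fun y => ?_
      rw [(hA y).1, (hA y).2, add_right_comm]
    exact (ENNReal.add_left_inj hfin).1 e1

/-- Integrals over the tower are bounded by integrals over the base. -/
lemma integrable_tower_of_le (hτ : Measurable τ) (hτ1 : ∀ x, 1 ≤ τ x) {G : Λ × ℕ → ℝ}
    (hG : Measurable G) (hG0 : ∀ q, 0 ≤ G q) {g : Λ → ℝ} (hg : Integrable g μY)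
    (hle : ∀ᵐ y ∂μY, ∑ ℓ ∈ Finset.range (τ y), G (y, ℓ) ≤ g y) :
    Integrable G (towerMeasure Set.univ τ μY) ∧
      ∫ q, G q ∂(towerMeasure Set.univ τ μY) ≤ ∫ y, g y ∂μY := by
  have hg0 : ∀ᵐ y ∂μY, 0 ≤ g y := by
    filter_upwards [hle] with y hy
    exact (Finset.sum_nonneg fun ℓ _ => hG0 _).trans hy
  have hb : ∫⁻ q, ENNReal.ofReal (G q) ∂(towerMeasure Set.univ τ μY) ≤
      ENNReal.ofReal (∫ y, g y ∂μY) := by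
    rw [lintegral_towerMeasure hτ hG.ennreal_ofReal, ofReal_integral_eq_lintegral_ofReal hg hg0]
    refine (mul_le_of_le_one_left (zero_le)
      (ENNReal.inv_le_one.2 (one_le_lintegral_return hτ1))).trans (lintegral_mono_ae ?_)
    filter_upwards [hle] with y hy
    rw [← ENNReal.ofReal_sum_of_nonneg fun ℓ _ => hG0 _]
    exact ENNReal.ofReal_le_ofReal hy
  have hi : Integrable G (towerMeasure Set.univ τ μY) := by
    refine ⟨hG.aestronglyMeasurable, ?_⟩
    rw [hasFiniteIntegral_iff_ofReal (ae_of_all _ hG0)]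
    exact hb.trans_lt ENNReal.ofReal_lt_top
  refine ⟨hi, ?_⟩
  rw [← ofReal_integral_eq_lintegral_ofReal hi (ae_of_all _ hG0)] at hb
  exact (ENNReal.ofReal_le_ofReal_iff (integral_nonneg_of_ae hg0)).1 hb

/-- Integrals over the base are bounded by integrals over the tower. -/
lemma integrable_base_of_tower (hτ : Measurable τ) (hτ1 : ∀ x, 1 ≤ τ x)
    (hτi : Integrable (fun y => (τ y : ℝ)) μY) {G : Λ × ℕ → ℝ}
    (hG : Measurable G) (hG0 : ∀ q, 0 ≤ G q) (hGi : Integrable G (towerMeasure Set.univ τ μY)) :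
    Integrable (fun y => G (y, 0)) μY ∧
      ∫ y, G (y, 0) ∂μY ≤ (∫ y, (τ y : ℝ) ∂μY) * ∫ q, G q ∂(towerMeasure Set.univ τ μY) := by
  have h0 : Measurable fun y : Λ => G (y, 0) := hG.comp (measurable_id.prodMk measurable_const)
  have hτ0 : 0 ≤ ∫ y, (τ y : ℝ) ∂μY := integral_nonneg fun _ => Nat.cast_nonneg _
  have hb : ∫⁻ y, ENNReal.ofReal (G (y, 0)) ∂μY ≤ ENNReal.ofReal ((∫ y, (τ y : ℝ) ∂μY) *
      ∫ q, G q ∂(towerMeasure Set.univ τ μY)) := by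
    rw [ENNReal.ofReal_mul hτ0, ← lintegral_return_eq hτi,
      ofReal_integral_eq_lintegral_ofReal hGi (ae_of_all _ hG0),
      lintegral_towerMeasure hτ hG.ennreal_ofReal, ← mul_assoc,
      ENNReal.mul_inv_cancel (zero_lt_one.trans_le (one_le_lintegral_return hτ1)).ne'
        (lintegral_return_ne_top hτi), one_mul]
    refine lintegral_mono fun y => ?_
    exact Finset.single_le_sum (f := fun ℓ => ENNReal.ofReal (G (y, ℓ))) (fun _ _ => zero_le)
      (Finset.mem_range.2 (hτ1 y))
  have hi : Integrable (fun y => G (y, 0)) μY := by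
    refine ⟨h0.aestronglyMeasurable, ?_⟩
    rw [hasFiniteIntegral_iff_ofReal (ae_of_all _ fun y => hG0 _)]
    exact hb.trans_lt ENNReal.ofReal_lt_top
  refine ⟨hi, ?_⟩
  rw [← ofReal_integral_eq_lintegral_ofReal hi (ae_of_all _ fun y => hG0 _)] at hb
  exact (ENNReal.ofReal_le_ofReal_iff
    (mul_nonneg hτ0 (integral_nonneg fun q => hG0 q))).1 hb

/-- Bochner integrals over the tower. -/
lemma integral_towerMeasure {E : Type*} [NormedAddCommGroup E] [NormedSpace ℝ E] [CompleteSpace E]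
    (hτ : Measurable τ) (hτ1 : ∀ x, 1 ≤ τ x)
    (hτi : Integrable (fun y => (τ y : ℝ)) μY) {G : Λ × ℕ → E}
    (hG : Integrable G (towerMeasure Set.univ τ μY)) :
    ∫ q, G q ∂(towerMeasure Set.univ τ μY) =
      (∫ y, (τ y : ℝ) ∂μY)⁻¹ • ∫ y, ∑ ℓ ∈ Finset.range (τ y), G (y, ℓ) ∂μY := by
  have hne := lintegral_return_ne_top hτi
  have hτ0 : 0 ≤ ∫ y, (τ y : ℝ) ∂μY := integral_nonneg fun _ => Nat.cast_nonneg _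
  have hGr : Integrable ((tower Set.univ τ).indicator G) (μY.prod Measure.count) := by
    rw [integrable_indicator_iff (measurableSet_tower hτ)]
    exact (integrable_smul_measure (ENNReal.inv_ne_zero.2 hne) (ENNReal.inv_ne_top.2
      (zero_lt_one.trans_le (one_le_lintegral_return hτ1)).ne')).1 hG
  unfold towerMeasure
  rw [integral_smul_measure, ← integral_indicator (measurableSet_tower hτ), integral_prod _ hGr,
    lintegral_return_eq hτi, ENNReal.toReal_inv, ENNReal.toReal_ofReal hτ0]
  congr 2
  ext y
  have e : ∀ ℓ, (tower Set.univ τ).indicator G (y, ℓ) =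
      (↑(Finset.range (τ y)) : Set ℕ).indicator (fun ℓ => G (y, ℓ)) ℓ := by
    intro ℓ
    by_cases h : ℓ < τ y
    · rw [Set.indicator_of_mem, Set.indicator_of_mem]
      · exact Finset.mem_coe.2 (Finset.mem_range.2 h)
      · exact ⟨trivial, h⟩
    · rw [Set.indicator_of_notMem, Set.indicator_of_notMem]
      · exact fun h' => h (Finset.mem_range.1 (Finset.mem_coe.1 h'))
      · exact fun h' => h h'.2
  simp only [e]
  rw [integral_indicator (Finset.measurableSet _), setIntegral_finset _]
  · simp [Measure.real]
  · rw [show (↑(Finset.range (τ y)) : Set ℕ) = ⋃ i ∈ Finset.range (τ y), {i} by ext; simp,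
      integrableOn_finset_iUnion]
    exact fun i _ => integrableOn_singleton (hx := by
      rw [Measure.count_singleton]; exact ENNReal.one_lt_top)

end Tower

/-! ### The matrix norm. -/

section Matrix

variable {d : ℕ}

lemma matNorm_eq (J : Matrix (Fin d) (Fin d) ℝ) :
    matNorm J = ‖(WithLp.toLp 2 fun p : Fin d × Fin d => J p.1 p.2 :
      EuclideanSpace ℝ (Fin d × Fin d))‖ := by
  rw [EuclideanSpace.norm_eq, Fintype.sum_prod_type]
  simp [matNorm]

lemma matNorm_nonneg (J : Matrix (Fin d) (Fin d) ℝ) : 0 ≤ matNorm J := Real.sqrt_nonneg _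

lemma matNorm_add_le (J K : Matrix (Fin d) (Fin d) ℝ) :
    matNorm (J + K) ≤ matNorm J + matNorm K := by
  have e : (WithLp.toLp 2 fun p : Fin d × Fin d => (J + K) p.1 p.2 :
      EuclideanSpace ℝ (Fin d × Fin d)) = WithLp.toLp 2 (fun p : Fin d × Fin d => J p.1 p.2) +
      WithLp.toLp 2 (fun p : Fin d × Fin d => K p.1 p.2) := rfl
  rw [matNorm_eq, e, matNorm_eq, matNorm_eq]
  exact norm_add_le _ _

lemma matNorm_smul (c : ℝ) (J : Matrix (Fin d) (Fin d) ℝ) :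
    matNorm (c • J) = |c| * matNorm J := by
  have e : (WithLp.toLp 2 fun p : Fin d × Fin d => (c • J) p.1 p.2 :
      EuclideanSpace ℝ (Fin d × Fin d)) =
      c • WithLp.toLp 2 (fun p : Fin d × Fin d => J p.1 p.2) := rfl
  rw [matNorm_eq, e, matNorm_eq, norm_smul, Real.norm_eq_abs]

lemma abs_apply_le_matNorm (J : Matrix (Fin d) (Fin d) ℝ) (i j : Fin d) : |J i j| ≤ matNorm J := by
  rw [matNorm_eq]
  exact PiLp.norm_apply_le (WithLp.toLp 2 fun p : Fin d × Fin d => J p.1 p.2 :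
      EuclideanSpace ℝ (Fin d × Fin d)) (i, j)

lemma outer_apply (a b : EuclideanSpace ℝ (Fin d)) (i j : Fin d) : outer a b i j = a i * b j := rfl

lemma matNorm_outer (a b : EuclideanSpace ℝ (Fin d)) : matNorm (outer a b) = ‖a‖ * ‖b‖ := by
  rw [EuclideanSpace.norm_eq, EuclideanSpace.norm_eq, ← Real.sqrt_mul (by positivity), matNorm]
  congr 1
  rw [Finset.sum_mul_sum]
  simp [outer_apply, mul_pow]

lemma sum_sum_mul_le_matNorm (J K : Matrix (Fin d) (Fin d) ℝ) :
    ∑ i, ∑ j, J i j * K i j ≤ matNorm J * matNorm K := by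
  rw [matNorm_eq, matNorm_eq]
  refine le_trans (le_of_eq ?_) (real_inner_le_norm _ _)
  rw [PiLp.inner_apply, Fintype.sum_prod_type]
  simp [mul_comm]

/-- Pair the integral `J` with itself: `|J|²` is the integral of the scalar product of `J` and `A
x`, at most `|J|` times the integral of `g`. No dimensional factor appears, as it would from
entrywise bounds. -/
lemma matNorm_matIntegral_le {Ω : Type*} [MeasurableSpace Ω] {ν : Measure Ω}
    {A : Ω → Matrix (Fin d) (Fin d) ℝ} (hA : ∀ i j, Integrable (fun x => A x i j) ν) {g : Ω → ℝ}
    (hg : Integrable g ν) (hle : ∀ᵐ x ∂ν, matNorm (A x) ≤ g x) :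
    matNorm (matIntegral ν A) ≤ ∫ x, g x ∂ν := by
  obtain ⟨J, hJ⟩ : ∃ J, J = matIntegral ν A := ⟨_, rfl⟩
  have hJij : ∀ i j, ∫ x, A x i j ∂ν = J i j := fun i j => by rw [hJ]; rfl
  rw [← hJ]
  have h1 : matNorm J * matNorm J = ∫ x, ∑ i, ∑ j, J i j * A x i j ∂ν := by
    have e1 : ∫ x, ∑ i, ∑ j, J i j * A x i j ∂ν = ∑ i, ∫ x, ∑ j, J i j * A x i j ∂ν :=
      integral_finsetSum _ fun i _ => integrable_finsetSum _ fun j _ => (hA i j).const_mul _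
    rw [e1, matNorm, Real.mul_self_sqrt (by positivity)]
    refine Finset.sum_congr rfl fun i _ => ?_
    rw [integral_finsetSum _ fun j _ => (hA i j).const_mul _]
    refine Finset.sum_congr rfl fun j _ => ?_
    rw [integral_const_mul, hJij, pow_two]
  have h2 : ∫ x, ∑ i, ∑ j, J i j * A x i j ∂ν ≤ ∫ x, matNorm J * g x ∂ν := by
    refine integral_mono_ae (integrable_finsetSum _ fun i _ => integrable_finsetSum _ fun j _ =>
      (hA i j).const_mul _) (hg.const_mul _) ?_
    filter_upwards [hle] with x hx
    exact (sum_sum_mul_le_matNorm _ _).trans (mul_le_mul_of_nonneg_left hx (matNorm_nonneg _))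
  rw [integral_const_mul, ← h1] at h2
  rcases (matNorm_nonneg J).eq_or_lt with h0 | h0
  · rw [← h0]
    refine integral_nonneg_of_ae ?_
    filter_upwards [hle] with x hx
    exact (matNorm_nonneg _).trans hx
  · exact le_of_mul_le_mul_left h2 h0

lemma tendsto_of_matNorm_sub_le {J : ℕ → Matrix (Fin d) (Fin d) ℝ}
    {K : Matrix (Fin d) (Fin d) ℝ} {b : ℕ → ℝ} (hb : Tendsto b atTop (𝓝 0))
    (h : ∀ n, 1 ≤ n → matNorm (J n - K) ≤ b n) : Tendsto J atTop (𝓝 K) := by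
  refine tendsto_pi_nhds.2 fun i => tendsto_pi_nhds.2 fun j => ?_
  rw [tendsto_iff_dist_tendsto_zero]
  refine squeeze_zero' (Eventually.of_forall fun _ => dist_nonneg) ?_ hb
  filter_upwards [eventually_ge_atTop 1] with n hn
  exact (abs_apply_le_matNorm (J n - K) i j).trans (h n hn)

end Matrix

/-! ### The martingale-coboundary decomposition on the tower. -/

/-- The data on which the analysis on the tower rests: a probability measure preserved by the
induced map, a square integrable return time, a bounded observable `v` by `V`, a bound `K` for
`χ'`, the identity `P m' = 0` and a decoupling estimate with constant `A`. -/
structure InducedSystem {Λ : Type*} [MeasurableSpace Λ] {d : ℕ} (T : Λ → Λ) (τ : Λ → ℕ)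
    (μY : Measure Λ) (v : Λ → EuclideanSpace ℝ (Fin d)) (V K A : ℝ) : Prop where
  measurable_T : Measurable T
  measurable_τ : Measurable τ
  one_le : ∀ x, 1 ≤ τ x
  preserving : MeasurePreserving (inducedMap T τ) μY μY
  memLp_two : MemLp (fun y => (τ y : ℝ)) 2 μY
  measurable_v : Measurable v
  V_nonneg : 0 ≤ V
  K_nonneg : 0 ≤ K
  A_nonneg : 0 ≤ A
  norm_le : ∀ x, ‖v x‖ ≤ V
  chi_le : ∀ᵐ y ∂μY, ‖chiBase T τ μY v y‖ ≤ K
  transfer_mBase : ∀ i B, MeasurableSet B → ∫ x in inducedMap T τ ⁻¹' B, mBase T τ μY v x i ∂μY = 0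
  decouple : ∀ (s : ℕ → ENNReal) (W : Λ → ENNReal), Measurable W →
    ∫⁻ x, s (τ x) * W (inducedMap T τ x) ∂μY ≤
      ENNReal.ofReal A * (∫⁻ x, s (τ x) ∂μY) * ∫⁻ x, W x ∂μY

section Algebra

variable {Λ : Type*} {d : ℕ} {T : Λ → Λ} {τ : Λ → ℕ} {v : Λ → EuclideanSpace ℝ (Fin d)}

lemma lift_iterate_eq (hτ1 : ∀ x, 1 ≤ τ x) {q : Λ × ℕ} (hq : q.2 < τ q.1) (j : ℕ) :
    v (T^[j] (towerProj T q)) = lift T v ((towerMap T τ)^[j] q) := by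
  rw [lift, towerProj_towerMap_iterate hτ1 hq]

lemma norm_birkhoff_le {V : ℝ} (hv : ∀ x, ‖v x‖ ≤ V) (n : ℕ) (x : Λ) :
    ‖birkhoff T v n x‖ ≤ n * V := by
  refine (norm_sum_le_of_le _ fun j _ => hv _).trans ?_
  simp

/-- The Birkhoff sum started at level `ℓ` splits at the first return. -/
lemma norm_birkhoff_tower_le {V : ℝ} (hV : 0 ≤ V) (hv : ∀ x, ‖v x‖ ≤ V) (n : ℕ) {y : Λ} {ℓ : ℕ}
    (hℓ : ℓ < τ y) :
    ‖birkhoff T v n (towerProj T (y, ℓ))‖ ≤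
      V * min (n : ℝ) (τ y : ℝ) + ‖birkhoff T v (n - (τ y - ℓ)) (inducedMap T τ y)‖ := by
  obtain ⟨t, ht⟩ : ∃ t, τ y = ℓ + t := ⟨τ y - ℓ, by omega⟩
  have e : τ y - ℓ = t := by omega
  rw [e]
  rcases le_total n t with h | h
  -- No return occurs within the `n` steps. Truncated subtraction makes the second Birkhoff sum
  -- empty.
  · rw [Nat.sub_eq_zero_of_le h]
    have := norm_birkhoff_le (T := T) hv n (towerProj T (y, ℓ))
    have h2 : n ≤ τ y := by omega
    rw [min_eq_left (by exact_mod_cast h2)]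
    simp only [birkhoff, Finset.range_zero, Finset.sum_empty, norm_zero, add_zero] at *
    linarith
  · obtain ⟨s, rfl⟩ := Nat.exists_eq_add_of_le h
    have e2 : birkhoff T v (t + s) (towerProj T (y, ℓ)) = birkhoff T v t (towerProj T (y, ℓ)) +
        birkhoff T v s (inducedMap T τ y) := by
      unfold birkhoff
      rw [Finset.sum_range_add]
      congr 1
      refine Finset.sum_congr rfl fun j _ => ?_
      simp only [inducedMap, towerProj]
      rw [ht, ← Function.iterate_add_apply, ← Function.iterate_add_apply]
      congr 2
      omega
    rw [e2, Nat.add_sub_cancel_left]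
    refine (norm_add_le _ _).trans ?_
    gcongr
    refine (norm_birkhoff_le hv _ _).trans ?_
    rw [mul_comm]
    gcongr
    rw [le_min_iff]
    constructor
    · exact_mod_cast Nat.le_add_right _ _
    · rw [ht]; exact_mod_cast Nat.le_add_left _ _

/-- The part of the level which is lost if a return happens during the first `n` steps. -/
def lostLevel (τ : Λ → ℕ) (n : ℕ) (q : Λ × ℕ) : ℝ := if q.2 + n < τ q.1 then 0 else q.2

end Algebra

section Decomp

variable {Λ : Type*} [MeasurableSpace Λ] {d : ℕ} {T : Λ → Λ} {τ : Λ → ℕ}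
    {μY : Measure Λ} {v : Λ → EuclideanSpace ℝ (Fin d)}

/-- The martingale-coboundary decomposition `φ = m + χ ∘ f - χ` on the tower. -/
lemma lift_eq_mart_add {q : Λ × ℕ} (hq : q.2 < τ q.1) :
    lift T v q = mart T τ μY v q + chi T τ μY v (towerMap T τ q) - chi T τ μY v q := by
  obtain ⟨y, ℓ⟩ := q
  simp only at hq
  unfold mart towerMap chi
  by_cases h : ℓ + 1 < τ y
  · simp only [h, if_true, if_neg h.ne, Finset.sum_range_succ]
    abel
  · have h' : ℓ + 1 = τ y := by omega
    simp only [h, if_false, if_pos h', Finset.range_zero, Finset.sum_empty, add_zero, mBase,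
      inducedObs]
    rw [← h', Finset.sum_range_succ]
    abel

/-- The sum `∑_{j<n} m ∘ f^j`. -/
noncomputable def martSum (T : Λ → Λ) (τ : Λ → ℕ) (μY : Measure Λ)
    (v : Λ → EuclideanSpace ℝ (Fin d)) (n : ℕ) (q : Λ × ℕ) : EuclideanSpace ℝ (Fin d) :=
  ∑ j ∈ Finset.range n, mart T τ μY v ((towerMap T τ)^[j] q)

/-- The coboundary `χ ∘ f^n - χ`. -/
noncomputable def cobdry (T : Λ → Λ) (τ : Λ → ℕ) (μY : Measure Λ)
    (v : Λ → EuclideanSpace ℝ (Fin d)) (n : ℕ) (q : Λ × ℕ) : EuclideanSpace ℝ (Fin d) :=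
  chi T τ μY v ((towerMap T τ)^[n] q) - chi T τ μY v q

lemma birkhoff_eq_martSum_add (hτ1 : ∀ x, 1 ≤ τ x) {q : Λ × ℕ} (hq : q.2 < τ q.1) (n : ℕ) :
    birkhoff T v n (towerProj T q) = martSum T τ μY v n q + cobdry T τ μY v n q := by
  induction n with
  | zero => simp [birkhoff, martSum, cobdry]
  | succ n ih =>
    unfold birkhoff martSum cobdry at *
    rw [Finset.sum_range_succ, Finset.sum_range_succ, ih, lift_iterate_eq (v := v) hτ1 hq,
      lift_eq_mart_add (μY := μY) (towerMap_iterate_mem hτ1 hq n),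
      ← Function.iterate_succ_apply' (towerMap T τ)]
    abel

lemma norm_chi_le {V K : ℝ} (hv : ∀ x, ‖v x‖ ≤ V) {q : Λ × ℕ}
    (hK : ‖chiBase T τ μY v q.1‖ ≤ K) : ‖chi T τ μY v q‖ ≤ K + V * q.2 := by
  unfold chi
  refine (norm_add_le _ _).trans (add_le_add hK ?_)
  refine (norm_sum_le_of_le _ (f := fun k => lift T v (q.1, k)) fun ℓ _ => hv _).trans ?_
  simp [mul_comm]

/-- Without a return the common part of the two values of `χ` cancels, leaving `n` terms, and the
final level is at least `n`. After a return both values are bounded separately, and the final level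
is below `n`. Cutting off at `n` in this way leads to `psi`, where plain levels would require a
third moment of `τ`. -/
lemma norm_cobdry_le {V K : ℝ} (hK0 : 0 ≤ K) (hv : ∀ x, ‖v x‖ ≤ V) (n : ℕ)
    {q : Λ × ℕ} (hq : q.2 < τ q.1) (hK : ‖chiBase T τ μY v q.1‖ ≤ K)
    (hKn : ‖chiBase T τ μY v ((towerMap T τ)^[n] q).1‖ ≤ K) :
    ‖cobdry T τ μY v n q‖ ≤
      2 * K + V * min (n : ℝ) (((towerMap T τ)^[n] q).2 : ℝ) + V * lostLevel τ n q := by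
  unfold cobdry
  rcases towerMap_iterate_cases (T := T) hq n with ⟨h1, h2⟩ | ⟨h1, h2⟩
  · have e : chi T τ μY v ((towerMap T τ)^[n] q) - chi T τ μY v q =
        ∑ k ∈ Finset.range n, lift T v (q.1, q.2 + k) := by
      rw [h2]
      unfold chi
      rw [Finset.sum_range_add]
      abel
    rw [e, h2, lostLevel, if_pos h1]
    simp only [mul_zero, add_zero]
    rw [min_eq_left (by exact_mod_cast Nat.le_add_left _ _)]
    refine (norm_sum_le_of_le _ (f := fun k => lift T v (q.1, q.2 + k)) fun ℓ _ => hv _).trans ?_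
    simp only [Finset.sum_const, Finset.card_range, nsmul_eq_mul]
    linarith
  · refine (norm_sub_le _ _).trans ?_
    have b1 := norm_chi_le hv hKn
    have b2 := norm_chi_le hv hK
    rw [lostLevel, if_neg (by omega), min_eq_right (by exact_mod_cast h2.le)]
    linarith

end Decomp

lemma integral_comp_of_measurePreserving {Ω : Type*} [MeasurableSpace Ω] {ν : Measure Ω} {f : Ω → Ω}
    (hf : MeasurePreserving f ν ν) {G : Ω → ℝ} (hG : Measurable G) :
    ∫ q, G (f q) ∂ν = ∫ q, G q ∂ν := by
  conv_rhs => rw [← hf.map_eq]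
  rw [integral_map hf.measurable.aemeasurable hG.aestronglyMeasurable]

/-- A function with vanishing transfer is orthogonal to all functions of the form `g ∘ F`. -/
lemma integral_mul_comp_eq_zero {Ω : Type*} [MeasurableSpace Ω] {ν : Measure Ω}
    [IsProbabilityMeasure ν] {F : Ω → Ω} (hF : Measurable F) {f g : Ω → ℝ} (hf : Integrable f ν)
    (hf0 : ∀ B, MeasurableSet B → ∫ x in F ⁻¹' B, f x ∂ν = 0) (hg : Measurable g)
    (hfg : Integrable (fun x => f x * g (F x)) ν) : ∫ x, f x * g (F x) ∂ν = 0 := by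
  have hm : MeasurableSpace.comap F inferInstance ≤ (inferInstance : MeasurableSpace Ω) :=
    hF.comap_le
  -- The hypothesis says that the conditional expectation of `f` on the σ-algebra of preimages under
  -- `F` vanishes; `g ∘ F` is measurable for it and can be pulled out.
  have h1 : (0 : Ω → ℝ) =ᵐ[ν] ν[f | MeasurableSpace.comap F inferInstance] := by
    refine ae_eq_condExp_of_forall_setIntegral_eq hm hf
      (fun s _ _ => (integrable_zero Ω ℝ ν).integrableOn) (fun s hs _ => ?_)
      aestronglyMeasurable_zero
    obtain ⟨B, hB, rfl⟩ := hs
    rw [hf0 B hB]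
    simp
  have h2 := condExp_mul_of_stronglyMeasurable_right
    (m := MeasurableSpace.comap F inferInstance) (μ := ν) (f := f) (g := fun x => g (F x))
    (hg.comp (comap_measurable F)).stronglyMeasurable hfg hf
  have h3 : ∫ x, (f * fun x => g (F x)) x ∂ν = 0 := by
    rw [← integral_condExp hm, integral_congr_ae h2]
    have : (ν[f | MeasurableSpace.comap F inferInstance] * fun x => g (F x)) =ᵐ[ν] 0 := by
      filter_upwards [h1] with x hx
      simp [← hx]
    rw [integral_congr_ae this]
    simp
  exact h3

/-! ### Orthogonality and second moments. -/

section LevelSums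

variable {Λ : Type*} {τ : Λ → ℕ}

/-- Only the top `min(n, τ y)` levels of the column contribute, each at most `τ y` squared. -/
lemma sum_range_lostLevel_le (n : ℕ) (y : Λ) :
    ∑ ℓ ∈ Finset.range (τ y), lostLevel τ n (y, ℓ) ^ 2 ≤ min (n : ℝ) (τ y) * (τ y : ℝ) ^ 2 := by
  calc ∑ ℓ ∈ Finset.range (τ y), lostLevel τ n (y, ℓ) ^ 2
      ≤ ∑ ℓ ∈ Finset.range (τ y), if ℓ ∈ Finset.Ico (τ y - n) (τ y) then (τ y : ℝ) ^ 2 else 0 := by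
        refine Finset.sum_le_sum fun ℓ hℓ => ?_
        have := Finset.mem_range.1 hℓ
        unfold lostLevel
        simp only [Finset.mem_Ico]
        by_cases h : ℓ + n < τ y
        · rw [if_pos h, zero_pow two_ne_zero]
          split_ifs <;> positivity
        · rw [if_neg h, if_pos ⟨by omega, this⟩]
          gcongr
    _ ≤ ∑ ℓ ∈ Finset.Ico (τ y - n) (τ y), (τ y : ℝ) ^ 2 := by
        rw [← Finset.sum_filter]
        refine Finset.sum_le_sum_of_subset_of_nonneg (fun ℓ hℓ => (Finset.mem_filter.1 hℓ).2)
          fun _ _ _ => by positivity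
    _ = _ := by
        rw [Finset.sum_const, Nat.card_Ico, nsmul_eq_mul]
        congr 1
        rw [show τ y - (τ y - n) = min n (τ y) by omega, Nat.cast_min]

lemma sum_range_min_le (n : ℕ) (y : Λ) :
    ∑ ℓ ∈ Finset.range (τ y), min (n : ℝ) (ℓ : ℝ) ^ 2 ≤ min (n : ℝ) (τ y) * (τ y : ℝ) ^ 2 := by
  calc ∑ ℓ ∈ Finset.range (τ y), min (n : ℝ) (ℓ : ℝ) ^ 2
      ≤ ∑ ℓ ∈ Finset.range (τ y), min (n : ℝ) (τ y) * (τ y : ℝ) := by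
        refine Finset.sum_le_sum fun ℓ hℓ => ?_
        have h1 : (ℓ : ℝ) ≤ τ y := by exact_mod_cast (Finset.mem_range.1 hℓ).le
        have h2 : min (n : ℝ) (ℓ : ℝ) ≤ min (n : ℝ) (τ y) := min_le_min_left _ h1
        have h3 : min (n : ℝ) (ℓ : ℝ) ≤ τ y := (min_le_right _ _).trans h1
        have h4 : 0 ≤ min (n : ℝ) (ℓ : ℝ) := by positivity
        rw [pow_two]
        gcongr
    _ = _ := by
        rw [Finset.sum_const, Finset.card_range, nsmul_eq_mul]
        ring

end LevelSums

section Tower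

variable {Λ : Type*} [MeasurableSpace Λ] {d : ℕ} {T : Λ → Λ} {τ : Λ → ℕ}
    {μY : Measure Λ} {v : Λ → EuclideanSpace ℝ (Fin d)}

/-- `m` lives on the top level, from which the tower map returns to the base. Tower integrals
involving `m` and the next state thus become base integrals of `m'` against a function of `F y`. -/
lemma sum_range_mart {M : Type*} [AddCommMonoid M] (hτ1 : ∀ x, 1 ≤ τ x)
    (H : EuclideanSpace ℝ (Fin d) → Λ × ℕ → M) (hH : ∀ q, H 0 q = 0) (y : Λ) :
    ∑ ℓ ∈ Finset.range (τ y), H (mart T τ μY v (y, ℓ)) (towerMap T τ (y, ℓ)) =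
      H (mBase T τ μY v y) (inducedMap T τ y, 0) := by
  have h1 := hτ1 y
  rw [Finset.sum_eq_single (τ y - 1)]
  · simp only [mart, towerMap]
    rw [if_pos (by omega), if_neg (by omega)]
  · intro ℓ _ hne
    simp only [mart]
    rw [if_neg (by omega), hH]
  · intro h
    exact absurd (Finset.mem_range.2 (by omega)) h

lemma measurable_eval (i : Fin d) : Measurable fun x : EuclideanSpace ℝ (Fin d) => x i :=
  (EuclideanSpace.proj i : EuclideanSpace ℝ (Fin d) →L[ℝ] ℝ).measurable

lemma memLp_eval {Ω : Type*} [MeasurableSpace Ω] {ν : Measure Ω}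
    {X : Ω → EuclideanSpace ℝ (Fin d)} (hX : MemLp X 2 ν) (i : Fin d) :
    MemLp (fun q => X q i) 2 ν :=
  (EuclideanSpace.proj i : EuclideanSpace ℝ (Fin d) →L[ℝ] ℝ).comp_memLp' hX

lemma integrable_outer {Ω : Type*} [MeasurableSpace Ω] {ν : Measure Ω}
    {X Z : Ω → EuclideanSpace ℝ (Fin d)} (hX : MemLp X 2 ν) (hZ : MemLp Z 2 ν) (i j : Fin d) :
    Integrable (fun q => X q i * Z q j) ν :=
  (memLp_eval hX i).integrable_mul (memLp_eval hZ j)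

/-- The quantity `∫ min(n, τ) τ² dμ_Y`. -/
noncomputable def psi (τ : Λ → ℕ) (μY : Measure Λ) (n : ℕ) : ℝ :=
  ∫ y, min (n : ℝ) (τ y) * (τ y : ℝ) ^ 2 ∂μY

variable {V K A : ℝ}

namespace InducedSystem

variable (h : InducedSystem T τ μY v V K A)
include h

lemma measurable_mart : Measurable (mart T τ μY v) := by
  have hφ := measurable_inducedObs h.measurable_T h.measurable_τ h.measurable_v
  have hχ := measurable_chiBase T τ μY v
  have hm : Measurable (mBase T τ μY v) :=
    (hφ.sub (hχ.comp h.preserving.measurable)).add hχ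
  have hs : MeasurableSet {q : Λ × ℕ | q.2 + 1 = τ q.1} :=
    measurable_returnTime_fst h.measurable_τ
      (Set.to_countable {r : ℕ × ℕ | r.2 + 1 = r.1}).measurableSet
  exact Measurable.ite hs (hm.comp measurable_fst) measurable_const

lemma measurable_mBase : Measurable (mBase T τ μY v) :=
  ((measurable_inducedObs h.measurable_T h.measurable_τ h.measurable_v).sub
    ((measurable_chiBase T τ μY v).comp h.preserving.measurable)).add (measurable_chiBase T τ μY v)

lemma measurable_chi : Measurable (chi T τ μY v) := by
  have h1 : Measurable fun q : Λ × ℕ => ∑ k ∈ Finset.range q.2, v (T^[k] q.1) :=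
    measurable_from_prod_countable_left fun n =>
      Finset.measurable_sum (Finset.range n) (f := fun k x => v (T^[k] x))
        fun k _ => h.measurable_v.comp (h.measurable_T.iterate k)
  exact ((measurable_chiBase T τ μY v).comp measurable_fst).add h1

lemma measurable_towerProj : Measurable (towerProj T) :=
  measurable_from_prod_countable_left fun n => h.measurable_T.iterate n

lemma measurable_lift : Measurable (lift T v) := h.measurable_v.comp h.measurable_towerProj

lemma measurable_birkhoff (n : ℕ) : Measurable (birkhoff T v n) :=
  Finset.measurable_sum (Finset.range n) (f := fun k x => v (T^[k] x))
    fun k _ => h.measurable_v.comp (h.measurable_T.iterate k)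

lemma measurable_towerMap' : Measurable (towerMap T τ) :=
  measurable_towerMap h.measurable_T h.measurable_τ

lemma measurable_cobdry (n : ℕ) : Measurable (cobdry T τ μY v n) :=
  (h.measurable_chi.comp (h.measurable_towerMap'.iterate n)).sub h.measurable_chi

lemma integrable_return_sq : Integrable (fun y => (τ y : ℝ) ^ 2) μY := h.memLp_two.integrable_sq

lemma measurable_return : Measurable fun y => (τ y : ℝ) :=
  (measurable_of_countable _).comp h.measurable_τ

lemma ae_norm_mBase_le : ∀ᵐ y ∂μY, ‖mBase T τ μY v y‖ ≤ V * τ y + 2 * K := by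
  filter_upwards [h.chi_le, h.preserving.quasiMeasurePreserving.ae h.chi_le] with y h1 h2
  have h3 := norm_inducedObs_le (T := T) (τ := τ) h.norm_le y
  unfold mBase
  calc _ ≤ ‖inducedObs T τ v y‖ + ‖chiBase T τ μY v (inducedMap T τ y)‖ +
        ‖chiBase T τ μY v y‖ := (norm_add_le _ _).trans (add_le_add_left (norm_sub_le _ _) _)
    _ ≤ _ := by linarith

lemma integrable_psi (n : ℕ) : Integrable (fun y => min (n : ℝ) (τ y) * (τ y : ℝ) ^ 2) μY := by
  have hm := h.measurable_return
  refine (h.integrable_return_sq.const_mul (n : ℝ)).mono' (by fun_prop) (ae_of_all _ fun y => ?_)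
  rw [Real.norm_of_nonneg (by positivity)]
  gcongr
  exact min_le_left _ _

variable [IsProbabilityMeasure μY]

lemma integrable_return : Integrable (fun y => (τ y : ℝ)) μY := h.memLp_two.integrable one_le_two

lemma isProb : IsProbabilityMeasure (towerMeasure Set.univ τ μY) :=
  isProbabilityMeasure_towerMeasure h.measurable_τ h.one_le h.integrable_return

lemma preserving_towerMap :
    MeasurePreserving (towerMap T τ) (towerMeasure Set.univ τ μY) (towerMeasure Set.univ τ μY) :=
  measurePreserving_towerMap h.measurable_T h.measurable_τ h.one_le h.preserving

lemma integrable_mBase (i : Fin d) : Integrable (fun y => mBase T τ μY v y i) μY := by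
  refine ((h.integrable_return.const_mul V).add (integrable_const (2 * K))).mono'
    ((measurable_eval i).comp h.measurable_mBase).aestronglyMeasurable ?_
  filter_upwards [h.ae_norm_mBase_le] with y hy
  exact (PiLp.norm_apply_le _ i).trans hy

/-- The reverse martingale property: `m` is orthogonal to functions of the next state. On the base
this is `P m' = 0`. -/
lemma integral_mart_mul_comp {G : Λ × ℕ → ℝ} (hG : Measurable G) (i : Fin d)
    (hi : Integrable (fun q => mart T τ μY v q i * G (towerMap T τ q))
      (towerMeasure Set.univ τ μY)) :
    ∫ q, mart T τ μY v q i * G (towerMap T τ q) ∂(towerMeasure Set.univ τ μY) = 0 := by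
  rw [integral_towerMeasure h.measurable_τ h.one_le h.integrable_return hi]
  simp only [sum_range_mart h.one_le (fun x q => x i * G q) (fun q => by simp)]
  have hG0 : Measurable fun y : Λ => G (y, 0) := hG.comp (measurable_id.prodMk measurable_const)
  -- If the product is not integrable on the base, its Bochner integral is `0` by convention, so
  -- integrability need not be carried down from the tower.
  by_cases hint : Integrable (fun y => mBase T τ μY v y i * G (inducedMap T τ y, 0)) μY
  · rw [integral_mul_comp_eq_zero h.preserving.measurable (h.integrable_mBase i)
      (h.transfer_mBase i) hG0 hint, smul_zero]
  · rw [integral_undef hint, smul_zero]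

lemma integral_mart_iterate_mul_comp {G : Λ × ℕ → ℝ} (hG : Measurable G) (i : Fin d) {a n : ℕ}
    (han : a < n) (hi : Integrable (fun q => mart T τ μY v ((towerMap T τ)^[a] q) i *
      G ((towerMap T τ)^[n] q)) (towerMeasure Set.univ τ μY)) :
    ∫ q, mart T τ μY v ((towerMap T τ)^[a] q) i * G ((towerMap T τ)^[n] q)
      ∂(towerMeasure Set.univ τ μY) = 0 := by
  obtain ⟨k, rfl⟩ : ∃ k, n = k + 1 + a := ⟨n - a - 1, by omega⟩
  have hG' : Measurable fun q => G ((towerMap T τ)^[k] q) :=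
    hG.comp (h.measurable_towerMap'.iterate k)
  have hm : Measurable fun q => mart T τ μY v q i * G ((towerMap T τ)^[k] (towerMap T τ q)) :=
    ((measurable_eval i).comp h.measurable_mart).mul (hG'.comp h.measurable_towerMap')
  have e : (fun q => mart T τ μY v ((towerMap T τ)^[a] q) i * G ((towerMap T τ)^[k + 1 + a] q)) =
      (fun q => mart T τ μY v q i * G ((towerMap T τ)^[k] (towerMap T τ q))) ∘
        (towerMap T τ)^[a] := by
    ext q
    rw [Function.comp_apply, Function.iterate_add_apply _ (k + 1) a, Function.iterate_succ_apply]
  have hp := h.preserving_towerMap.iterate a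
  rw [e] at hi ⊢
  rw [hp.integrable_comp hm.aestronglyMeasurable] at hi
  exact (integral_comp_of_measurePreserving hp hm).trans (h.integral_mart_mul_comp hG' i hi)

lemma mart_sq :
    Integrable (fun q => ‖mart T τ μY v q‖ ^ 2) (towerMeasure Set.univ τ μY) ∧
      ∫ q, ‖mart T τ μY v q‖ ^ 2 ∂(towerMeasure Set.univ τ μY) ≤
        2 * V ^ 2 * ∫ y, (τ y : ℝ) ^ 2 ∂μY + 8 * K ^ 2 := by
  have hi : Integrable (fun y => 2 * V ^ 2 * (τ y : ℝ) ^ 2 + 8 * K ^ 2) μY :=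
    (h.integrable_return_sq.const_mul _).add (integrable_const _)
  have := integrable_tower_of_le h.measurable_τ h.one_le
    (G := fun q => ‖mart T τ μY v q‖ ^ 2) (h.measurable_mart.norm.pow_const 2)
    (fun q => by positivity) hi (by
      filter_upwards [h.ae_norm_mBase_le] with y hy
      rw [sum_range_mart (T := T) h.one_le (fun x _ => ‖x‖ ^ 2) (fun q => by simp)]
      have h0 := norm_nonneg (mBase T τ μY v y)
      nlinarith [sq_nonneg (V * τ y - 2 * K), pow_le_pow_left₀ h0 hy 2])
  refine ⟨this.1, this.2.trans (le_of_eq ?_)⟩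
  rw [integral_add (h.integrable_return_sq.const_mul _) (integrable_const _), integral_const_mul]
  simp

lemma memLp_mart : MemLp (mart T τ μY v) 2 (towerMeasure Set.univ τ μY) :=
  (memLp_two_iff_integrable_sq_norm h.measurable_mart.aestronglyMeasurable).2 h.mart_sq.1

lemma memLp_martSum (n : ℕ) : MemLp (martSum T τ μY v n) 2 (towerMeasure Set.univ τ μY) :=
  memLp_finsetSum (Finset.range n) (f := fun k q => mart T τ μY v ((towerMap T τ)^[k] q))
    fun k _ => h.memLp_mart.comp_measurePreserving (h.preserving_towerMap.iterate k)

lemma cobdry_sq (n : ℕ) :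
    Integrable (fun q => ‖cobdry T τ μY v n q‖ ^ 2) (towerMeasure Set.univ τ μY) ∧
      ∫ q, ‖cobdry T τ μY v n q‖ ^ 2 ∂(towerMeasure Set.univ τ μY) ≤
        12 * K ^ 2 + 6 * V ^ 2 * psi τ μY n := by
  have hprob := h.isProb
  have hf := h.preserving_towerMap.iterate n
  have hsnd : Measurable fun q : Λ × ℕ => (q.2 : ℝ) :=
    (measurable_of_countable _).comp measurable_snd
  have m1 : Measurable fun q : Λ × ℕ => min (n : ℝ) (q.2 : ℝ) ^ 2 := by fun_prop
  have hs : MeasurableSet {q : Λ × ℕ | q.2 + n < τ q.1} :=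
    measurable_returnTime_fst h.measurable_τ
      (Set.to_countable {r : ℕ × ℕ | r.2 + n < r.1}).measurableSet
  have m2 : Measurable fun q : Λ × ℕ => lostLevel τ n q ^ 2 :=
    (Measurable.ite hs measurable_const hsnd).pow_const 2
  obtain ⟨i1, b1⟩ := integrable_tower_of_le (μY := μY) h.measurable_τ h.one_le m1
    (fun q => by positivity) (h.integrable_psi n) (ae_of_all _ fun y => sum_range_min_le n y)
  obtain ⟨i2, b2⟩ := integrable_tower_of_le (μY := μY) h.measurable_τ h.one_le m2
    (fun q => by positivity) (h.integrable_psi n) (ae_of_all _ fun y => sum_range_lostLevel_le n y)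
  have i1' : Integrable (fun q => min (n : ℝ) (((towerMap T τ)^[n] q).2 : ℝ) ^ 2)
      (towerMeasure Set.univ τ μY) := hf.integrable_comp_of_integrable i1
  -- Invariance of the tower measure replaces the level at time `n` by the level at time `0`.
  have e1 := integral_comp_of_measurePreserving hf m1
  have hle : ∀ᵐ q ∂(towerMeasure Set.univ τ μY), ‖cobdry T τ μY v n q‖ ^ 2 ≤
      12 * K ^ 2 + 3 * V ^ 2 * min (n : ℝ) (((towerMap T τ)^[n] q).2 : ℝ) ^ 2 +
        3 * V ^ 2 * lostLevel τ n q ^ 2 := by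
    have hK := ae_tower_of_ae (τ := τ) h.chi_le
    filter_upwards [ae_tower h.measurable_τ, hK, hf.quasiMeasurePreserving.ae hK] with q h1 h2 h3
    have := norm_cobdry_le h.K_nonneg h.norm_le n h1 h2 h3
    set x := V * min (n : ℝ) (((towerMap T τ)^[n] q).2 : ℝ)
    set z := V * lostLevel τ n q
    have h5 := pow_le_pow_left₀ (norm_nonneg _) this 2
    have e : 3 * V ^ 2 * min (n : ℝ) (((towerMap T τ)^[n] q).2 : ℝ) ^ 2 = 3 * x ^ 2 := by
      simp only [x]; ring
    have e' : 3 * V ^ 2 * lostLevel τ n q ^ 2 = 3 * z ^ 2 := by simp only [z]; ring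
    rw [e, e']
    -- The square of a sum of three terms is at most three times the sum of squares; the term `2 K`
    -- gives `12 K²`.
    nlinarith [sq_nonneg (2 * K - x), sq_nonneg (2 * K - z), sq_nonneg (x - z)]
  have iR : Integrable (fun q => 12 * K ^ 2 +
      3 * V ^ 2 * min (n : ℝ) (((towerMap T τ)^[n] q).2 : ℝ) ^ 2)
        (towerMeasure Set.univ τ μY) := (integrable_const _).add (i1'.const_mul _)
  have iR2 : Integrable (fun q => 3 * V ^ 2 * lostLevel τ n q ^ 2)
        (towerMeasure Set.univ τ μY) := i2.const_mul _
  have hint : Integrable (fun q => ‖cobdry T τ μY v n q‖ ^ 2) (towerMeasure Set.univ τ μY) := by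
    refine (iR.add iR2).mono' ((h.measurable_cobdry n).norm.pow_const 2).aestronglyMeasurable ?_
    filter_upwards [hle] with q hq
    rw [Real.norm_of_nonneg (by positivity)]
    exact hq
  refine ⟨hint, ?_⟩
  refine (integral_mono_ae hint (iR.add iR2) hle).trans ?_
  have e2 : ∫ q, (12 * K ^ 2 + 3 * V ^ 2 * min (n : ℝ) (((towerMap T τ)^[n] q).2 : ℝ) ^ 2 +
        3 * V ^ 2 * lostLevel τ n q ^ 2) ∂(towerMeasure Set.univ τ μY) =
      12 * K ^ 2 + 3 * V ^ 2 * ∫ q, min (n : ℝ) (q.2 : ℝ) ^ 2 ∂(towerMeasure Set.univ τ μY) +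
        3 * V ^ 2 * ∫ q, lostLevel τ n q ^ 2 ∂(towerMeasure Set.univ τ μY) := by
    rw [integral_add iR iR2, integral_add (integrable_const _) (i1'.const_mul _)]
    simp only [integral_const_mul, e1]
    simp
  refine e2.le.trans ?_
  have b1' : 3 * V ^ 2 * ∫ q, min (n : ℝ) (q.2 : ℝ) ^ 2 ∂(towerMeasure Set.univ τ μY) ≤
      3 * V ^ 2 * psi τ μY n := by unfold psi; gcongr
  have b2' : 3 * V ^ 2 * ∫ q, lostLevel τ n q ^ 2 ∂(towerMeasure Set.univ τ μY) ≤
      3 * V ^ 2 * psi τ μY n := by unfold psi; gcongr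
  linarith

lemma memLp_cobdry (n : ℕ) : MemLp (cobdry T τ μY v n) 2 (towerMeasure Set.univ τ μY) :=
  (memLp_two_iff_integrable_sq_norm (h.measurable_cobdry n).aestronglyMeasurable).2
    (h.cobdry_sq n).1

end InducedSystem

end Tower

/-! ### The variance of Birkhoff sums. -/

section Tower

variable {Λ : Type*} [MeasurableSpace Λ] {d : ℕ} {T : Λ → Λ} {τ : Λ → ℕ}
    {μY : Measure Λ} {v : Λ → EuclideanSpace ℝ (Fin d)} {V K A : ℝ}

namespace InducedSystem

variable (h : InducedSystem T τ μY v V K A)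
include h

lemma integral_baseMeasure {g : Λ → ℝ} (hg : Measurable g) :
    ∫ x, g x ∂(baseMeasure T Set.univ τ μY) =
      ∫ q, g (towerProj T q) ∂(towerMeasure Set.univ τ μY) := by
  unfold baseMeasure
  rw [integral_map h.measurable_towerProj.aemeasurable hg.aestronglyMeasurable]

lemma ae_birkhoff_eq (n : ℕ) : ∀ᵐ q ∂(towerMeasure Set.univ τ μY),
    birkhoff T v n (towerProj T q) = martSum T τ μY v n q + cobdry T τ μY v n q := by
  filter_upwards [ae_tower h.measurable_τ] with q hq
  exact birkhoff_eq_martSum_add h.one_le hq n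

lemma psi_le (n : ℕ) : psi τ μY n ≤ n * ∫ y, (τ y : ℝ) ^ 2 ∂μY := by
  unfold psi
  rw [← integral_const_mul]
  refine integral_mono (h.integrable_psi n) (h.integrable_return_sq.const_mul _) fun y => ?_
  simp only
  gcongr
  exact min_le_left _ _

variable [IsProbabilityMeasure μY]

lemma integral_martSum_mul_comp {G : Λ × ℕ → ℝ} (hG : Measurable G) (i : Fin d) (n : ℕ)
    (hi : ∀ a, Integrable (fun q => mart T τ μY v ((towerMap T τ)^[a] q) i *
      G ((towerMap T τ)^[n] q)) (towerMeasure Set.univ τ μY)) :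
    ∫ q, martSum T τ μY v n q i * G ((towerMap T τ)^[n] q)
      ∂(towerMeasure Set.univ τ μY) = 0 := by
  have e : ∀ q, martSum T τ μY v n q i * G ((towerMap T τ)^[n] q) =
      ∑ a ∈ Finset.range n, mart T τ μY v ((towerMap T τ)^[a] q) i * G ((towerMap T τ)^[n] q) := by
    intro q
    rw [← Finset.sum_mul, martSum]
    simp
  simp only [e]
  rw [integral_finsetSum _ fun a _ => hi a]
  exact Finset.sum_eq_zero fun a ha =>
    h.integral_mart_iterate_mul_comp hG i (Finset.mem_range.1 ha) (hi a)

lemma memLp_mart_iterate (n : ℕ) : MemLp (fun q => mart T τ μY v ((towerMap T τ)^[n] q)) 2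
    (towerMeasure Set.univ τ μY) :=
  h.memLp_mart.comp_measurePreserving (h.preserving_towerMap.iterate n)

/-- The increment `m ∘ f^n` is a function of `f^n`, hence orthogonal to the preceding sum. The mixed
terms vanish and stationarity makes all diagonal terms equal, so the formula is exact. -/
lemma integral_martSum_mul_martSum (n : ℕ) (i j : Fin d) :
    ∫ q, martSum T τ μY v n q i * martSum T τ μY v n q j ∂(towerMeasure Set.univ τ μY) =
      n * ∫ q, mart T τ μY v q i * mart T τ μY v q j ∂(towerMeasure Set.univ τ μY) := by
  induction n with
  | zero => simp [martSum]
  | succ n ih =>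
    have hM := h.memLp_martSum n
    have hx := h.memLp_mart_iterate n
    have hm : ∀ i, Measurable fun q => mart T τ μY v q i := fun i =>
      (measurable_eval i).comp h.measurable_mart
    have e : ∀ q, martSum T τ μY v (n + 1) q i * martSum T τ μY v (n + 1) q j =
        martSum T τ μY v n q i * martSum T τ μY v n q j +
        martSum T τ μY v n q i * mart T τ μY v ((towerMap T τ)^[n] q) j +
        (martSum T τ μY v n q j * mart T τ μY v ((towerMap T τ)^[n] q) i +
        mart T τ μY v ((towerMap T τ)^[n] q) i * mart T τ μY v ((towerMap T τ)^[n] q) j) := by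
      intro q
      have : martSum T τ μY v (n + 1) q =
          martSum T τ μY v n q + mart T τ μY v ((towerMap T τ)^[n] q) :=
        Finset.sum_range_succ _ _
      rw [this]
      simp only [PiLp.add_apply]
      ring
    simp only [e]
    have i1 := (integrable_outer hM hM i j).add (integrable_outer hM hx i j)
    have i2 := (integrable_outer hM hx j i).add (integrable_outer hx hx i j)
    have z1 := h.integral_martSum_mul_comp (hm j) i n fun a =>
      integrable_outer (h.memLp_mart_iterate a) hx i j
    have z2 := h.integral_martSum_mul_comp (hm i) j n fun a =>
      integrable_outer (h.memLp_mart_iterate a) hx j i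
    have z3 := integral_comp_of_measurePreserving (h.preserving_towerMap.iterate n)
      ((hm i).mul (hm j))
    simp only [Pi.mul_apply] at z3
    have s1 := integral_add i1 i2
    have s2 := integral_add (integrable_outer hM hM i j) (integrable_outer hM hx i j)
    have s3 := integral_add (integrable_outer hM hx j i) (integrable_outer hx hx i j)
    simp only [Pi.add_apply] at s1
    rw [s1, s2, s3, z1, z2, z3, ih]
    push_cast
    ring

lemma integral_norm_martSum_sq (n : ℕ) :
    ∫ q, ‖martSum T τ μY v n q‖ ^ 2 ∂(towerMeasure Set.univ τ μY) =
      n * ∫ q, ‖mart T τ μY v q‖ ^ 2 ∂(towerMeasure Set.univ τ μY) := by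
  have e : ∀ x : EuclideanSpace ℝ (Fin d), ‖x‖ ^ 2 = ∑ i, x i * x i := fun x => by
    rw [EuclideanSpace.real_norm_sq_eq]
    simp only [pow_two]
  simp only [e]
  rw [integral_finsetSum _ fun i _ => integrable_outer (h.memLp_martSum n) (h.memLp_martSum n) i i,
    integral_finsetSum _ fun i _ => integrable_outer h.memLp_mart h.memLp_mart i i, Finset.mul_sum]
  exact Finset.sum_congr rfl fun i _ => h.integral_martSum_mul_martSum n i i

/-- The variance of the Birkhoff sums, up to the coboundary terms. -/
theorem matNorm_variance_sub_le {n : ℕ} (hn : 1 ≤ n) {s : ℝ} (hs : 0 < s) :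
    matNorm ((n : ℝ)⁻¹ • matIntegral (baseMeasure T Set.univ τ μY)
        (fun x => outer (birkhoff T v n x) (birkhoff T v n x)) -
      matIntegral (towerMeasure Set.univ τ μY)
        (fun q => outer (mart T τ μY v q) (mart T τ μY v q))) ≤
      s * (2 * V ^ 2 * ∫ y, (τ y : ℝ) ^ 2 ∂μY + 8 * K ^ 2) +
        (s⁻¹ + 1) * ((12 * K ^ 2 + 6 * V ^ 2 * psi τ μY n) / n) := by
  have hM := h.memLp_martSum n
  have hR := h.memLp_cobdry n
  have hn0 : (0 : ℝ) < n := by exact_mod_cast hn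
  set D : Λ × ℕ → Matrix (Fin d) (Fin d) ℝ := fun q =>
    outer (martSum T τ μY v n q) (cobdry T τ μY v n q) +
    outer (cobdry T τ μY v n q) (martSum T τ μY v n q) +
    outer (cobdry T τ μY v n q) (cobdry T τ μY v n q) with hD
  have hDi : ∀ i j, Integrable (fun q => D q i j) (towerMeasure Set.univ τ μY) := fun i j =>
    ((integrable_outer hM hR i j).add (integrable_outer hR hM i j)).add (integrable_outer hR hR i j)
  have key : (n : ℝ)⁻¹ • matIntegral (baseMeasure T Set.univ τ μY)
        (fun x => outer (birkhoff T v n x) (birkhoff T v n x)) -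
      matIntegral (towerMeasure Set.univ τ μY)
        (fun q => outer (mart T τ μY v q) (mart T τ μY v q)) =
      (n : ℝ)⁻¹ • matIntegral (towerMeasure Set.univ τ μY) D := by
    ext i j
    have e1 : ∫ x, birkhoff T v n x i * birkhoff T v n x j ∂(baseMeasure T Set.univ τ μY) =
        n * ∫ q, mart T τ μY v q i * mart T τ μY v q j ∂(towerMeasure Set.univ τ μY) +
          ∫ q, D q i j ∂(towerMeasure Set.univ τ μY) := by
      have hm : Measurable fun x => birkhoff T v n x i * birkhoff T v n x j :=
        ((measurable_eval i).comp (h.measurable_birkhoff n)).mul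
          ((measurable_eval j).comp (h.measurable_birkhoff n))
      rw [h.integral_baseMeasure hm, ← h.integral_martSum_mul_martSum,
        ← integral_add (integrable_outer hM hM i j) (hDi i j)]
      refine integral_congr_ae ?_
      filter_upwards [h.ae_birkhoff_eq n] with q hq
      simp only [hq, hD, PiLp.add_apply, Matrix.add_apply, outer_apply]
      ring
    simp only [Matrix.sub_apply, Matrix.smul_apply, matIntegral, Matrix.of_apply, outer_apply,
      smul_eq_mul]
    rw [e1]
    field_simp
    ring
  have hg : Integrable (fun q => s * ‖martSum T τ μY v n q‖ ^ 2 +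
      (s⁻¹ + 1) * ‖cobdry T τ μY v n q‖ ^ 2) (towerMeasure Set.univ τ μY) :=
    (((memLp_two_iff_integrable_sq_norm hM.1).1 hM).const_mul s).add ((h.cobdry_sq n).1.const_mul _)
  have hb := matNorm_matIntegral_le hDi hg (ae_of_all _ fun q => by
    refine (matNorm_add_le _ _).trans ((add_le_add_left (matNorm_add_le _ _) _).trans ?_)
    rw [matNorm_outer, matNorm_outer, matNorm_outer]
    set a := ‖martSum T τ μY v n q‖
    set b := ‖cobdry T τ μY v n q‖
    -- Young's inequality `2ab ≤ s a² + b² / s`. The parameter `s` stays free, to be taken of the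
    -- order of the desired rate.
    have : 0 ≤ s⁻¹ * (s * a - b) ^ 2 := by positivity
    have e : s⁻¹ * (s * a - b) ^ 2 = s * a ^ 2 - 2 * (a * b) + s⁻¹ * b ^ 2 := by
      field_simp; ring
    nlinarith)
  rw [integral_add (((memLp_two_iff_integrable_sq_norm hM.1).1 hM).const_mul s)
    ((h.cobdry_sq n).1.const_mul _), integral_const_mul, integral_const_mul,
    h.integral_norm_martSum_sq] at hb
  rw [key, matNorm_smul, abs_of_nonneg (by positivity)]
  calc (n : ℝ)⁻¹ * matNorm (matIntegral (towerMeasure Set.univ τ μY) D)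
      ≤ (n : ℝ)⁻¹ * (s * (n * (2 * V ^ 2 * ∫ y, (τ y : ℝ) ^ 2 ∂μY + 8 * K ^ 2)) +
        (s⁻¹ + 1) * (12 * K ^ 2 + 6 * V ^ 2 * psi τ μY n)) := by
        refine mul_le_mul_of_nonneg_left (hb.trans ?_) (by positivity)
        have := h.mart_sq.2
        have := (h.cobdry_sq n).2
        gcongr
    _ = _ := by field_simp

lemma integral_return_le : ∫ y, (τ y : ℝ) ∂μY ≤ ∫ y, (τ y : ℝ) ^ 2 ∂μY := by
  refine integral_mono h.integrable_return h.integrable_return_sq fun y => ?_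
  have : (1 : ℝ) ≤ τ y := by exact_mod_cast h.one_le y
  simp only
  nlinarith

/-- The second moment of the Birkhoff sums with respect to `μ_Y`. -/
lemma integral_norm_birkhoff_sq_le {n N : ℕ} (hn : 1 ≤ n) (hN : N ≤ n) :
    Integrable (fun y => ‖birkhoff T v N y‖ ^ 2) μY ∧
    ∫ y, ‖birkhoff T v N y‖ ^ 2 ∂μY ≤ n * ((∫ y, (τ y : ℝ) ^ 2 ∂μY) *
      (16 * V ^ 2 * (∫ y, (τ y : ℝ) ^ 2 ∂μY) + 40 * K ^ 2)) := by
  have hM := (memLp_two_iff_integrable_sq_norm (h.memLp_martSum N).1).1 (h.memLp_martSum N)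
  have hR := h.cobdry_sq N
  have hm : Measurable fun q => ‖birkhoff T v N (towerProj T q)‖ ^ 2 :=
    ((h.measurable_birkhoff N).comp h.measurable_towerProj).norm.pow_const 2
  have hi : Integrable (fun q => 2 * ‖martSum T τ μY v N q‖ ^ 2 + 2 * ‖cobdry T τ μY v N q‖ ^ 2)
      (towerMeasure Set.univ τ μY) := (hM.const_mul 2).add (hR.1.const_mul 2)
  have hle : ∀ᵐ q ∂(towerMeasure Set.univ τ μY), ‖birkhoff T v N (towerProj T q)‖ ^ 2 ≤
      2 * ‖martSum T τ μY v N q‖ ^ 2 + 2 * ‖cobdry T τ μY v N q‖ ^ 2 := by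
    filter_upwards [h.ae_birkhoff_eq N] with q hq
    rw [hq]
    have := pow_le_pow_left₀ (norm_nonneg _)
      (norm_add_le (martSum T τ μY v N q) (cobdry T τ μY v N q)) 2
    nlinarith [sq_nonneg (‖martSum T τ μY v N q‖ - ‖cobdry T τ μY v N q‖)]
  have hint : Integrable (fun q => ‖birkhoff T v N (towerProj T q)‖ ^ 2)
      (towerMeasure Set.univ τ μY) := by
    refine hi.mono' hm.aestronglyMeasurable ?_
    filter_upwards [hle] with q hq
    rwa [Real.norm_of_nonneg (by positivity)]
  have hb := integral_mono_ae hint hi hle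
  rw [integral_add (hM.const_mul 2) (hR.1.const_mul 2), integral_const_mul, integral_const_mul,
    h.integral_norm_martSum_sq] at hb
  -- The base is the bottom level of the tower, so passing from the tower to `μY` costs the mean
  -- return time.
  obtain ⟨r1, r2⟩ := integrable_base_of_tower h.measurable_τ h.one_le h.integrable_return hm
    (fun q => by positivity) hint
  refine ⟨r1, r2.trans ?_⟩
  have h1 := h.integral_return_le
  have h2 := h.psi_le N
  have h3 := h.mart_sq.2
  have h4 := hR.2
  set t := ∫ y, (τ y : ℝ) ^ 2 ∂μY
  have ht : 0 ≤ t := integral_nonneg fun y => by positivity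
  have hNn : (N : ℝ) ≤ n := by exact_mod_cast hN
  have hn1 : (1 : ℝ) ≤ n := by exact_mod_cast hn
  calc (∫ y, (τ y : ℝ) ∂μY) * ∫ q, ‖birkhoff T v N (towerProj T q)‖ ^ 2
        ∂(towerMeasure Set.univ τ μY)
      ≤ t * (2 * (n * (2 * V ^ 2 * t + 8 * K ^ 2)) +
          2 * (12 * K ^ 2 * n + 6 * V ^ 2 * (n * t))) := by
        refine mul_le_mul h1 (hb.trans ?_) (integral_nonneg fun q => by positivity) ht
        have h5 : psi τ μY N ≤ n * t := h2.trans (by gcongr)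
        have h6 : 6 * V ^ 2 * psi τ μY N ≤ 6 * V ^ 2 * (n * t) := by gcongr
        have h7 : 12 * K ^ 2 ≤ 12 * K ^ 2 * n := le_mul_of_one_le_right (by positivity) hn1
        have h8 : N * ∫ q, ‖mart T τ μY v q‖ ^ 2 ∂(towerMeasure Set.univ τ μY) ≤
          n * (2 * V ^ 2 * t + 8 * K ^ 2) := by gcongr
        linarith
    _ = _ := by ring

end InducedSystem

end Tower

/-! ### The drift of the iterated sums. -/

section Tower

variable {Λ : Type*} [MeasurableSpace Λ] {d : ℕ} {T : Λ → Λ} {τ : Λ → ℕ}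
    {μY : Measure Λ} {v : Λ → EuclideanSpace ℝ (Fin d)} {V K A : ℝ}

lemma iteratedSum_apply {Λ : Type*} {d : ℕ} (T : Λ → Λ) (v : Λ → EuclideanSpace ℝ (Fin d)) (n : ℕ)
    (x : Λ) (a b : Fin d) :
    iteratedSum T v n x a b = ∑ j ∈ Finset.range n, birkhoff T v j x a * v (T^[j] x) b := by
  unfold iteratedSum birkhoff
  simp only [Matrix.sum_apply, outer_apply, WithLp.ofLp_sum, Finset.sum_apply, Finset.sum_mul]

namespace InducedSystem

variable (h : InducedSystem T τ μY v V K A)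
include h

lemma sum_norm_chi_le {y : Λ} (hy : ‖chiBase T τ μY v y‖ ≤ K) :
    ∑ ℓ ∈ Finset.range (τ y), ‖chi T τ μY v (y, ℓ)‖ ≤ (K + V) * (τ y : ℝ) ^ 2 := by
  have hV := h.V_nonneg
  have hK := h.K_nonneg
  have h2 : (1 : ℝ) ≤ τ y := by exact_mod_cast h.one_le y
  calc ∑ ℓ ∈ Finset.range (τ y), ‖chi T τ μY v (y, ℓ)‖
      ≤ ∑ ℓ ∈ Finset.range (τ y), (K + V) * (τ y : ℝ) := by
        refine Finset.sum_le_sum fun ℓ hℓ => ?_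
        have h1 : (ℓ : ℝ) ≤ τ y := by exact_mod_cast (Finset.mem_range.1 hℓ).le
        have b1 := norm_chi_le h.norm_le (q := (y, ℓ)) hy
        refine b1.trans ?_
        simp only
        rw [add_mul]
        gcongr
        exact le_mul_of_one_le_right hK h2
    _ = _ := by
        rw [Finset.sum_const, Finset.card_range, nsmul_eq_mul]
        ring

lemma integrable_mul_lift {X : Λ × ℕ → ℝ} (hX : Integrable X (towerMeasure Set.univ τ μY))
    (b : Fin d)
    (j : ℕ) : Integrable (fun q => X q * lift T v ((towerMap T τ)^[j] q) b)
      (towerMeasure Set.univ τ μY) := by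
  refine hX.mul_bdd (c := V) ((measurable_eval b).comp
    (h.measurable_lift.comp (h.measurable_towerMap'.iterate j))).aestronglyMeasurable
    (ae_of_all _ fun q => ?_)
  exact (PiLp.norm_apply_le _ b).trans (h.norm_le _)

/-- Each Birkhoff sum is split at the first return. Indexing levels from the top, by `t = τ y - 1 -
ℓ`, makes the number `n - (t + 1)` of steps after the return independent of `τ y`, the form in which
decoupling applies. -/
lemma sum_norm_chi_mul_birkhoff_le (n : ℕ) {y : Λ} (hy : ‖chiBase T τ μY v y‖ ≤ K) :
    ∑ ℓ ∈ Finset.range (τ y), ‖chi T τ μY v (y, ℓ)‖ * ‖birkhoff T v n (towerProj T (y, ℓ))‖ ≤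
      V * (K + V) * (min (n : ℝ) (τ y) * (τ y : ℝ) ^ 2) +
        ∑ t ∈ Finset.range (τ y),
          (K + V * τ y) * ‖birkhoff T v (n - (t + 1)) (inducedMap T τ y)‖ := by
  have hV := h.V_nonneg
  have hK := h.K_nonneg
  have h2 : (1 : ℝ) ≤ τ y := by exact_mod_cast h.one_le y
  rw [← Finset.sum_range_reflect (fun t => (K + V * τ y) *
    ‖birkhoff T v (n - (t + 1)) (inducedMap T τ y)‖)]
  calc _ ≤ ∑ ℓ ∈ Finset.range (τ y), ((K + V * τ y) * (V * min (n : ℝ) (τ y)) +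
        (K + V * τ y) * ‖birkhoff T v (n - (τ y - 1 - ℓ + 1)) (inducedMap T τ y)‖) := by
        refine Finset.sum_le_sum fun ℓ hℓ => ?_
        have hℓ' := Finset.mem_range.1 hℓ
        have b1 := norm_chi_le h.norm_le (q := (y, ℓ)) hy
        have b2 := norm_birkhoff_tower_le (T := T) hV h.norm_le n hℓ'
        rw [show τ y - 1 - ℓ + 1 = τ y - ℓ by omega, ← mul_add]
        refine mul_le_mul (b1.trans ?_) b2 (norm_nonneg _) (by positivity)
        simp only
        gcongr
    _ ≤ _ := by
        rw [Finset.sum_add_distrib]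
        gcongr
        rw [Finset.sum_const, Finset.card_range, nsmul_eq_mul]
        have e : V * (K + V) * (min (n : ℝ) (τ y) * (τ y : ℝ) ^ 2) =
          τ y * ((K * τ y + V * τ y) * (V * min (n : ℝ) (τ y))) := by ring
        rw [e]
        gcongr
        exact le_mul_of_one_le_right hK h2

/-- For fixed `t` the summand is a function of `τ y` times a function of `F y`, so `decouple`
applies term by term. The first factors sum to at most `(K + V) τ²`, and truncated subtraction keeps
all sum lengths at most `n`, so `w` bounds every second factor. -/
lemma decoupled_integrable {n : ℕ} {w : ℝ} (hw0 : 0 ≤ w)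
    (hw : ∀ N ≤ n, ∫⁻ y, ENNReal.ofReal ‖birkhoff T v N y‖ ∂μY ≤ ENNReal.ofReal w) :
    Integrable (fun y => ∑ t ∈ Finset.range (τ y),
          (K + V * τ y) * ‖birkhoff T v (n - (t + 1)) (inducedMap T τ y)‖) μY ∧
      ∫ y, ∑ t ∈ Finset.range (τ y),
          (K + V * τ y) * ‖birkhoff T v (n - (t + 1)) (inducedMap T τ y)‖ ∂μY ≤
        A * ((K + V) * ∫ y, (τ y : ℝ) ^ 2 ∂μY) * w := by
  have hV := h.V_nonneg
  have hK := h.K_nonneg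
  have hA := h.A_nonneg
  have hF := h.preserving.measurable
  have hτm := h.measurable_return
  set g : Λ → ℝ := fun y => ∑ t ∈ Finset.range (τ y),
          (K + V * τ y) * ‖birkhoff T v (n - (t + 1)) (inducedMap T τ y)‖ with hg
  have hg0 : ∀ y, 0 ≤ g y := fun y => Finset.sum_nonneg fun t _ => by positivity
  have hgm : Measurable g := by
    refine measurable_sum_range h.measurable_τ (G := fun q : Λ × ℕ =>
      (K + V * τ q.1) * ‖birkhoff T v (n - (q.2 + 1)) (inducedMap T τ q.1)‖) ?_
    refine measurable_from_prod_countable_left fun t => ?_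
    exact (measurable_const.add (hτm.const_mul V)).mul
      ((h.measurable_birkhoff (n - (t + 1))).comp hF).norm
  set s : ℕ → ℕ → ENNReal := fun t k => if t < k then ENNReal.ofReal (K + V * k) else 0 with hs
  set W : ℕ → Λ → ENNReal := fun t z => ENNReal.ofReal ‖birkhoff T v (n - (t + 1)) z‖ with hW
  have hWm : ∀ t, Measurable (W t) := fun t => (h.measurable_birkhoff _).norm.ennreal_ofReal
  have hsm : ∀ t, Measurable fun y => s t (τ y) := fun t =>
    (measurable_of_countable (s t)).comp h.measurable_τ
  have hsum : ∀ (f : ℕ → ENNReal) (k : ℕ), ∑' t, (if t < k then f t else 0) =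
      ∑ t ∈ Finset.range k, f t := by
    intro f k
    rw [tsum_eq_sum (s := Finset.range k) fun t ht => if_neg fun h' => ht (Finset.mem_range.2 h')]
    exact Finset.sum_congr rfl fun t ht => if_pos (Finset.mem_range.1 ht)
  have e1 : ∀ y, ENNReal.ofReal (g y) = ∑' t, s t (τ y) * W t (inducedMap T τ y) := by
    intro y
    simp only [hs, hW, ite_mul, zero_mul]
    rw [hsum, hg, ENNReal.ofReal_sum_of_nonneg fun t _ => by positivity]
    exact Finset.sum_congr rfl fun t _ => ENNReal.ofReal_mul (by positivity)
  have e2 : ∀ y, ∑' t, s t (τ y) ≤ ENNReal.ofReal ((K + V) * (τ y : ℝ) ^ 2) := by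
    intro y
    simp only [hs]
    rw [hsum, Finset.sum_const, Finset.card_range, nsmul_eq_mul, ← ENNReal.ofReal_natCast,
      ← ENNReal.ofReal_mul (by positivity)]
    apply ENNReal.ofReal_le_ofReal
    have h2 : (1 : ℝ) ≤ τ y := by exact_mod_cast h.one_le y
    rw [show (K + V) * (τ y : ℝ) ^ 2 = τ y * (K * τ y + V * τ y) by ring]
    gcongr
    exact le_mul_of_one_le_right hK h2
  have hi2 : Integrable (fun y => (K + V) * (τ y : ℝ) ^ 2) μY := h.integrable_return_sq.const_mul _
  have hb : ∫⁻ y, ENNReal.ofReal (g y) ∂μY ≤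
      ENNReal.ofReal (A * ((K + V) * ∫ y, (τ y : ℝ) ^ 2 ∂μY) * w) := by
    calc ∫⁻ y, ENNReal.ofReal (g y) ∂μY
        = ∑' t, ∫⁻ y, s t (τ y) * W t (inducedMap T τ y) ∂μY := by
          simp only [e1]
          exact lintegral_tsum fun t => ((hsm t).mul ((hWm t).comp hF)).aemeasurable
      _ ≤ ∑' t, ENNReal.ofReal A * (∫⁻ y, s t (τ y) ∂μY) * ENNReal.ofReal w := by
          refine ENNReal.tsum_le_tsum fun t => (h.decouple (s t) (W t) (hWm t)).trans ?_
          gcongr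
          exact hw _ (Nat.sub_le _ _)
      _ = ENNReal.ofReal A * (∫⁻ y, ∑' t, s t (τ y) ∂μY) * ENNReal.ofReal w := by
          rw [ENNReal.tsum_mul_right, ENNReal.tsum_mul_left,
            lintegral_tsum fun t => (hsm t).aemeasurable]
      _ ≤ ENNReal.ofReal A * (∫⁻ y, ENNReal.ofReal ((K + V) * (τ y : ℝ) ^ 2) ∂μY) *
            ENNReal.ofReal w := by
          gcongr with y
          exact e2 y
      _ = _ := by
          rw [← ofReal_integral_eq_lintegral_ofReal hi2 (ae_of_all _ fun y => by positivity),
            integral_const_mul, ← ENNReal.ofReal_mul hA, ← ENNReal.ofReal_mul (by positivity)]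
  have hgi : Integrable g μY := by
    refine ⟨hgm.aestronglyMeasurable, ?_⟩
    rw [hasFiniteIntegral_iff_ofReal (ae_of_all _ hg0)]
    exact hb.trans_lt ENNReal.ofReal_lt_top
  refine ⟨hgi, ?_⟩
  rw [← ofReal_integral_eq_lintegral_ofReal hgi (ae_of_all _ hg0)] at hb
  exact (ENNReal.ofReal_le_ofReal_iff (by positivity)).1 hb

variable [IsProbabilityMeasure μY]

lemma integrable_chi : Integrable (chi T τ μY v) (towerMeasure Set.univ τ μY) := by
  have hi : Integrable (fun y => (K + V) * (τ y : ℝ) ^ 2) μY := h.integrable_return_sq.const_mul _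
  have hle : ∀ᵐ y ∂μY, ∑ ℓ ∈ Finset.range (τ y), ‖chi T τ μY v (y, ℓ)‖ ≤
      (K + V) * (τ y : ℝ) ^ 2 := by
    filter_upwards [h.chi_le] with y hy
    exact h.sum_norm_chi_le hy
  have hG : Measurable fun q => ‖chi T τ μY v q‖ := h.measurable_chi.norm
  obtain ⟨i3, -⟩ := integrable_tower_of_le h.measurable_τ h.one_le hG
    (fun q => norm_nonneg _) hi hle
  exact (integrable_norm_iff h.measurable_chi.aestronglyMeasurable).1 i3

lemma integrable_chi_apply (a : Fin d) :
    Integrable (fun q => chi T τ μY v q a) (towerMeasure Set.univ τ μY) :=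
  (EuclideanSpace.proj a : EuclideanSpace ℝ (Fin d) →L[ℝ] ℝ).integrable_comp h.integrable_chi

lemma integrable_outer_chi_lift (a b : Fin d) :
    Integrable (fun q => outer (chi T τ μY v q) (lift T v q) a b) (towerMeasure Set.univ τ μY) :=
  h.integrable_mul_lift (h.integrable_chi_apply a) b 0

/-- Write `S_j v` as martingale part plus `χ ∘ f^j - χ` and multiply by `φ ∘ f^j`. The martingale
part is orthogonal to it, and invariance turns the term with `χ ∘ f^j` into the integral defining
`E`. -/
lemma integral_birkhoff_mul (j : ℕ) (a b : Fin d) :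
    ∫ q, birkhoff T v j (towerProj T q) a * v (T^[j] (towerProj T q)) b
        ∂(towerMeasure Set.univ τ μY) =
      ∫ q, chi T τ μY v q a * lift T v q b ∂(towerMeasure Set.univ τ μY) -
        ∫ q, chi T τ μY v q a * v (T^[j] (towerProj T q)) b ∂(towerMeasure Set.univ τ μY) := by
  have hprob := h.isProb
  have hL : Measurable fun q => lift T v q b := (measurable_eval b).comp h.measurable_lift
  have hχm : Measurable fun q => chi T τ μY v q a := (measurable_eval a).comp h.measurable_chi
  have hp := h.preserving_towerMap.iterate j
  have hχ := h.integrable_chi_apply a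
  have hχj : Integrable (fun q => chi T τ μY v ((towerMap T τ)^[j] q) a)
      (towerMeasure Set.univ τ μY) := hp.integrable_comp_of_integrable hχ
  have hM : Integrable (fun q => martSum T τ μY v j q a) (towerMeasure Set.univ τ μY) :=
    (memLp_eval (h.memLp_martSum j) a).integrable one_le_two
  have z := h.integral_martSum_mul_comp hL a j fun k => h.integrable_mul_lift
    ((memLp_eval (h.memLp_mart_iterate k) a).integrable one_le_two) b j
  have e1 := integral_comp_of_measurePreserving hp (hχm.mul hL)
  simp only [Pi.mul_apply] at e1
  have e2 : ∫ q, birkhoff T v j (towerProj T q) a * v (T^[j] (towerProj T q)) b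
        ∂(towerMeasure Set.univ τ μY) =
      ∫ q, (martSum T τ μY v j q a * lift T v ((towerMap T τ)^[j] q) b +
        (chi T τ μY v ((towerMap T τ)^[j] q) a * lift T v ((towerMap T τ)^[j] q) b -
          chi T τ μY v q a * lift T v ((towerMap T τ)^[j] q) b))
        ∂(towerMeasure Set.univ τ μY) := by
    refine integral_congr_ae ?_
    filter_upwards [h.ae_birkhoff_eq j, ae_tower h.measurable_τ] with q hq hq2
    rw [hq, lift_iterate_eq (T := T) (v := v) h.one_le hq2]
    simp only [PiLp.add_apply, PiLp.sub_apply, cobdry]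
    ring
  have e3 : ∫ q, chi T τ μY v q a * v (T^[j] (towerProj T q)) b ∂(towerMeasure Set.univ τ μY) =
      ∫ q, chi T τ μY v q a * lift T v ((towerMap T τ)^[j] q) b
        ∂(towerMeasure Set.univ τ μY) := by
    refine integral_congr_ae ?_
    filter_upwards [ae_tower h.measurable_τ] with q hq2
    rw [lift_iterate_eq (T := T) (v := v) h.one_le hq2]
  have i1 := h.integrable_mul_lift hM b j
  have i2 := h.integrable_mul_lift hχj b j
  have i3 := h.integrable_mul_lift hχ b j
  have i4 := i2.sub i3
  simp only [Pi.sub_def] at i4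
  rw [e2, e3, integral_add i1 i4, integral_sub i2 i3, z, e1, zero_add]

lemma integrable_birkhoff_mul (j : ℕ) (a b : Fin d) :
    Integrable (fun q => birkhoff T v j (towerProj T q) a * v (T^[j] (towerProj T q)) b)
      (towerMeasure Set.univ τ μY) := by
  have hprob := h.isProb
  have m1 : Measurable fun q => birkhoff T v j (towerProj T q) a :=
    (measurable_eval a).comp ((h.measurable_birkhoff j).comp h.measurable_towerProj)
  have m2 : Measurable fun q => v (T^[j] (towerProj T q)) b :=
    (measurable_eval b).comp (h.measurable_v.comp ((h.measurable_T.iterate j).comp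
      h.measurable_towerProj))
  refine Integrable.of_bound (C := j * V * V) (m1.mul m2).aestronglyMeasurable
    (ae_of_all _ fun q => ?_)
  rw [norm_mul]
  have := h.V_nonneg
  gcongr
  · exact (PiLp.norm_apply_le _ a).trans (norm_birkhoff_le h.norm_le j _)
  · exact (PiLp.norm_apply_le _ b).trans (h.norm_le _)

lemma integrable_chi_mul (a b : Fin d) (j : ℕ) :
    Integrable (fun q => chi T τ μY v q a * v (T^[j] (towerProj T q)) b)
      (towerMeasure Set.univ τ μY) := by
  refine (h.integrable_chi_apply a).mul_bdd (c := V) ((measurable_eval b).comp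
    (h.measurable_v.comp ((h.measurable_T.iterate j).comp
      h.measurable_towerProj))).aestronglyMeasurable (ae_of_all _ fun q => ?_)
  exact (PiLp.norm_apply_le _ b).trans (h.norm_le _)

/-- Summing the preceding identity over `j` reassembles the remaining terms into one Birkhoff sum.
The error is thus expressed exactly, with a single factor `χ`. -/
lemma matIntegral_iteratedSum_sub {n : ℕ} (hn : 1 ≤ n) :
    (n : ℝ)⁻¹ • matIntegral (baseMeasure T Set.univ τ μY) (fun x => iteratedSum T v n x) -
      matIntegral (towerMeasure Set.univ τ μY) (fun q => outer (chi T τ μY v q) (lift T v q)) =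
    (-(n : ℝ)⁻¹) • matIntegral (towerMeasure Set.univ τ μY)
      (fun q => outer (chi T τ μY v q) (birkhoff T v n (towerProj T q))) := by
  have hn0 : (0 : ℝ) < n := by exact_mod_cast hn
  ext a b
  have hm : Measurable fun x => ∑ j ∈ Finset.range n, birkhoff T v j x a * v (T^[j] x) b :=
    Finset.measurable_sum (Finset.range n) (f := fun j x => birkhoff T v j x a * v (T^[j] x) b)
      fun j _ => ((measurable_eval a).comp (h.measurable_birkhoff j)).mul
        ((measurable_eval b).comp (h.measurable_v.comp (h.measurable_T.iterate j)))
  have e1 : ∫ x, iteratedSum T v n x a b ∂(baseMeasure T Set.univ τ μY) =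
      n * ∫ q, chi T τ μY v q a * lift T v q b ∂(towerMeasure Set.univ τ μY) -
        ∫ q, chi T τ μY v q a * birkhoff T v n (towerProj T q) b
          ∂(towerMeasure Set.univ τ μY) := by
    simp only [iteratedSum_apply]
    rw [h.integral_baseMeasure hm, integral_finsetSum _ fun j _ => h.integrable_birkhoff_mul j a b]
    simp only [h.integral_birkhoff_mul]
    rw [Finset.sum_sub_distrib, Finset.sum_const, Finset.card_range, nsmul_eq_mul,
      ← integral_finsetSum _ fun j _ => h.integrable_chi_mul a b j]
    congr 2
    ext q
    rw [← Finset.mul_sum]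
    congr 1
    simp [birkhoff]
  simp only [Matrix.sub_apply, Matrix.smul_apply, matIntegral, Matrix.of_apply, outer_apply,
      smul_eq_mul]
  rw [e1]
  field_simp
  ring

/-- The bound for the drift of the iterated sums. -/
theorem matNorm_iteratedSum_sub_le {n : ℕ} (hn : 1 ≤ n) :
    matNorm ((n : ℝ)⁻¹ • matIntegral (baseMeasure T Set.univ τ μY)
        (fun x => iteratedSum T v n x) -
      matIntegral (towerMeasure Set.univ τ μY) (fun q => outer (chi T τ μY v q) (lift T v q))) ≤
    (n : ℝ)⁻¹ * (V * (K + V) * psi τ μY n + A * ((K + V) * ∫ y, (τ y : ℝ) ^ 2 ∂μY) *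
      Real.sqrt (n * ((∫ y, (τ y : ℝ) ^ 2 ∂μY) *
      (16 * V ^ 2 * (∫ y, (τ y : ℝ) ^ 2 ∂μY) + 40 * K ^ 2)))) := by
  set w := Real.sqrt (n * ((∫ y, (τ y : ℝ) ^ 2 ∂μY) *
      (16 * V ^ 2 * (∫ y, (τ y : ℝ) ^ 2 ∂μY) + 40 * K ^ 2)))
  have hw : ∀ N ≤ n, ∫⁻ y, ENNReal.ofReal ‖birkhoff T v N y‖ ∂μY ≤ ENNReal.ofReal w := by
    intro N hN
    obtain ⟨i1, b1⟩ := h.integral_norm_birkhoff_sq_le hn hN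
    have hmL : MemLp (birkhoff T v N) 2 μY :=
      (memLp_two_iff_integrable_sq_norm (h.measurable_birkhoff N).aestronglyMeasurable).2 i1
    have hi := (hmL.integrable one_le_two).norm
    rw [← ofReal_integral_eq_lintegral_ofReal hi (ae_of_all _ fun _ => norm_nonneg _)]
    apply ENNReal.ofReal_le_ofReal
    apply Real.le_sqrt_of_sq_le
    refine le_trans ?_ b1
    -- Nonnegativity of the variance of the norm is the comparison of its `L¹` and `L²` norms.
    have hv := ProbabilityTheory.variance_nonneg (fun y => ‖birkhoff T v N y‖) μY
    rw [ProbabilityTheory.variance_eq_sub hmL.norm] at hv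
    simp only [Pi.pow_apply] at hv
    linarith
  obtain ⟨i2, b2⟩ := h.decoupled_integrable (Real.sqrt_nonneg _) hw
  have i1 : Integrable (fun y => V * (K + V) * (min (n : ℝ) (τ y) * (τ y : ℝ) ^ 2)) μY :=
    (h.integrable_psi n).const_mul _
  have hG : Measurable fun q => ‖chi T τ μY v q‖ * ‖birkhoff T v n (towerProj T q)‖ :=
    h.measurable_chi.norm.mul ((h.measurable_birkhoff n).comp h.measurable_towerProj).norm
  obtain ⟨i3, b3⟩ := integrable_tower_of_le h.measurable_τ h.one_le hG (fun q => by positivity)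
    (i1.add i2) (by
      filter_upwards [h.chi_le] with y hy
      exact h.sum_norm_chi_mul_birkhoff_le n hy)
  have hi : ∀ a b, Integrable (fun q => outer (chi T τ μY v q) (birkhoff T v n (towerProj T q)) a b)
      (towerMeasure Set.univ τ μY) := by
    intro a b
    refine i3.mono' (((measurable_eval a).comp h.measurable_chi).mul ((measurable_eval b).comp
      ((h.measurable_birkhoff n).comp h.measurable_towerProj))).aestronglyMeasurable
      (ae_of_all _ fun q => ?_)
    rw [outer_apply, norm_mul]
    gcongr
    · exact PiLp.norm_apply_le _ a
    · exact PiLp.norm_apply_le _ b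
  have hb := matNorm_matIntegral_le hi i3 (ae_of_all _ fun q => (matNorm_outer _ _).le)
  rw [h.matIntegral_iteratedSum_sub hn, matNorm_smul, abs_neg, abs_of_nonneg (by positivity)]
  refine mul_le_mul_of_nonneg_left (hb.trans (b3.trans ?_)) (by positivity)
  simp only [Pi.add_apply]
  rw [integral_add i1 i2, integral_const_mul]
  exact add_le_add le_rfl b2

end InducedSystem

end Tower

/-! ### Extending the return time outside the base. -/

section Congr

variable {Λ : Type*} {T : Λ → Λ} {Y : Set Λ} {τ τ' : Λ → ℕ}

lemma inducedMap_eqOn (hτ : Set.EqOn τ τ' Y) : Set.EqOn (inducedMap T τ) (inducedMap T τ') Y := by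
  intro x hx
  unfold inducedMap
  rw [hτ hx]

lemma inducedObs_eqOn {d : ℕ} (hτ : Set.EqOn τ τ' Y) (v : Λ → EuclideanSpace ℝ (Fin d)) :
    Set.EqOn (inducedObs T τ v) (inducedObs T τ' v) Y := by
  intro x hx
  unfold inducedObs
  rw [hτ hx]

/-- Only the values of the return time on the base matter. -/
lemma NonuniformlyExpanding.congr [MetricSpace Λ] [MeasurableSpace Λ] {ρ : Measure Λ}
    {α : Set (Set Λ)} {β η C₁ : ℝ} (h : NonuniformlyExpanding ρ T Y α τ β η C₁)
    (hτ : Set.EqOn τ τ' Y) : NonuniformlyExpanding ρ T Y α τ' β η C₁ := by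
  have hs : ∀ a ∈ α, a ⊆ Y := fun a ha => h.sUnion_partition ▸ Set.subset_sUnion_of_mem ha
  have hF := inducedMap_eqOn (T := T) hτ
  have hFa : ∀ a ∈ α, ∀ x ∈ a, inducedMap T τ' x = inducedMap T τ x := fun a ha x hx =>
    (hF (hs a ha hx)).symm
  have him : ∀ a ∈ α, ∀ A ⊆ a, inducedMap T τ' '' A = inducedMap T τ '' A := fun a ha A hA =>
    Set.image_congr fun x hx => hFa a ha x (hA hx)
  obtain ⟨ζ₀, hζ, hζ0, hζ1, hζ2⟩ := h.distortion
  exact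
  { nonsingular := h.nonsingular
    measurableSet_base := h.measurableSet_base
    base_pos := h.base_pos
    countable_partition := h.countable_partition
    measurableSet_partition := h.measurableSet_partition
    disjoint_partition := h.disjoint_partition
    sUnion_partition := h.sUnion_partition
    one_le_return := fun x hx => hτ hx ▸ h.one_le_return x hx
    return_const := fun a ha x hx y hy => by
      rw [← hτ (hs a ha hx), ← hτ (hs a ha hy)]
      exact h.return_const a ha x hx y hy
    integrable_return := h.integrable_return.congr_fun (fun x hx => by simp only [hτ hx])
      h.measurableSet_base
    one_lt_β := h.one_lt_β
    η_pos := h.η_pos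
    η_le_one := h.η_le_one
    one_le_C₁ := h.one_le_C₁
    mapsTo := h.mapsTo.congr hF
    bijective := fun a ha => ⟨(h.bijective a ha).1.congr (hF.mono (hs a ha)), by
      rw [him a ha a le_rfl]
      exact (h.bijective a ha).2⟩
    expanding := fun a ha x hx y hy => by
      rw [hFa a ha x hx, hFa a ha y hy]
      exact h.expanding a ha x hx y hy
    backward := fun a ha x hx y hy ℓ hℓ => by
      rw [hFa a ha x hx, hFa a ha y hy]
      exact h.backward a ha x hx y hy ℓ (hτ (hs a ha hx) ▸ hℓ)
    distortion := ⟨ζ₀, hζ, hζ0, fun a ha A hA hAm => by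
      rw [him a ha A hA]
      exact hζ1 a ha A hA hAm, fun a ha x hx y hy => by
      rw [hFa a ha x hx, hFa a ha y hy]
      exact hζ2 a ha x hx y hy⟩ }

open Classical in
/-- The return time, extended by one outside of the base. -/
noncomputable def returnExt (Y : Set Λ) (τ : Λ → ℕ) (x : Λ) : ℕ := if x ∈ Y then τ x else 1

lemma returnExt_eqOn : Set.EqOn τ (returnExt Y τ) Y := fun x hx => by
  rw [returnExt, if_pos hx]

lemma NonuniformlyExpanding.one_le_returnExt [MetricSpace Λ] [MeasurableSpace Λ] {ρ : Measure Λ}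
    {α : Set (Set Λ)} {β η C₁ : ℝ} (h : NonuniformlyExpanding ρ T Y α τ β η C₁) (x : Λ) :
    1 ≤ returnExt Y τ x := by
  unfold returnExt
  split_ifs with hx
  · exact h.one_le_return x hx
  · exact le_rfl

/-- `τ` is constant on countably many measurable pieces of `Y`, and the extension is constant off
`Y`. -/
lemma NonuniformlyExpanding.measurable_returnExt [MetricSpace Λ] [MeasurableSpace Λ]
    {ρ : Measure Λ} {α : Set (Set Λ)} {β η C₁ : ℝ}
    (h : NonuniformlyExpanding ρ T Y α τ β η C₁) : Measurable (returnExt Y τ) := by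
  have hs : ∀ a ∈ α, a ⊆ Y := fun a ha => h.sUnion_partition ▸ Set.subset_sUnion_of_mem ha
  intro B _
  have e : returnExt Y τ ⁻¹' B =
      (⋃ a ∈ {a ∈ α | ∃ x ∈ a, τ x ∈ B}, a) ∪ (Yᶜ ∩ {_x : Λ | 1 ∈ B}) := by
    ext x
    simp only [Set.mem_preimage, Set.mem_union, Set.mem_iUnion, Set.mem_inter_iff,
      Set.mem_compl_iff, Set.mem_ofPred_eq, exists_prop]
    by_cases hx : x ∈ Y
    · rw [returnExt, if_pos hx]
      constructor
      · intro hB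
        have hx2 := hx
        rw [← h.sUnion_partition] at hx2
        obtain ⟨a, ha, hxa⟩ := hx2
        exact Or.inl ⟨a, ⟨ha, x, hxa, hB⟩, hxa⟩
      · rintro (⟨a, ⟨ha, y, hy, hB⟩, hxa⟩ | ⟨hn, _⟩)
        · rwa [h.return_const a ha x hxa y hy]
        · exact absurd hx hn
    · rw [returnExt, if_neg hx]
      constructor
      · exact fun hB => Or.inr ⟨hx, hB⟩
      · rintro (⟨a, ⟨ha, _⟩, hxa⟩ | ⟨_, hB⟩)
        · exact absurd (hs a ha hxa) hx
        · exact hB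
  rw [e]
  refine MeasurableSet.union (MeasurableSet.biUnion (h.countable_partition.mono fun a ha => ha.1)
    fun a ha => h.measurableSet_partition a ha.1) (h.measurableSet_base.compl.inter ?_)
  by_cases h1 : 1 ∈ B <;> simp [h1]

variable [MeasurableSpace Λ] {μY : Measure Λ} {d : ℕ} {v : Λ → EuclideanSpace ℝ (Fin d)}

/-- From the first application of the operator on, only measures matter, so the iterates agree
everywhere. The zeroth iterate may differ off `Y`, but the series for `χ'` starts at `k = 1`. -/
lemma transferIter_succ_congr (hτ : Set.EqOn τ τ' Y) (hY : ∀ᵐ y ∂μY, y ∈ Y) (i : Fin d) (k : ℕ) :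
    transferIter T τ μY v i (k + 1) = transferIter T τ' μY v i (k + 1) := by
  have hF : inducedMap T τ =ᵐ[μY] inducedMap T τ' := by
    filter_upwards [hY] with y hy using inducedMap_eqOn hτ hy
  induction k with
  | zero =>
    refine transfer_congr hF ?_
    filter_upwards [hY] with y hy
    simp only [inducedObs_eqOn hτ v hy]
  | succ k ih =>
    unfold transferIter at ih ⊢
    rw [Function.iterate_succ_apply', ih, Function.iterate_succ_apply' _ (k + 1)]
    exact transfer_congr hF ae_eq_rfl

lemma chiBase_congr (hτ : Set.EqOn τ τ' Y) (hY : ∀ᵐ y ∂μY, y ∈ Y) :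
    chiBase T τ μY v = chiBase T τ' μY v := by
  funext y
  unfold chiBase
  simp only [transferIter_succ_congr hτ hY]

lemma chi_congr (hτ : Set.EqOn τ τ' Y) (hY : ∀ᵐ y ∂μY, y ∈ Y) :
    chi T τ μY v = chi T τ' μY v := by
  funext q
  unfold chi
  rw [chiBase_congr hτ hY]

lemma mart_congr (hτ : Set.EqOn τ τ' Y) (hY : ∀ᵐ y ∂μY, y ∈ Y) {q : Λ × ℕ} (hq : q.1 ∈ Y) :
    mart T τ μY v q = mart T τ' μY v q := by
  unfold mart mBase
  rw [chiBase_congr hτ hY, hτ hq, inducedObs_eqOn hτ v hq, inducedMap_eqOn hτ hq]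

/-- `μY` does not charge the complement of `Y`, so the columns added there are null. From then on
the base can be the whole space. -/
lemma towerMeasure_congr [SFinite μY] (hτ : Set.EqOn τ τ' Y) (hY : ∀ᵐ y ∂μY, y ∈ Y) :
    towerMeasure Y τ μY = towerMeasure Set.univ τ' μY := by
  unfold towerMeasure
  congr 1
  · congr 1
    refine lintegral_congr_ae ?_
    filter_upwards [hY] with y hy
    rw [hτ hy]
  · refine Measure.restrict_congr_set ?_
    have := (Measure.quasiMeasurePreserving_fst (μ := μY) (ν := (Measure.count : Measure ℕ))).ae hY
    filter_upwards [this] with q hq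
    apply propext
    change (q.1 ∈ Y ∧ q.2 < τ q.1) ↔ (q.1 ∈ Set.univ ∧ q.2 < τ' q.1)
    rw [hτ hq]
    simp [hq]

lemma baseMeasure_congr [SFinite μY] (hτ : Set.EqOn τ τ' Y) (hY : ∀ᵐ y ∂μY, y ∈ Y) :
    baseMeasure T Y τ μY = baseMeasure T Set.univ τ' μY := by
  unfold baseMeasure
  rw [towerMeasure_congr hτ hY]

end Congr

/-! ### Moments of the return time and the size of `psi`. -/

lemma min_le_rpow_mul_rpow {x y a : ℝ} (hx : 0 < x) (hy : 0 < y) (ha0 : 0 ≤ a) (ha1 : a ≤ 1) :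
    min x y ≤ x ^ a * y ^ (1 - a) := by
  have hm : 0 < min x y := lt_min hx hy
  calc min x y = min x y ^ a * min x y ^ (1 - a) := by
        rw [← Real.rpow_add hm]; simp
    _ ≤ x ^ a * y ^ (1 - a) := by
        have h1 : 0 ≤ 1 - a := by linarith
        gcongr
        · exact min_le_left _ _
        · exact min_le_right _ _

section Moments

variable {Λ : Type*} [MeasurableSpace Λ] {τ : Λ → ℕ} {μY : Measure Λ} {p : ℝ}

lemma integrable_rpow_of_memLp (hp : 0 < p)
    (hτp : MemLp (fun y => (τ y : ℝ)) (ENNReal.ofReal p) μY) :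
    Integrable (fun y => (τ y : ℝ) ^ p) μY := by
  have := hτp.integrable_norm_rpow (by simpa using hp) ENNReal.ofReal_ne_top
  rw [ENNReal.toReal_ofReal hp.le] at this
  simpa using this

lemma integral_rpow_eq (hp : 0 < p)
    (hτp : MemLp (fun y => (τ y : ℝ)) (ENNReal.ofReal p) μY) :
    ∫ y, (τ y : ℝ) ^ p ∂μY =
      (eLpNorm (fun y => (τ y : ℝ)) (ENNReal.ofReal p) μY).toReal ^ p := by
  have h0 : 0 ≤ ∫ y, (τ y : ℝ) ^ p ∂μY := integral_nonneg fun y => by positivity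
  rw [hτp.eLpNorm_eq_integral_rpow_norm (by simpa using hp) ENNReal.ofReal_ne_top,
    ENNReal.toReal_ofReal hp.le]
  simp only [Real.norm_natCast]
  rw [ENNReal.toReal_ofReal (by positivity), ← Real.rpow_mul h0, inv_mul_cancel₀ hp.ne',
    Real.rpow_one]

lemma integral_le_integral_rpow {g : Λ → ℝ} (hp : 0 < p)
    (hτp : MemLp (fun y => (τ y : ℝ)) (ENNReal.ofReal p) μY) (hg0 : ∀ y, 0 ≤ g y) {c : ℝ}
    (hg : ∀ y, g y ≤ c * (τ y : ℝ) ^ p) :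
    ∫ y, g y ∂μY ≤ c * ∫ y, (τ y : ℝ) ^ p ∂μY := by
  rw [← integral_const_mul]
  exact integral_mono_of_nonneg (ae_of_all _ hg0)
    ((integrable_rpow_of_memLp hp hτp).const_mul c) (ae_of_all _ hg)

lemma one_le_integral_rpow [IsProbabilityMeasure μY] (hτ1 : ∀ x, 1 ≤ τ x) (hp : 0 < p)
    (hτp : MemLp (fun y => (τ y : ℝ)) (ENNReal.ofReal p) μY) :
    1 ≤ ∫ y, (τ y : ℝ) ^ p ∂μY := by
  have := integral_le_integral_rpow (g := fun _ => 1) (c := 1) hp hτp (fun _ => zero_le_one)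
    fun y => by
      rw [one_mul]
      exact Real.one_le_rpow (by exact_mod_cast hτ1 y) hp.le
  simpa using this

lemma integral_return_le_integral_rpow (hτ1 : ∀ x, 1 ≤ τ x) (hp : 2 ≤ p)
    (hτp : MemLp (fun y => (τ y : ℝ)) (ENNReal.ofReal p) μY) :
    ∫ y, (τ y : ℝ) ∂μY ≤ ∫ y, (τ y : ℝ) ^ p ∂μY := by
  have := integral_le_integral_rpow (g := fun y => (τ y : ℝ)) (c := 1) (by linarith) hτp
    (fun _ => Nat.cast_nonneg _) fun y => by
      rw [one_mul]
      exact Real.self_le_rpow_of_one_le (by exact_mod_cast hτ1 y) (by linarith)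
  simpa using this

lemma integral_return_sq_le_integral_rpow (hτ1 : ∀ x, 1 ≤ τ x) (hp : 2 ≤ p)
    (hτp : MemLp (fun y => (τ y : ℝ)) (ENNReal.ofReal p) μY) :
    ∫ y, (τ y : ℝ) ^ 2 ∂μY ≤ ∫ y, (τ y : ℝ) ^ p ∂μY := by
  have := integral_le_integral_rpow (g := fun y => (τ y : ℝ) ^ 2) (c := 1) (by linarith) hτp
    (fun _ => by positivity) fun y => by
      rw [one_mul, ← Real.rpow_natCast]
      exact Real.rpow_le_rpow_of_exponent_le (by exact_mod_cast hτ1 y) (by exact_mod_cast hp)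
  simpa using this

/-- Interpolation: `min(n, τ) ≤ n^a τ^(1-a)`, so the integrand is at most `n^a τ^(3-a)`, and `τ ≥ 1`
allows raising the exponent to `p`. -/
lemma psi_le_of_exponent (hτ1 : ∀ x, 1 ≤ τ x) (hp : 2 ≤ p)
    (hτp : MemLp (fun y => (τ y : ℝ)) (ENNReal.ofReal p) μY) {n : ℕ} (hn : 1 ≤ n) {a : ℝ}
    (ha0 : 0 ≤ a) (ha1 : a ≤ 1) (hap : 3 - a ≤ p) :
    psi τ μY n ≤ (n : ℝ) ^ a * ∫ y, (τ y : ℝ) ^ p ∂μY := by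
  refine integral_le_integral_rpow (by linarith) hτp (fun y => by positivity) fun y => ?_
  have hy1 : (1 : ℝ) ≤ τ y := by exact_mod_cast hτ1 y
  have hn1 : (1 : ℝ) ≤ n := by exact_mod_cast hn
  have hy0 : (0 : ℝ) < τ y := by linarith
  calc min (n : ℝ) (τ y) * (τ y : ℝ) ^ 2
      ≤ ((n : ℝ) ^ a * (τ y : ℝ) ^ (1 - a)) * (τ y : ℝ) ^ 2 := by
        gcongr
        exact min_le_rpow_mul_rpow (by linarith) hy0 ha0 ha1
    _ = (n : ℝ) ^ a * (τ y : ℝ) ^ (3 - a) := by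
        rw [← Real.rpow_natCast (τ y : ℝ) 2, mul_assoc, ← Real.rpow_add hy0]
        congr 2
        push_cast
        ring
    _ ≤ _ := by
        gcongr

/-- The exponent `a = 2/p` gives `n^(2/p - 1)`, the square of the rate. It is admissible since `3 -
2/p ≤ p` amounts to `(p - 1)(p - 2) ≥ 0`. -/
lemma psi_div_le_sq (hτ1 : ∀ x, 1 ≤ τ x) (hp : 2 ≤ p)
    (hτp : MemLp (fun y => (τ y : ℝ)) (ENNReal.ofReal p) μY) {n : ℕ} (hn : 1 ≤ n) :
    psi τ μY n / n ≤ (∫ y, (τ y : ℝ) ^ p ∂μY) * ((n : ℝ) ^ (1 / p - 1 / 2)) ^ 2 := by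
  have hn0 : (0 : ℝ) < n := by exact_mod_cast hn
  have hp0 : 0 < p := by linarith
  have h1 := psi_le_of_exponent hτ1 hp hτp hn (a := 2 / p) (by positivity)
    ((div_le_one hp0).2 hp) (by
      rw [sub_le_iff_le_add, ← sub_le_iff_le_add', le_div_iff₀ hp0]
      nlinarith)
  rw [div_le_iff₀ hn0]
  refine h1.trans (le_of_eq ?_)
  rw [mul_comm, mul_assoc]
  congr 1
  rw [← Real.rpow_natCast, ← Real.rpow_mul hn0.le]
  nth_rw 3 [← Real.rpow_one (n : ℝ)]
  rw [← Real.rpow_add hn0]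
  congr 1
  push_cast
  ring

/-- The exponent is `a = 3 - p` for `p ≤ 3` and `a = 0` for `p ≥ 3`. In the second case the
resulting `n^(-1)` is below `n^(-1/2)`. -/
lemma psi_div_le_add (hτ1 : ∀ x, 1 ≤ τ x) (hp : 2 ≤ p)
    (hτp : MemLp (fun y => (τ y : ℝ)) (ENNReal.ofReal p) μY) {n : ℕ} (hn : 1 ≤ n) :
    psi τ μY n / n ≤ (∫ y, (τ y : ℝ) ^ p ∂μY) *
      ((n : ℝ) ^ (-(1 / 2) : ℝ) + (n : ℝ) ^ (-(p - 2))) := by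
  have hn0 : (0 : ℝ) < n := by exact_mod_cast hn
  have hn1 : (1 : ℝ) ≤ n := by exact_mod_cast hn
  have hM : 0 ≤ ∫ y, (τ y : ℝ) ^ p ∂μY := integral_nonneg fun y => by positivity
  have key : ∀ a : ℝ, psi τ μY n ≤ (n : ℝ) ^ a * ∫ y, (τ y : ℝ) ^ p ∂μY →
      psi τ μY n / n ≤ (∫ y, (τ y : ℝ) ^ p ∂μY) * (n : ℝ) ^ (a - 1) := fun a ha => by
    rw [div_le_iff₀ hn0, mul_assoc, Real.rpow_sub_one hn0.ne', div_mul_cancel₀ _ hn0.ne', mul_comm]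
    exact ha
  rcases le_total 3 p with h3 | h3
  · refine (key 0 (psi_le_of_exponent hτ1 hp hτp hn le_rfl zero_le_one (by linarith))).trans ?_
    gcongr
    refine le_trans ?_ (le_add_of_nonneg_right (by positivity))
    exact Real.rpow_le_rpow_of_exponent_le hn1 (by norm_num)
  · refine (key (3 - p) (psi_le_of_exponent hτ1 hp hτp hn (by linarith) (by linarith)
      (by linarith))).trans ?_
    gcongr
    refine le_trans (le_of_eq ?_) (le_add_of_nonneg_left (by positivity))
    congr 1
    ring

end Moments

/-! ### Rates and limits. -/

namespace InducedSystem

variable {Λ : Type*} [MeasurableSpace Λ] {d : ℕ} {T : Λ → Λ} {τ : Λ → ℕ}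
    {μY : Measure Λ} {v : Λ → EuclideanSpace ℝ (Fin d)} {V B A M : ℝ}

section General

variable {K : ℝ} (h : InducedSystem T τ μY v V K A)
include h

/-- Dominated convergence, with `τ²` as the dominating function. This yields the limits for `p = 2`
too, where the stated rates do not tend to zero. -/
lemma tendsto_psi_div : Tendsto (fun n : ℕ => psi τ μY n / n) atTop (𝓝 0) := by
  have e : ∀ n : ℕ, psi τ μY n / n = ∫ y, min (n : ℝ) (τ y) * (τ y : ℝ) ^ 2 / n ∂μY := fun n => by
    rw [integral_div]
    rfl
  simp only [e]
  have h0 : ∫ _y : Λ, (0 : ℝ) ∂μY = 0 := integral_zero _ _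
  rw [← h0]
  refine tendsto_integral_of_dominated_convergence (fun y => (τ y : ℝ) ^ 2)
    (fun n => ((h.integrable_psi n).div_const _).aestronglyMeasurable) h.integrable_return_sq
    (fun n => ae_of_all _ fun y => ?_) (ae_of_all _ fun y => ?_)
  · rw [Real.norm_of_nonneg (by positivity)]
    refine div_le_of_le_mul₀ (by positivity) (by positivity) ?_
    rw [mul_comm]
    gcongr
    exact min_le_left _ _
  · refine squeeze_zero (fun n => by positivity) (fun n => ?_)
      (tendsto_const_div_atTop_nhds_zero_nat ((τ y : ℝ) * (τ y : ℝ) ^ 2))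
    gcongr
    exact min_le_right _ _

variable [IsProbabilityMeasure μY]

lemma one_le_psi {n : ℕ} (hn : 1 ≤ n) : 1 ≤ psi τ μY n := by
  have := integral_mono (integrable_const (1 : ℝ)) (h.integrable_psi n) fun y => by
    have hy1 : (1 : ℝ) ≤ τ y := by exact_mod_cast h.one_le y
    have hn1 : (1 : ℝ) ≤ n := by exact_mod_cast hn
    exact one_le_mul_of_one_le_of_one_le (le_min hn1 hy1) (one_le_pow₀ hy1)
  simpa [psi] using this

end General

variable [IsProbabilityMeasure μY] (h : InducedSystem T τ μY v V (V * B) A)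
include h

/-- The bound for `χ'` is taken as `V * B`, so that `V²` factors out. The two conditions on `s` say
that the squared `L²` norm of the coboundary, divided by `n`, is of order `s²`, which balances the
two terms of Young's inequality. -/
lemma matNorm_variance_sub_le_mul (hM : ∫ y, (τ y : ℝ) ^ 2 ∂μY ≤ M) {n : ℕ} (hn : 1 ≤ n) {s : ℝ}
    (hs : 0 < s) (hs1 : (n : ℝ)⁻¹ ≤ s ^ 2) (hs2 : psi τ μY n / n ≤ M * s ^ 2) :
    matNorm ((n : ℝ)⁻¹ • matIntegral (baseMeasure T Set.univ τ μY)
        (fun x => outer (birkhoff T v n x) (birkhoff T v n x)) -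
      matIntegral (towerMeasure Set.univ τ μY)
        (fun q => outer (mart T τ μY v q) (mart T τ μY v q))) ≤
      V ^ 2 * (s * (2 * M + 8 * B ^ 2) + (s + s ^ 2) * (12 * B ^ 2 + 6 * M)) := by
  refine (h.matNorm_variance_sub_le hn hs).trans ?_
  have e : (12 * (V * B) ^ 2 + 6 * V ^ 2 * psi τ μY n) / n =
      V ^ 2 * (12 * B ^ 2 * (n : ℝ)⁻¹ + 6 * (psi τ μY n / n)) := by
    rw [div_eq_mul_inv, div_eq_mul_inv]
    ring
  rw [e]
  calc _ ≤ s * (2 * V ^ 2 * M + 8 * (V * B) ^ 2) +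
        (s⁻¹ + 1) * (V ^ 2 * (12 * B ^ 2 * s ^ 2 + 6 * (M * s ^ 2))) := by gcongr
    _ = _ := by field_simp

lemma matNorm_variance_sub_le_rpow {p : ℝ} (hp : 2 ≤ p)
    (hτp : MemLp (fun y => (τ y : ℝ)) (ENNReal.ofReal p) μY)
    (hM : ∫ y, (τ y : ℝ) ^ p ∂μY = M) {n : ℕ} (hn : 1 ≤ n) :
    matNorm ((n : ℝ)⁻¹ • matIntegral (baseMeasure T Set.univ τ μY)
        (fun x => outer (birkhoff T v n x) (birkhoff T v n x)) -
      matIntegral (towerMeasure Set.univ τ μY)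
        (fun q => outer (mart T τ μY v q) (mart T τ μY v q))) ≤
      (14 * M + 32 * B ^ 2) * V ^ 2 * (n : ℝ) ^ (1 / p - 1 / 2) := by
  have hn0 : (0 : ℝ) < n := by exact_mod_cast hn
  have hn1 : (1 : ℝ) ≤ n := by exact_mod_cast hn
  have hp0 : 0 < p := by linarith
  have hM0 : 0 ≤ M := hM ▸ integral_nonneg fun y => by positivity
  have hs1 : (n : ℝ) ^ (1 / p - 1 / 2) ≤ 1 :=
    Real.rpow_le_one_of_one_le_of_nonpos hn1 (by
      rw [sub_nonpos]
      exact one_div_le_one_div_of_le two_pos hp)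
  have h1 : (n : ℝ)⁻¹ ≤ ((n : ℝ) ^ (1 / p - 1 / 2)) ^ 2 := by
    rw [← Real.rpow_natCast, ← Real.rpow_mul hn0.le, ← Real.rpow_neg_one]
    refine Real.rpow_le_rpow_of_exponent_le hn1 ?_
    have : 0 ≤ 1 / p := by positivity
    push_cast
    linarith
  refine (h.matNorm_variance_sub_le_mul (hM ▸ integral_return_sq_le_integral_rpow h.one_le hp hτp)
    hn (by positivity) h1 (hM ▸ psi_div_le_sq h.one_le hp hτp hn)).trans ?_
  set s := (n : ℝ) ^ (1 / p - 1 / 2)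
  have hs0 : 0 ≤ s := by positivity
  calc _ ≤ V ^ 2 * (s * (2 * M + 8 * B ^ 2) + (s + s) * (12 * B ^ 2 + 6 * M)) := by
        gcongr
        rw [pow_two]
        exact mul_le_of_le_one_left hs0 hs1
    _ = _ := by ring

lemma tendsto_variance :
    Tendsto (fun n : ℕ => (n : ℝ)⁻¹ • matIntegral (baseMeasure T Set.univ τ μY)
        (fun x => outer (birkhoff T v n x) (birkhoff T v n x))) atTop
      (𝓝 (matIntegral (towerMeasure Set.univ τ μY)
        (fun q => outer (mart T τ μY v q) (mart T τ μY v q)))) := by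
  set M := ∫ y, (τ y : ℝ) ^ 2 ∂μY with hM
  have hM1 : 1 ≤ M := by
    have := (h.one_le_psi le_rfl).trans (h.psi_le 1)
    simpa using this
  have ht : Tendsto (fun n : ℕ => Real.sqrt (psi τ μY n / n)) atTop (𝓝 0) := by
    simpa using h.tendsto_psi_div.sqrt
  -- Here `s` is the square root of `psi n / n`. It satisfies `n⁻¹ ≤ s²` because `psi n ≥ 1`.
  refine tendsto_of_matNorm_sub_le (b := fun n : ℕ => V ^ 2 * (Real.sqrt (psi τ μY n / n) *
    (2 * M + 8 * B ^ 2) + (Real.sqrt (psi τ μY n / n) + Real.sqrt (psi τ μY n / n) ^ 2) *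
      (12 * B ^ 2 + 6 * M))) ?_ fun n hn => ?_
  · have := ((ht.mul_const (2 * M + 8 * B ^ 2)).add
      ((ht.add (ht.pow 2)).mul_const (12 * B ^ 2 + 6 * M))).const_mul (V ^ 2)
    simpa using this
  · have hn0 : (0 : ℝ) < n := by exact_mod_cast hn
    have h1 := h.one_le_psi hn
    have h0 : 0 < psi τ μY n / n := by positivity
    refine h.matNorm_variance_sub_le_mul hM.ge hn (Real.sqrt_pos.2 h0) ?_ ?_
    · rw [Real.sq_sqrt h0.le, inv_eq_one_div]
      gcongr
    · rw [Real.sq_sqrt h0.le]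
      exact le_mul_of_one_le_left h0.le hM1

lemma matNorm_iteratedSum_sub_le_mul (hB : 0 ≤ B) (hM : ∫ y, (τ y : ℝ) ^ 2 ∂μY ≤ M) {n : ℕ}
    (hn : 1 ≤ n) :
    matNorm ((n : ℝ)⁻¹ • matIntegral (baseMeasure T Set.univ τ μY)
        (fun x => iteratedSum T v n x) -
      matIntegral (towerMeasure Set.univ τ μY) (fun q => outer (chi T τ μY v q) (lift T v q))) ≤
    V ^ 2 * (B + 1) * (psi τ μY n / n +
      A * M * Real.sqrt (M * (16 * M + 40 * B ^ 2)) * (n : ℝ) ^ (-(1 / 2) : ℝ)) := by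
  have hn0 : (0 : ℝ) < n := by exact_mod_cast hn
  have hV := h.V_nonneg
  have hA := h.A_nonneg
  have hI : 0 ≤ ∫ y, (τ y : ℝ) ^ 2 ∂μY := integral_nonneg fun y => by positivity
  have hM0 := hI.trans hM
  refine (h.matNorm_iteratedSum_sub_le hn).trans ?_
  have e : (n : ℝ)⁻¹ * Real.sqrt n = (n : ℝ) ^ (-(1 / 2) : ℝ) := by
    rw [Real.sqrt_eq_rpow, ← Real.rpow_neg_one, ← Real.rpow_add hn0]
    norm_num
  have e2 : Real.sqrt (n * (M * (16 * V ^ 2 * M + 40 * (V * B) ^ 2))) =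
      Real.sqrt n * (V * Real.sqrt (M * (16 * M + 40 * B ^ 2))) := by
    rw [Real.sqrt_mul hn0.le, show M * (16 * V ^ 2 * M + 40 * (V * B) ^ 2) =
      V ^ 2 * (M * (16 * M + 40 * B ^ 2)) by ring, Real.sqrt_mul (sq_nonneg V), Real.sqrt_sq hV]
  calc _ ≤ (n : ℝ)⁻¹ * (V * (V * B + V) * psi τ μY n + A * ((V * B + V) * M) *
      Real.sqrt (n * (M * (16 * V ^ 2 * M + 40 * (V * B) ^ 2)))) := by gcongr
    _ = _ := by
      rw [e2, ← e]
      field_simp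

lemma matNorm_iteratedSum_sub_le_rpow (hB : 0 ≤ B) {p : ℝ} (hp : 2 ≤ p)
    (hτp : MemLp (fun y => (τ y : ℝ)) (ENNReal.ofReal p) μY)
    (hM : ∫ y, (τ y : ℝ) ^ p ∂μY = M) {n : ℕ} (hn : 1 ≤ n) :
    matNorm ((n : ℝ)⁻¹ • matIntegral (baseMeasure T Set.univ τ μY)
        (fun x => iteratedSum T v n x) -
      matIntegral (towerMeasure Set.univ τ μY) (fun q => outer (chi T τ μY v q) (lift T v q))) ≤
    ((B + 1) * M * (1 + A * Real.sqrt (M * (16 * M + 40 * B ^ 2)))) * V ^ 2 *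
      ((n : ℝ) ^ (-(1 / 2) : ℝ) + (n : ℝ) ^ (-(p - 2))) := by
  have hA := h.A_nonneg
  have hM0 : 0 ≤ M := hM ▸ integral_nonneg fun y => by positivity
  have h1 : psi τ μY n / n ≤ M * ((n : ℝ) ^ (-(1 / 2) : ℝ) + (n : ℝ) ^ (-(p - 2))) :=
    hM ▸ psi_div_le_add h.one_le hp hτp hn
  refine (h.matNorm_iteratedSum_sub_le_mul hB
    (hM ▸ integral_return_sq_le_integral_rpow h.one_le hp hτp) hn).trans ?_
  have h2 : (n : ℝ) ^ (-(1 / 2) : ℝ) ≤ (n : ℝ) ^ (-(1 / 2) : ℝ) + (n : ℝ) ^ (-(p - 2)) :=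
    le_add_of_nonneg_right (by positivity)
  set r := (n : ℝ) ^ (-(1 / 2) : ℝ) + (n : ℝ) ^ (-(p - 2))
  calc _ ≤ V ^ 2 * (B + 1) * (M * r + A * M * Real.sqrt (M * (16 * M + 40 * B ^ 2)) * r) := by
        gcongr
    _ = _ := by ring

lemma tendsto_iteratedSum (hB : 0 ≤ B) :
    Tendsto (fun n : ℕ => (n : ℝ)⁻¹ • matIntegral (baseMeasure T Set.univ τ μY)
        (fun x => iteratedSum T v n x)) atTop
      (𝓝 (matIntegral (towerMeasure Set.univ τ μY)
        (fun q => outer (chi T τ μY v q) (lift T v q)))) := by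
  refine tendsto_of_matNorm_sub_le ?_ fun n hn => h.matNorm_iteratedSum_sub_le_mul hB le_rfl hn
  have h1 : Tendsto (fun n : ℕ => (n : ℝ) ^ (-(1 / 2) : ℝ)) atTop (𝓝 0) :=
    (tendsto_rpow_neg_atTop (by norm_num)).comp tendsto_natCast_atTop_atTop
  have := (h.tendsto_psi_div.add (h1.const_mul (A * (∫ y, (τ y : ℝ) ^ 2 ∂μY) *
    Real.sqrt ((∫ y, (τ y : ℝ) ^ 2 ∂μY) * (16 * (∫ y, (τ y : ℝ) ^ 2 ∂μY) + 40 * B ^ 2))))).const_mul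
    (V ^ 2 * (B + 1))
  simpa using this

end InducedSystem

/-! ### The constant and its continuity. -/

/-- The constant in the moment estimates, as a function of the supremum of `χ'` per unit of
Hölder norm, of the decoupling constant and of the `p`-th moment of the return time. -/
noncomputable def momentConst (B A M : ℝ) : ℝ :=
  (14 * M + 32 * B ^ 2) + (B + 1) * M * (1 + A * Real.sqrt (M * (16 * M + 40 * B ^ 2)))

lemma chiConst_nonneg {D β η C₁ t : ℝ} (hβ : 1 < β) (hη : 0 < η) (ht : 0 ≤ t) :
    0 ≤ chiConst D β η C₁ t :=
  div_nonneg (mul_nonneg (Real.exp_pos _).le (by positivity)) (gap_pos hβ hη).le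

lemma chiConst_mono {D β η C₁ s t : ℝ} (hβ : 1 < β) (hη : 0 < η) (hst : s ≤ t) :
    chiConst D β η C₁ s ≤ chiConst D β η C₁ t := by
  have h1 := gap_pos (D := D) (C₁ := C₁) hβ hη
  have h2 : 0 < distConst D β η C₁ := Real.exp_pos _
  unfold chiConst decayConst
  gcongr

/-- The constant of the theorem, as a function of `diam Λ`, `C₁`, `β`, `η`, `p` and `|τ|_p`. -/
noncomputable def rateConst (x : ℝ × ℝ × ℝ × ℝ × ℝ × ℝ) : ℝ :=
  momentConst (chiConst x.1 x.2.2.1 x.2.2.2.1 x.2.1 (x.2.2.2.2.2 ^ x.2.2.2.2.1))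
    (distConst x.1 x.2.2.1 x.2.2.2.1 x.2.1) (x.2.2.2.2.2 ^ x.2.2.2.2.1)

/-- The denominators `1 - ratio` and `gap` do not vanish on the domain. The power `D^η` is
continuous even at `D = 0` because `η > 0`, and the other powers have positive bases. -/
lemma continuousOn_rateConst : ContinuousOn rateConst
    (Set.Ici 0 ×ˢ Set.Ici 1 ×ˢ Set.Ioi 1 ×ˢ Set.Ioc 0 1 ×ˢ Set.Ici 2 ×ˢ Set.Ici 1) := by
  set s : Set (ℝ × ℝ × ℝ × ℝ × ℝ × ℝ) :=
    Set.Ici 0 ×ˢ Set.Ici 1 ×ˢ Set.Ioi 1 ×ˢ Set.Ioc 0 1 ×ˢ Set.Ici 2 ×ˢ Set.Ici 1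
  have hs : ∀ x ∈ s, 1 < x.2.2.1 ∧ 0 < x.2.2.2.1 ∧ 1 ≤ x.2.2.2.2.2 :=
    fun x hx => ⟨hx.2.2.1, hx.2.2.2.1.1, hx.2.2.2.2.2⟩
  have hD : ContinuousOn (fun x : ℝ × ℝ × ℝ × ℝ × ℝ × ℝ => x.1 ^ x.2.2.2.1) s :=
    ContinuousOn.rpow (by fun_prop) (by fun_prop) fun x hx => Or.inr (hs x hx).2.1
  have hM : ContinuousOn (fun x : ℝ × ℝ × ℝ × ℝ × ℝ × ℝ => x.2.2.2.2.2 ^ x.2.2.2.2.1) s :=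
    ContinuousOn.rpow (by fun_prop) (by fun_prop) fun x hx =>
      Or.inl (zero_lt_one.trans_le (hs x hx).2.2).ne'
  have hr : ContinuousOn (fun x : ℝ × ℝ × ℝ × ℝ × ℝ × ℝ => ratio x.2.2.1 x.2.2.2.1) s := by
    unfold ratio
    exact ContinuousOn.rpow (by fun_prop) (by fun_prop) fun x hx =>
      Or.inl (zero_lt_one.trans (hs x hx).1).ne'
  have hc : ContinuousOn
      (fun x : ℝ × ℝ × ℝ × ℝ × ℝ × ℝ => coneConst x.2.2.1 x.2.2.2.1 x.2.1) s := by
    unfold coneConst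
    exact ContinuousOn.div (by fun_prop) (by fun_prop) fun x hx =>
      (sub_pos.2 (ratio_lt_one (hs x hx).1 (hs x hx).2.1)).ne'
  have hg : ContinuousOn
      (fun x : ℝ × ℝ × ℝ × ℝ × ℝ × ℝ => gap x.1 x.2.2.1 x.2.2.2.1 x.2.1) s := by
    unfold gap
    fun_prop
  have hA : ContinuousOn
      (fun x : ℝ × ℝ × ℝ × ℝ × ℝ × ℝ => distConst x.1 x.2.2.1 x.2.2.2.1 x.2.1) s := by
    unfold distConst
    fun_prop
  have hB : ContinuousOn (fun x : ℝ × ℝ × ℝ × ℝ × ℝ × ℝ =>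
      chiConst x.1 x.2.2.1 x.2.2.2.1 x.2.1 (x.2.2.2.2.2 ^ x.2.2.2.2.1)) s := by
    unfold chiConst decayConst
    exact ContinuousOn.div (by fun_prop) hg fun x hx => (gap_pos (hs x hx).1 (hs x hx).2.1).ne'
  unfold rateConst momentConst
  fun_prop

/-! ### Assembly. -/

section Main

variable {Λ : Type*} [MetricSpace Λ] [BoundedSpace Λ] [MeasurableSpace Λ] [BorelSpace Λ]
    {ρ : Measure Λ} [IsFiniteMeasure ρ] {T : Λ → Λ} {Y : Set Λ} {α : Set (Set Λ)} {τ : Λ → ℕ}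
    {β η C₁ : ℝ} {μY : Measure Λ} [IsProbabilityMeasure μY] {p : ℝ} {d : ℕ}
    {v : Λ → EuclideanSpace ℝ (Fin d)}

lemma integral_inducedObs_eq_zero (hT : Measurable T) (hτ : Measurable τ) (hτ1 : ∀ x, 1 ≤ τ x)
    (hτi : Integrable (fun y => (τ y : ℝ)) μY) (hη : 0 < η) (hv : MemHolder η.toNNReal v)
    (h0 : ∫ x, v x ∂(baseMeasure T Set.univ τ μY) = 0) : ∫ y, inducedObs T τ v y ∂μY = 0 := by
  have hvm : Measurable v := (continuous_of_memHolder hη hv).measurable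
  have hpm : Measurable (towerProj T : Λ × ℕ → Λ) :=
    measurable_from_prod_countable_left fun n => hT.iterate n
  have hprob := isProbabilityMeasure_towerMeasure (μY := μY) hτ hτ1 hτi
  have hi : Integrable (lift T v) (towerMeasure Set.univ τ μY) :=
    Integrable.of_bound (C := holderNorm η v) (hvm.comp hpm).aestronglyMeasurable
      (ae_of_all _ fun q => norm_le_holderNorm hη hv _)
  unfold baseMeasure at h0
  rw [integral_map hpm.aemeasurable hvm.aestronglyMeasurable] at h0
  change ∫ q, lift T v q ∂(towerMeasure Set.univ τ μY) = 0 at h0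
  rw [integral_towerMeasure hτ hτ1 hτi hi] at h0
  refine (smul_eq_zero.1 h0).resolve_left (inv_ne_zero ?_)
  have : (1 : ℝ) ≤ ∫ y, (τ y : ℝ) ∂μY := by
    have := integral_mono (integrable_const (1 : ℝ)) hτi fun y => by
      change (1 : ℝ) ≤ (τ y : ℝ)
      exact_mod_cast hτ1 y
    simpa using this
  positivity

/-- Any majorant `M` of the mean return time is allowed. The choice of the `p`-th moment makes the
constants functions of `|τ|_p` rather than of the mean itself. -/
theorem inducedSystem (h : NonuniformlyExpanding ρ T Y α τ β η C₁) (hτ : Measurable τ)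
    (hτ1 : ∀ x, 1 ≤ τ x) (hac : μY ≪ ρ.restrict Y) (hinv : μY.map (inducedMap T τ) = μY)
    (hτ2 : MemLp (fun y => (τ y : ℝ)) 2 μY) (hv : MemHolder η.toNNReal v)
    (h0 : ∫ y, inducedObs T τ v y ∂μY = 0) {M : ℝ} (hM : ∫ y, (τ y : ℝ) ∂μY ≤ M) :
    InducedSystem T τ μY v (holderNorm η v)
      (holderNorm η v * chiConst (Metric.diam (Set.univ : Set Λ)) β η C₁ M)
      (distConst (Metric.diam (Set.univ : Set Λ)) β η C₁) := by
  have hτi := hτ2.integrable one_le_two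
  have hM0 : 0 ≤ M := (integral_nonneg fun _ => Nat.cast_nonneg _).trans hM
  have hV : 0 ≤ holderNorm η v := holderNorm_nonneg
  exact
  { measurable_T := h.nonsingular.measurable
    measurable_τ := hτ
    one_le := hτ1
    preserving := ⟨h.measurable_F hτ, hinv⟩
    memLp_two := hτ2
    measurable_v := (continuous_of_memHolder h.η_pos hv).measurable
    V_nonneg := hV
    K_nonneg := mul_nonneg hV (chiConst_nonneg h.one_lt_β h.η_pos hM0)
    A_nonneg := (Real.exp_pos _).le
    norm_le := norm_le_holderNorm h.η_pos hv
    chi_le := by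
      filter_upwards [ae_summable_and_norm_chiBase_le h hτ hac hinv hτi hv h0] with y hy
      exact hy.2.trans (mul_le_mul_of_nonneg_left (chiConst_mono h.one_lt_β h.η_pos hM) hV)
    transfer_mBase := fun i B hB => setIntegral_preimage_mBase h hτ hac hinv hτi hv h0 i hB
    decouple := fun s W hW => lintegral_comp_return_le h hτ hac hinv s hW }

end Main

end NUE

theorem mainTheorem6 :
    ∃ C : ℝ × ℝ × ℝ × ℝ × ℝ × ℝ → ℝ,
      ContinuousOn C (Set.Ici 0 ×ˢ Set.Ici 1 ×ˢ Set.Ioi 1 ×ˢ Set.Ioc 0 1 ×ˢ Set.Ici 2 ×ˢ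
        Set.Ici 1) ∧
      ∀ (Λ : Type*) [MetricSpace Λ] [BoundedSpace Λ] [MeasurableSpace Λ] [BorelSpace Λ]
        (ρ : Measure Λ) [IsFiniteMeasure ρ] (T : Λ → Λ) (Y : Set Λ) (α : Set (Set Λ))
        (τ : Λ → ℕ) (β η C₁ : ℝ) (_ : NUE.NonuniformlyExpanding ρ T Y α τ β η C₁)
        -- the absolutely continuous invariant probability measure of the induced map
        (μY : Measure Λ) [IsProbabilityMeasure μY] (_ : μY ≪ ρ.restrict Y)
        (_ : μY.map (NUE.inducedMap T τ) = μY)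
        (p : ℝ) (_ : 2 ≤ p) (_ : MemLp (fun y => (τ y : ℝ)) (ENNReal.ofReal p) μY)
        (d : ℕ) (v : Λ → EuclideanSpace ℝ (Fin d)) (_ : MemHolder η.toNNReal v)
        (_ : ∫ x, v x ∂(NUE.baseMeasure T Y τ μY) = 0),
        let μ := NUE.baseMeasure T Y τ μY
        let μΔ := NUE.towerMeasure Y τ μY
        let φ := NUE.lift T v
        let χ := NUE.chi T τ μY v
        let m := NUE.mart T τ μY v
        let S := NUE.matIntegral μΔ fun q => NUE.outer (m q) (m q)
        let E := NUE.matIntegral μΔ fun q => NUE.outer (χ q) (φ q)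
        let Sn : ℕ → Matrix (Fin d) (Fin d) ℝ := fun n => (n : ℝ)⁻¹ •
          NUE.matIntegral μ fun x => NUE.outer (NUE.birkhoff T v n x) (NUE.birkhoff T v n x)
        let En : ℕ → Matrix (Fin d) (Fin d) ℝ := fun n => (n : ℝ)⁻¹ •
          NUE.matIntegral μ fun x => NUE.iteratedSum T v n x
        let K := C (Metric.diam (Set.univ : Set Λ), C₁, β, η, p,
          (eLpNorm (fun y => (τ y : ℝ)) (ENNReal.ofReal p) μY).toReal)
        -- the series for `χ'` converges and the integrands are integrable
        (∀ᵐ y ∂μY, ∀ i, Summable fun k : ℕ => NUE.transferIter T τ μY v i (k + 1) y) ∧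
        (∀ i j, Integrable (fun q => NUE.outer (m q) (m q) i j) μΔ) ∧
        (∀ i j, Integrable (fun q => NUE.outer (χ q) (φ q) i j) μΔ) ∧
        Tendsto Sn atTop (𝓝 S) ∧
        Tendsto En atTop (𝓝 E) ∧
        ∀ n : ℕ, 1 ≤ n →
          NUE.matNorm (Sn n - S) ≤ K * NUE.holderNorm η v ^ 2 * (n : ℝ) ^ (1 / p - 1 / 2) ∧
          NUE.matNorm (En n - E) ≤
            K * NUE.holderNorm η v ^ 2 * ((n : ℝ) ^ (-(1 / 2) : ℝ) + (n : ℝ) ^ (-(p - 2))) := by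
  refine ⟨NUE.rateConst, NUE.continuousOn_rateConst, ?_⟩
  intro Λ _ _ _ _ ρ _ T Y α τ₀ β η C₁ h₀ μY _ hac hinv₀ p hp hτp₀ d v hv hmean₀
  -- The return time is prescribed only on `Y`. Its extension by `1` is measurable and at least `1`
  -- everywhere, and all objects of the statement agree with their versions for the extension, up to
  -- null sets.
  have hτ₀ : Set.EqOn τ₀ (NUE.returnExt Y τ₀) Y := NUE.returnExt_eqOn
  have hY : ∀ᵐ y ∂μY, y ∈ Y := hac.ae_le (ae_restrict_mem h₀.measurableSet_base)
  have h := h₀.congr hτ₀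
  have hτ := h₀.measurable_returnExt
  have hτ1 := h₀.one_le_returnExt
  set τ := NUE.returnExt Y τ₀
  have hinv : μY.map (NUE.inducedMap T τ) = μY := by
    rw [← hinv₀]
    conv_lhs => rw [hinv₀]
    refine Measure.map_congr ?_
    filter_upwards [hY] with y hy using (NUE.inducedMap_eqOn hτ₀ hy).symm
  have hae : (fun y => (τ₀ y : ℝ)) =ᵐ[μY] fun y => (τ y : ℝ) := by
    filter_upwards [hY] with y hy
    rw [hτ₀ hy]
  have hτp := hτp₀.ae_eq hae
  have hΔ := NUE.towerMeasure_congr (μY := μY) hτ₀ hY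
  have hμ := NUE.baseMeasure_congr (T := T) hτ₀ hY
  have hmean := hμ ▸ hmean₀
  have hp0 : 0 < p := by linarith
  have hτ2 : MemLp (fun y => (τ y : ℝ)) 2 μY :=
    hτp.mono_exponent (by simpa using ENNReal.ofReal_le_ofReal hp)
  have hτi := hτ2.integrable one_le_two
  have h0 := NUE.integral_inducedObs_eq_zero h.nonsingular.measurable hτ hτ1 hτi h.η_pos hv hmean
  have hM := NUE.integral_rpow_eq hp0 hτp
  have hM1 := NUE.one_le_integral_rpow hτ1 hp0 hτp
  have hsys := NUE.inducedSystem h hτ hτ1 hac hinv hτ2 hv h0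
    (NUE.integral_return_le_integral_rpow hτ1 hp hτp)
  have hB := NUE.chiConst_nonneg (D := Metric.diam (Set.univ : Set Λ)) (C₁ := C₁) h.one_lt_β
    h.η_pos (zero_le_one.trans hM1)
  have hA := hsys.A_nonneg
  -- Unlike `χ`, the function `m` involves the values of `τ` directly, so the two versions agree
  -- only over `Y`, that is almost everywhere.
  have hm : ∀ᵐ q ∂(NUE.towerMeasure Set.univ τ μY),
      NUE.mart T τ₀ μY v q = NUE.mart T τ μY v q := by
    filter_upwards [NUE.ae_tower_of_ae hY] with q hq
    exact NUE.mart_congr hτ₀ hY hq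
  have hS : NUE.matIntegral (NUE.towerMeasure Set.univ τ μY)
      (fun q => NUE.outer (NUE.mart T τ₀ μY v q) (NUE.mart T τ₀ μY v q)) =
      NUE.matIntegral (NUE.towerMeasure Set.univ τ μY)
      (fun q => NUE.outer (NUE.mart T τ μY v q) (NUE.mart T τ μY v q)) := by
    ext i j
    refine integral_congr_ae ?_
    filter_upwards [hm] with q hq
    rw [hq]
  intro μ μΔ φ χ m S E Sn En K
  have hK : K = NUE.momentConst
      (NUE.chiConst (Metric.diam (Set.univ : Set Λ)) β η C₁ (∫ y, (τ y : ℝ) ^ p ∂μY))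
      (NUE.distConst (Metric.diam (Set.univ : Set Λ)) β η C₁) (∫ y, (τ y : ℝ) ^ p ∂μY) := by
    rw [hM, ← eLpNorm_congr_ae hae]
    rfl
  clear_value K
  simp only [μ, μΔ, φ, χ, m, S, E, Sn, En]
  rw [hΔ, hμ, hS, NUE.chi_congr hτ₀ hY, hK]
  refine ⟨?_, fun i j => ?_, hsys.integrable_outer_chi_lift, hsys.tendsto_variance,
    hsys.tendsto_iteratedSum hB, fun n hn => ⟨?_, ?_⟩⟩
  · filter_upwards [NUE.ae_summable_and_norm_chiBase_le h hτ hac hinv hτi hv h0] with y hy i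
    simp only [NUE.transferIter_succ_congr hτ₀ hY]
    exact hy.1 i
  · refine (NUE.integrable_outer hsys.memLp_mart hsys.memLp_mart i j).congr ?_
    filter_upwards [hm] with q hq
    rw [hq]
    rfl
  · refine (hsys.matNorm_variance_sub_le_rpow hp hτp rfl hn).trans ?_
    -- `momentConst` is the sum of the constants of the two estimates, so that one function serves
    -- both; each estimate discards the other's nonnegative term.
    gcongr
    exact le_add_of_nonneg_right (by positivity)
  · refine (hsys.matNorm_iteratedSum_sub_le_rpow hB hp hτp rfl hn).trans ?_
    gcongr
    exact le_add_of_nonneg_left (by positivity)
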